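/- **Conventions.** Let $g\ge 1$ and let $\Gamma$ be a chain of $g$ loops with bridges: the metric graph with vertices $w_0,\dots,w_g,v_1,\dots,v_{g+1}$, a bridge $\beta_k$ of length $n_k>0$ from $w_k$ to $v_{k+1}$ for $0\le k\le g$, and, for $1\le k\le g$, two edges of lengths $\ell_k>0$ and $m_k>0$ joining $v_k$ and $w_k$, which form the $k$th loop $\gamma_k$. For $C>0$, say that $\Gamma$ has *$C$-admissible* edge lengths if $$C\,\ell_{k+1}\le m_k,\qquad C\,m_k\le \ell_k,\qquad C\,\ell_k\le n_k,\qquad C\,n_k\le n_{k-1}$$ for all $k$ with $1\le k\le g$ (the first one for $k<g$). Let $\operatorname{PL}(\Gamma)$ be the set of continuous piecewise linear functions on $\Gamma$ with integer slopes. For $\varphi\in\operatorname{PL}(\Gamma)$ let $\operatorname{div}(\varphi)=\sum_x \operatorname{ord}_x(\varphi)\,x$, where $\operatorname{ord}_x(\varphi)$ is the sum of the incoming slopes of $\varphi$ at $x$. Divisors $D,D'$ on $\Gamma$ are equivalent if $D'-D=\operatorname{div}(\varphi)$ for some $\varphi\in\operatorname{PL}(\Gamma)$; the (Baker–Norine)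 rank of $D$, when nonnegative, is the largest $r$ such that $D-F$ is equivalent to an effective divisor for every effective $F$ of degree $r$. A divisor $D$ of degree $d$ is a *break divisor* if it is the sum of $d-g$ chips at $w_0$ and precisely one chip on each loop $\gamma_k$. The class of a divisor $D$ of rank $r$ is *vertex avoiding* if for every $0\le i\le r$ there is a unique effective divisor $D_i$ equivalent to $D$ with degree $r-i$ at $w_0$ and degree $i$ at $v_{g+1}$. Given functions $\psi_i$ on $\Gamma$ indexed by a finite set $I$ and real coefficients $c_i$, the function $\psi_i$ *achieves the minimum* at $x$ if $\psi_i(x)+c_i=\min_{j}\{\psi_j(x)+c_j\}$. The combination $\min_i\{\psi_i+c_i\}$ is *maximally independent* if each $\psi_i$ achieves the minimum uniquely at some point of $\Gamma$. The family $(\psi_i)_{i\in I}$ is *tropically dependent* if for some coefficients the minimum is achieved by at least two indices at every point of $\Gamma$, and *tropically independent* otherwise. **Theorem.** For every integer $\rho\ge 0$ there is a constant $C>0$ such that the following holds. Let $\Gamma$ be a chain of $g=21+\rho$ loops with $C$-admissible edge lengths, and let $D$ be a break divisor on $\Gamma$ of degree $24+\rho$ and rank $6$ whose class is vertex avoiding.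 For $0\le i\le 6$ let $D_i$ be the unique effective divisor equivalent to $D$ with degree $6-i$ at $w_0$ and degree $i$ at $v_{g+1}$, and let $\varphi_i\in\operatorname{PL}(\Gamma)$ be a function with $\operatorname{div}(\varphi_i)=D_i-D$. Then there are real numbers $c_{ij}$, $0\le i\le j\le 6$, such that the tropical linear combination $$\theta=\min_{0\le i\le j\le 6}\{\varphi_i+\varphi_j+c_{ij}\}$$ is maximally independent. In particular, the family of the $28$ functions $\varphi_i+\varphi_j$, $0\le i\le j\le 6$, is tropically independent. -/

import Mathlib

open scoped BigOperators

/-- A (finite) metric graph, presented by a model: finitely many vertices and oriented edges, each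
edge having a positive length. The orientation only serves to parametrize the edges. -/
structure MetricGraph (V E : Type) where
  tail : E → V
  head : E → V
  len : E → ℝ
  len_pos : ∀ e, 0 < len e

namespace MetricGraph

variable {V E : Type}

/-- The points of the metric graph: the vertices, and the interior points of the edges, where
`inner e t` lies on `e` at distance `t` from the tail. -/
inductive Point (G : MetricGraph V E) : Type
  | vert (v : V) : Point G
  | inner (e : E) (t : ℝ) (h₀ : 0 < t) (h₁ : t < G.len e) : Point G

/-- The arc length parametrization of the closed edge `e` by `[0, len e]`, from tail to head.
(It is only used for `t` in this interval; outside it is constant.) -/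
noncomputable def edgePoint (G : MetricGraph V E) (e : E) (t : ℝ) : G.Point :=
  if h₀ : 0 < t then
    if h₁ : t < G.len e then .inner e t h₀ h₁ else .vert (G.head e)
  else .vert (G.tail e)

/-- Near the point at distance `t` from the tail of `e`, in the direction of the head of `e`,
the function `f` is affine with outgoing slope `s`. -/
def HasFwdSlope (G : MetricGraph V E) (f : G.Point → ℝ) (e : E) (t : ℝ) (s : ℤ) : Prop :=
  ∃ ε : ℝ, 0 < ε ∧ ∀ u ∈ Set.Icc 0 ε,
    f (G.edgePoint e (t + u)) = f (G.edgePoint e t) + s * u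

/-- Near the point at distance `t` from the tail of `e`, in the direction of the tail of `e`,
the function `f` is affine with outgoing slope `s`. -/
def HasBwdSlope (G : MetricGraph V E) (f : G.Point → ℝ) (e : E) (t : ℝ) (s : ℤ) : Prop :=
  ∃ ε : ℝ, 0 < ε ∧ ∀ u ∈ Set.Icc 0 ε,
    f (G.edgePoint e (t - u)) = f (G.edgePoint e t) + s * u

/-- `PL(Γ)`: continuous piecewise linear functions with integer slopes. By compactness of the
edges it is the same to require that the function is affine with an integer slope near each point
in each tangent direction. -/
def IsPL (G : MetricGraph V E) (f : G.Point → ℝ) : Prop :=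
  ∀ e : E,
    (∀ t ∈ Set.Ico 0 (G.len e), ∃ s : ℤ, G.HasFwdSlope f e t s) ∧
    (∀ t ∈ Set.Ioc 0 (G.len e), ∃ s : ℤ, G.HasBwdSlope f e t s)

open Classical in
/-- The outgoing slope in forward direction (it is unique for `0 ≤ t < len e`; `0` if there is
none, which does not happen for `f ∈ PL(Γ)`). -/
noncomputable def fwdSlope (G : MetricGraph V E) (f : G.Point → ℝ) (e : E) (t : ℝ) : ℤ :=
  if h : ∃ s : ℤ, G.HasFwdSlope f e t s then h.choose else 0

open Classical in
/-- The outgoing slope in backward direction (it is unique for `0 < t ≤ len e`; `0` if there is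
none, which does not happen for `f ∈ PL(Γ)`). -/
noncomputable def bwdSlope (G : MetricGraph V E) (f : G.Point → ℝ) (e : E) (t : ℝ) : ℤ :=
  if h : ∃ s : ℤ, G.HasBwdSlope f e t s then h.choose else 0

open Classical in
/-- `ord_x(f)`: the sum of the incoming slopes of `f` at `x`, that is, minus the sum of the
outgoing slopes over all tangent directions at `x`. -/
noncomputable def ord [Fintype E] (G : MetricGraph V E) (f : G.Point → ℝ) : G.Point → ℤ
  | .vert v => -∑ e : E, ((if G.tail e = v then G.fwdSlope f e 0 else 0) +
      (if G.head e = v then G.bwdSlope f e (G.len e) else 0))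
  | .inner e t _ _ => -(G.fwdSlope f e t + G.bwdSlope f e t)

/-- Divisors: finite formal integer combinations of points. -/
abbrev Divisor (G : MetricGraph V E) : Type := G.Point →₀ ℤ

/-- The degree of a divisor. -/
def degree (G : MetricGraph V E) (D : G.Divisor) : ℤ := D.sum fun _ a => a

/-- `f ∈ PL(Γ)` and `div(f) = D' - D`. -/
def Moves [Fintype E] (G : MetricGraph V E) (f : G.Point → ℝ) (D D' : G.Divisor) : Prop :=
  G.IsPL f ∧ ∀ x, G.ord f x = D' x - D x

/-- Linear equivalence of divisors: the difference is the divisor of a function in `PL(Γ)`. -/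
def LinEquiv [Fintype E] (G : MetricGraph V E) (D D' : G.Divisor) : Prop :=
  ∃ f : G.Point → ℝ, G.Moves f D D'

/-- The Baker–Norine rank of `D` is at least `r`: for each effective `F` of degree `r`, the divisor
`D - F` is equivalent to an effective divisor. -/
def RankGE [Fintype E] (G : MetricGraph V E) (D : G.Divisor) (r : ℕ) : Prop :=
  ∀ F : G.Divisor, 0 ≤ F → G.degree F = r → ∃ D' : G.Divisor, 0 ≤ D' ∧ G.LinEquiv (D - F) D'

/-- The Baker–Norine rank of `D` is equal to `r`. -/
def HasRank [Fintype E] (G : MetricGraph V E) (D : G.Divisor) (r : ℕ) : Prop :=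
  G.RankGE D r ∧ ¬ G.RankGE D (r + 1)

end MetricGraph

/-- The edge lengths of a chain of `g` loops with bridges. The loop `γ_(k+1)` for `k : Fin g` has
top edge of length `l k` and bottom edge of length `m k`, and the bridge `β_k` has length `n k`
for `k : Fin (g + 1)`. -/
structure ChainOfLoops (g : ℕ) where
  l : Fin g → ℝ
  m : Fin g → ℝ
  n : Fin (g + 1) → ℝ
  l_pos : ∀ k, 0 < l k
  m_pos : ∀ k, 0 < m k
  n_pos : ∀ k, 0 < n k

namespace ChainOfLoops

/-- The vertices: `lft k` is `w_k`, the left end of the bridge `β_k`, and `rgt k` is `v_(k+1)`,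
its right end, for `0 ≤ k ≤ g`. -/
inductive Vertex (g : ℕ) : Type
  | lft (k : Fin (g + 1)) : Vertex g
  | rgt (k : Fin (g + 1)) : Vertex g

/-- The edges: the bridges `β_k` for `0 ≤ k ≤ g`, the top edges of the `g` loops, and the bottom
edges of the `g` loops. -/
abbrev Edge (g : ℕ) : Type := Fin (g + 1) ⊕ (Fin g ⊕ Fin g)

variable {g : ℕ}

/-- The chain of loops as a metric graph: the bridge `β_k` goes from `w_k` to `v_(k+1)`, and the
two edges of the loop `γ_(k+1)` go from `v_(k+1)` to `w_(k+1)`. -/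
def graph (Γ : ChainOfLoops g) : MetricGraph (Vertex g) (Edge g) where
  tail
    | .inl k => .lft k
    | .inr (.inl k) => .rgt k.castSucc
    | .inr (.inr k) => .rgt k.castSucc
  head
    | .inl k => .rgt k
    | .inr (.inl k) => .lft k.succ
    | .inr (.inr k) => .lft k.succ
  len
    | .inl k => Γ.n k
    | .inr (.inl k) => Γ.l k
    | .inr (.inr k) => Γ.m k
  len_pos
    | .inl k => Γ.n_pos k
    | .inr (.inl k) => Γ.l_pos k
    | .inr (.inr k) => Γ.m_pos k

/-- The points of the chain of loops. -/
abbrev Point (Γ : ChainOfLoops g) : Type := Γ.graph.Point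

/-- The left endpoint `w_0` of the chain. -/
def leftEnd (Γ : ChainOfLoops g) : Γ.Point := .vert (.lft 0)

/-- The right endpoint `v_(g+1)` of the chain. -/
def rightEnd (Γ : ChainOfLoops g) : Γ.Point := .vert (.rgt (Fin.last g))

/-- The closed loop `γ_(k+1)`, including its two vertices. -/
def loop (Γ : ChainOfLoops g) (k : Fin g) : Set Γ.Point :=
  {x | (∃ t ∈ Set.Icc 0 (Γ.l k), x = Γ.graph.edgePoint (.inr (.inl k)) t) ∨
    (∃ t ∈ Set.Icc 0 (Γ.m k), x = Γ.graph.edgePoint (.inr (.inr k)) t)}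

/-- Admissible edge lengths `ℓ_(k+1) ≪ m_k ≪ ℓ_k ≪ n_k ≪ n_(k-1)` for all `k`, where `a ≪ b` means
that `C * a ≤ b`. (Here `k : Fin g` stands for the loop `γ_(k+1)`, whose left and right bridges
have lengths `n k.castSucc` and `n k.succ`.) -/
def Admissible (Γ : ChainOfLoops g) (C : ℝ) : Prop :=
  (∀ k k' : Fin g, (k' : ℕ) = k + 1 → C * Γ.l k' ≤ Γ.m k) ∧
  (∀ k : Fin g, C * Γ.m k ≤ Γ.l k ∧ C * Γ.l k ≤ Γ.n k.succ ∧ C * Γ.n k.succ ≤ Γ.n k.castSucc)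

/-- `D` is a break divisor: it consists of `deg D - g` chips at `w_0` and precisely one chip on
each of the `g` loops. -/
def IsBreak (Γ : ChainOfLoops g) (D : Γ.graph.Divisor) : Prop :=
  ∃ x : Fin g → Γ.Point, (∀ k, x k ∈ Γ.loop k) ∧
    D = Finsupp.single Γ.leftEnd (Γ.graph.degree D - g) + ∑ k : Fin g, Finsupp.single (x k) 1

/-- `F` is an effective divisor in the class of `D`, of degree `r - i` at `w_0` and of degree `i`
at `v_(g+1)`. -/
def IsDistinguished (Γ : ChainOfLoops g) (D : Γ.graph.Divisor) (r i : ℕ) (F : Γ.graph.Divisor) :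
    Prop :=
  0 ≤ F ∧ Γ.graph.LinEquiv D F ∧ F Γ.leftEnd = (r : ℤ) - i ∧ F Γ.rightEnd = i

/-- The class of `D`, a divisor of rank `r`, is vertex avoiding: for each `0 ≤ i ≤ r` there is
a unique effective divisor `D_i` in this class with degree `r - i` at `w_0` and degree `i` at
`v_(g+1)`. Because all points of a closed bridge are linearly equivalent, uniqueness implies that
no `D_i` has a chip at any of the other vertices `v_k`, `w_k` with `1 ≤ k ≤ g`. -/
def VertexAvoiding (Γ : ChainOfLoops g) (D : Γ.graph.Divisor) (r : ℕ) : Prop :=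
  ∀ i : ℕ, i ≤ r → ∃! F : Γ.graph.Divisor, Γ.IsDistinguished D r i F

end ChainOfLoops

namespace TropicalCombination

variable {X ι : Type}

/-- In the tropical linear combination `min_i (ψ_i + c_i)`, the function `ψ_i` achieves the
minimum at `x`. -/
def Achieves (ψ : ι → X → ℝ) (c : ι → ℝ) (i : ι) (x : X) : Prop :=
  ∀ j, ψ i x + c i ≤ ψ j x + c j

/-- `min_i (ψ_i + c_i)` is maximally independent: each `ψ_i` achieves the minimum uniquely at some
point. -/
def MaximallyIndependent (ψ : ι → X → ℝ) (c : ι → ℝ) : Prop :=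
  ∀ i, ∃ x, Achieves ψ c i x ∧ ∀ j, j ≠ i → ¬ Achieves ψ c j x

/-- The family is tropically dependent: for some coefficients the minimum is achieved at least
twice at every point. -/
def TropicallyDependent (ψ : ι → X → ℝ) : Prop :=
  ∃ c : ι → ℝ, ∀ x, ∃ i j, i ≠ j ∧ Achieves ψ c i x ∧ Achieves ψ c j x

end TropicalCombination

/-!
# Tropical independence of the pairwise sums `φ i + φ j` on a chain of loops

Uniqueness of the distinguished divisors makes them rigid: a chip on a bridge, or two chips on a
loop, could be moved without touching the ends of the chain. Hence each `φ i` is affine on every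
bridge, and its slope increases by one at a loop on which `E i` has no chip, and otherwise
stays the same (`VASystem.loop_shape`, `VASystem.slope_succ`). The slopes on a bridge are distinct
and increasing in `i` (`VASystem.slope_strictMono`); they run from `i - 3` to `i`, and since the
bottom edges are short, at most one of them jumps at each loop (`VASystem.jump_unique`). So the
slopes form a `SlopePath` with `21` jumps.

The combination is to look like a concave function whose slope on the bridges decreases from `6` to
`0`. The chain is cut into seven blocks accordingly, and each of the `28` sums is assigned to one
block `σ` and to one station in it: a loop with a jump or, for one sum per block, the bridge at the
end of the block. A counting argument, which is reduced to a check of the `120` possible slope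
vectors (`blockBounds_table`), shows that at each jump in a block there are two or three unassigned
sums of slope at least `σ`; one of these is assigned to the loop (`SlopePath.exists_schedule`). It
is the sum whose slope jumps above `σ`, if there is one. Otherwise the two or three sums have the
same slope, and one of them is strictly smaller than the others somewhere on the loop when
they are aligned at its right end (`exists_loop_winner`). This can be decided from the slopes alone,
because the chips sit on the top edge, at integer multiples of the length of the bottom edge from
one of its ends (`VASystem.loop_values`).

The coefficients are chosen so that each sum meets the line of its block next to its station, up to
an offset comparable to the short edge of the loop. Before its station, a sum has slope at most `σ`,
afterwards at least `σ`, so that it lies above the line of its block elsewhere, up to errors made on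
loops, and this line lies above the lines of the other blocks in their regions. As the
lengths decrease rapidly, the errors are negligible (`lt_of_loop_station`, `lt_of_bridge_station`).
Thus each sum achieves the minimum uniquely at its station. Finally, a maximally independent
combination precludes tropical dependence for any other coefficients, by looking at the index whose
coefficient drops the most.
-/

/-! ### Slopes of functions on an interval -/

/-- The function `h` is affine with slope `s` on a right neighbourhood of `t`. -/
def RightSlope (h : ℝ → ℝ) (t : ℝ) (s : ℤ) : Prop :=
  ∃ ε : ℝ, 0 < ε ∧ ∀ u ∈ Set.Icc 0 ε, h (t + u) = h t + s * u

/-- The function `h` is affine on a left neighbourhood of `t`, where its slope in the leftward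
direction is `s`. -/
def LeftSlope (h : ℝ → ℝ) (t : ℝ) (s : ℤ) : Prop :=
  ∃ ε : ℝ, 0 < ε ∧ ∀ u ∈ Set.Icc 0 ε, h (t - u) = h t + s * u

theorem RightSlope.unique {h : ℝ → ℝ} {t : ℝ} {s s' : ℤ} (H : RightSlope h t s)
    (H' : RightSlope h t s') : s = s' := by
  obtain ⟨ε, hε, h1⟩ := H
  obtain ⟨ε', hε', h2⟩ := H'
  have hm : 0 < min ε ε' := lt_min hε hε'
  have e1 := h1 (min ε ε') ⟨hm.le, min_le_left _ _⟩
  have e2 := h2 (min ε ε') ⟨hm.le, min_le_right _ _⟩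
  have : (s : ℝ) = s' := by
    have : (s : ℝ) * min ε ε' = s' * min ε ε' := by linarith
    exact mul_right_cancel₀ hm.ne' this
  exact_mod_cast this

theorem LeftSlope.unique {h : ℝ → ℝ} {t : ℝ} {s s' : ℤ} (H : LeftSlope h t s)
    (H' : LeftSlope h t s') : s = s' := by
  obtain ⟨ε, hε, h1⟩ := H
  obtain ⟨ε', hε', h2⟩ := H'
  have hm : 0 < min ε ε' := lt_min hε hε'
  have e1 := h1 (min ε ε') ⟨hm.le, min_le_left _ _⟩
  have e2 := h2 (min ε ε') ⟨hm.le, min_le_right _ _⟩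
  have : (s : ℝ) = s' := by
    have : (s : ℝ) * min ε ε' = s' * min ε ε' := by linarith
    exact mul_right_cancel₀ hm.ne' this
  exact_mod_cast this

theorem RightSlope.add {h h' : ℝ → ℝ} {t : ℝ} {s s' : ℤ} (H : RightSlope h t s)
    (H' : RightSlope h' t s') : RightSlope (fun u => h u + h' u) t (s + s') := by
  obtain ⟨ε, hε, h1⟩ := H
  obtain ⟨ε', hε', h2⟩ := H'
  refine ⟨min ε ε', lt_min hε hε', fun u hu => ?_⟩
  have e1 := h1 u ⟨hu.1, hu.2.trans (min_le_left _ _)⟩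
  have e2 := h2 u ⟨hu.1, hu.2.trans (min_le_right _ _)⟩
  simp only [e1, e2]; push_cast; ring

theorem LeftSlope.add {h h' : ℝ → ℝ} {t : ℝ} {s s' : ℤ} (H : LeftSlope h t s)
    (H' : LeftSlope h' t s') : LeftSlope (fun u => h u + h' u) t (s + s') := by
  obtain ⟨ε, hε, h1⟩ := H
  obtain ⟨ε', hε', h2⟩ := H'
  refine ⟨min ε ε', lt_min hε hε', fun u hu => ?_⟩
  have e1 := h1 u ⟨hu.1, hu.2.trans (min_le_left _ _)⟩
  have e2 := h2 u ⟨hu.1, hu.2.trans (min_le_right _ _)⟩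
  simp only [e1, e2]; push_cast; ring

theorem RightSlope.smul {h : ℝ → ℝ} {t : ℝ} {s : ℤ} (c : ℤ) (H : RightSlope h t s) :
    RightSlope (fun u => c * h u) t (c * s) := by
  obtain ⟨ε, hε, h1⟩ := H
  refine ⟨ε, hε, fun u hu => ?_⟩
  simp only [h1 u hu]; push_cast; ring

theorem LeftSlope.smul {h : ℝ → ℝ} {t : ℝ} {s : ℤ} (c : ℤ) (H : LeftSlope h t s) :
    LeftSlope (fun u => c * h u) t (c * s) := by
  obtain ⟨ε, hε, h1⟩ := H
  refine ⟨ε, hε, fun u hu => ?_⟩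
  simp only [h1 u hu]; push_cast; ring

theorem RightSlope.sub {h h' : ℝ → ℝ} {t : ℝ} {s s' : ℤ} (H : RightSlope h t s)
    (H' : RightSlope h' t s') : RightSlope (fun u => h u - h' u) t (s - s') := by
  have := H.add (H'.smul (-1))
  simpa [sub_eq_add_neg] using this

theorem LeftSlope.sub {h h' : ℝ → ℝ} {t : ℝ} {s s' : ℤ} (H : LeftSlope h t s)
    (H' : LeftSlope h' t s') : LeftSlope (fun u => h u - h' u) t (s - s') := by
  have := H.add (H'.smul (-1))
  simpa [sub_eq_add_neg] using this

theorem rightSlope_const (c t : ℝ) : RightSlope (fun _ => c) t 0 :=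
  ⟨1, one_pos, fun u _ => by simp⟩

theorem leftSlope_const (c t : ℝ) : LeftSlope (fun _ => c) t 0 :=
  ⟨1, one_pos, fun u _ => by simp⟩

theorem rightSlope_linear (s : ℤ) (t : ℝ) : RightSlope (fun u => s * u) t s :=
  ⟨1, one_pos, fun u _ => by ring⟩

theorem leftSlope_linear (s : ℤ) (t : ℝ) : LeftSlope (fun u => s * u) t (-s) :=
  ⟨1, one_pos, fun u _ => by push_cast; ring⟩

theorem RightSlope.congr {h h' : ℝ → ℝ} {t η : ℝ} {s : ℤ} (H : RightSlope h t s) (hη : 0 < η)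
    (e : ∀ u ∈ Set.Icc t (t + η), h' u = h u) : RightSlope h' t s := by
  obtain ⟨ε, hε, h1⟩ := H
  refine ⟨min ε η, lt_min hε hη, fun u hu => ?_⟩
  have e1 := h1 u ⟨hu.1, hu.2.trans (min_le_left _ _)⟩
  have h3 := hu.2.trans (min_le_right _ _)
  rw [e _ ⟨by linarith [hu.1], by linarith⟩, e t ⟨le_rfl, by linarith⟩, e1]

theorem LeftSlope.congr {h h' : ℝ → ℝ} {t η : ℝ} {s : ℤ} (H : LeftSlope h t s) (hη : 0 < η)
    (e : ∀ u ∈ Set.Icc (t - η) t, h' u = h u) : LeftSlope h' t s := by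
  obtain ⟨ε, hε, h1⟩ := H
  refine ⟨min ε η, lt_min hε hη, fun u hu => ?_⟩
  have e1 := h1 u ⟨hu.1, hu.2.trans (min_le_left _ _)⟩
  have h3 := hu.2.trans (min_le_right _ _)
  rw [e _ ⟨by linarith, by linarith [hu.1]⟩, e t ⟨by linarith, le_rfl⟩, e1]

/-- The function which is zero up to `p` and has slope `1` from there on. -/
noncomputable def ramp (p u : ℝ) : ℝ := max 0 (u - p)

theorem ramp_of_le {p u : ℝ} (h : u ≤ p) : ramp p u = 0 := max_eq_left (by linarith)

theorem ramp_of_ge {p u : ℝ} (h : p ≤ u) : ramp p u = u - p := max_eq_right (by linarith)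

theorem rightSlope_ramp (p t : ℝ) : RightSlope (ramp p) t (if p ≤ t then 1 else 0) := by
  split_ifs with h
  · refine ⟨1, one_pos, fun u hu => ?_⟩
    rw [ramp_of_ge (by linarith [hu.1]), ramp_of_ge h]; push_cast; ring
  · push Not at h
    refine ⟨p - t, by linarith, fun u hu => ?_⟩
    rw [ramp_of_le (by linarith [hu.2]), ramp_of_le h.le]; simp

theorem leftSlope_ramp (p t : ℝ) : LeftSlope (ramp p) t (if p < t then -1 else 0) := by
  split_ifs with h
  · refine ⟨t - p, by linarith, fun u hu => ?_⟩
    rw [ramp_of_ge (by linarith [hu.2]), ramp_of_ge h.le]; push_cast; ring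
  · push Not at h
    refine ⟨1, one_pos, fun u hu => ?_⟩
    rw [ramp_of_le (by linarith [hu.1]), ramp_of_le h]; simp

/-- A piecewise linear function on `[0, L]` without kinks in the interior is affine. -/
theorem affine_of_no_kink {h : ℝ → ℝ} {L : ℝ} (hL : 0 < L) {s : ℤ} (h0 : RightSlope h 0 s)
    (hL' : ∃ l, LeftSlope h L l)
    (hk : ∀ t, 0 < t → t < L → ∃ r l, RightSlope h t r ∧ LeftSlope h t l ∧ r + l = 0) :
    ∀ t ∈ Set.Icc 0 L, h t = h 0 + s * t := by
  set S : Set ℝ := {t | t ≤ L ∧ ∀ u ∈ Set.Icc 0 t, h u = h 0 + s * u} with hS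
  obtain ⟨ε, hε, he⟩ := h0
  have hεS : min ε L ∈ S := by
    refine ⟨min_le_right _ _, fun u hu => ?_⟩
    have := he u ⟨hu.1, hu.2.trans (min_le_left _ _)⟩
    simpa using this
  have hbdd : BddAbove S := ⟨L, fun t ht => ht.1⟩
  set τ := sSup S with hτ
  have hτ0 : 0 < τ := (lt_min hε hL).trans_le (le_csSup hbdd hεS)
  have hτL : τ ≤ L := csSup_le ⟨_, hεS⟩ fun t ht => ht.1
  have hlt : ∀ u, 0 ≤ u → u < τ → h u = h 0 + s * u := by
    intro u hu0 hu
    obtain ⟨t, htS, ht⟩ := exists_lt_of_lt_csSup ⟨_, hεS⟩ hu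
    exact htS.2 u ⟨hu0, ht.le⟩
  have hleft : ∀ l, LeftSlope h τ l → l = -s ∧ h τ = h 0 + s * τ := by
    rintro l ⟨η, hη, hl⟩
    set m := min η τ with hm
    have hm0 : 0 < m := lt_min hη hτ0
    have h1 := hl m ⟨hm0.le, min_le_left _ _⟩
    have h2 := hl (m / 2) ⟨by linarith, by linarith [min_le_left η τ]⟩
    rw [hlt _ (by linarith [min_le_right η τ]) (by linarith)] at h1
    rw [hlt _ (by linarith [min_le_right η τ]) (by linarith)] at h2
    have h3 : (l : ℝ) = -s := by
      have : (l : ℝ) * m = -s * m := by linarith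
      exact mul_right_cancel₀ hm0.ne' this
    refine ⟨by exact_mod_cast h3, ?_⟩
    rw [h3] at h1
    linarith
  have hτeq : h τ = h 0 + s * τ ∧ τ = L := by
    rcases hτL.lt_or_eq with hlt' | heq
    · exfalso
      obtain ⟨r, l, hr, hl, hrl⟩ := hk τ hτ0 hlt'
      obtain ⟨hl1, hl2⟩ := hleft l hl
      obtain ⟨η, hη, hr⟩ := hr
      have hrs : r = s := by omega
      subst hrs
      set m := min η (L - τ) with hm
      have hm0 : 0 < m := lt_min hη (by linarith)
      have : τ + m ∈ S := by
        refine ⟨by linarith [min_le_right η (L - τ)], fun u hu => ?_⟩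
        rcases lt_or_ge u τ with hu1 | hu1
        · exact hlt u hu.1 hu1
        · have := hr (u - τ) ⟨by linarith, by linarith [hu.2, min_le_left η (L - τ)]⟩
          rw [show τ + (u - τ) = u by ring] at this
          rw [this, hl2]; ring
      linarith [le_csSup hbdd this]
    · obtain ⟨l, hl⟩ := hL'
      exact ⟨(hleft l (heq ▸ hl)).2, heq⟩
  intro t ht
  rcases lt_or_ge t τ with h1 | h1
  · exact hlt t ht.1 h1
  · have : t = τ := le_antisymm (ht.2.trans hτeq.2.ge) h1
    rw [this]; exact hτeq.1

/-! ### Piecewise linear functions on metric graphs -/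

theorem RightSlope.sum {ι : Type} (S : Finset ι) {h : ι → ℝ → ℝ} {t : ℝ} {s : ι → ℤ}
    (H : ∀ i, RightSlope (h i) t (s i)) : RightSlope (fun u => ∑ i ∈ S, h i u) t (∑ i ∈ S, s i) := by
  classical
  induction S using Finset.induction_on with
  | empty => simpa using rightSlope_const 0 t
  | insert i S hi ih => simpa [Finset.sum_insert hi] using (H i).add ih

theorem LeftSlope.sum {ι : Type} (S : Finset ι) {h : ι → ℝ → ℝ} {t : ℝ} {s : ι → ℤ}
    (H : ∀ i, LeftSlope (h i) t (s i)) : LeftSlope (fun u => ∑ i ∈ S, h i u) t (∑ i ∈ S, s i) := by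
  classical
  induction S using Finset.induction_on with
  | empty => simpa using leftSlope_const 0 t
  | insert i S hi ih => simpa [Finset.sum_insert hi] using (H i).add ih

namespace MetricGraph

variable {V E : Type} (G : MetricGraph V E)

theorem edgePoint_zero (e : E) : G.edgePoint e 0 = .vert (G.tail e) := by simp [edgePoint]

theorem edgePoint_len (e : E) : G.edgePoint e (G.len e) = .vert (G.head e) := by
  simp [edgePoint, G.len_pos e]

theorem edgePoint_of_mem (e : E) {t : ℝ} (h0 : 0 < t) (h1 : t < G.len e) :
    G.edgePoint e t = .inner e t h0 h1 := by simp [edgePoint, h0, h1]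

theorem edgePoint_eq_inner_iff (e e' : E) (b : ℝ) {t : ℝ} (h0 : 0 < t) (h1 : t < G.len e') :
    G.edgePoint e b = .inner e' t h0 h1 ↔ e = e' ∧ b = t := by
  constructor
  · intro h
    unfold edgePoint at h
    split_ifs at h with h2 h3
    simpa using h
  · rintro ⟨rfl, rfl⟩
    exact G.edgePoint_of_mem _ h0 h1

theorem fwdSlope_eq {G : MetricGraph V E} {f : G.Point → ℝ} {e : E} {t : ℝ} {s : ℤ}
    (h : G.HasFwdSlope f e t s) : G.fwdSlope f e t = s := by
  have hex : ∃ s, G.HasFwdSlope f e t s := ⟨s, h⟩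
  rw [fwdSlope, dif_pos hex]
  exact RightSlope.unique (h := fun u => f (G.edgePoint e u)) hex.choose_spec h

theorem bwdSlope_eq {G : MetricGraph V E} {f : G.Point → ℝ} {e : E} {t : ℝ} {s : ℤ}
    (h : G.HasBwdSlope f e t s) : G.bwdSlope f e t = s := by
  have hex : ∃ s, G.HasBwdSlope f e t s := ⟨s, h⟩
  rw [bwdSlope, dif_pos hex]
  exact LeftSlope.unique (h := fun u => f (G.edgePoint e u)) hex.choose_spec h

variable {G}

theorem IsPL.hasFwdSlope {f : G.Point → ℝ} (hf : G.IsPL f) {e : E} {t : ℝ} (h0 : 0 ≤ t)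
    (h1 : t < G.len e) : RightSlope (fun u => f (G.edgePoint e u)) t (G.fwdSlope f e t) := by
  obtain ⟨s, hs⟩ := (hf e).1 t ⟨h0, h1⟩
  rw [fwdSlope_eq hs]; exact hs

theorem IsPL.hasBwdSlope {f : G.Point → ℝ} (hf : G.IsPL f) {e : E} {t : ℝ} (h0 : 0 < t)
    (h1 : t ≤ G.len e) : LeftSlope (fun u => f (G.edgePoint e u)) t (G.bwdSlope f e t) := by
  obtain ⟨s, hs⟩ := (hf e).2 t ⟨h0, h1⟩
  rw [bwdSlope_eq hs]; exact hs

variable (G) in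
/-- The function `f` has the outgoing slopes `R` in forward and `L` in backward direction along
all edges. -/
def HasSlopes (f : G.Point → ℝ) (R L : E → ℝ → ℤ) : Prop :=
  (∀ e t, 0 ≤ t → t < G.len e → RightSlope (fun u => f (G.edgePoint e u)) t (R e t)) ∧
  (∀ e t, 0 < t → t ≤ G.len e → LeftSlope (fun u => f (G.edgePoint e u)) t (L e t))

theorem IsPL.hasSlopes {f : G.Point → ℝ} (hf : G.IsPL f) :
    G.HasSlopes f (G.fwdSlope f) (G.bwdSlope f) :=
  ⟨fun _ _ h0 h1 => hf.hasFwdSlope h0 h1, fun _ _ h0 h1 => hf.hasBwdSlope h0 h1⟩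

theorem HasSlopes.isPL {f : G.Point → ℝ} {R L : E → ℝ → ℤ} (h : G.HasSlopes f R L) : G.IsPL f :=
  fun e => ⟨fun t ht => ⟨_, h.1 e t ht.1 ht.2⟩, fun t ht => ⟨_, h.2 e t ht.1 ht.2⟩⟩

theorem HasSlopes.fwdSlope_eq {f : G.Point → ℝ} {R L : E → ℝ → ℤ} (h : G.HasSlopes f R L) {e : E}
    {t : ℝ} (h0 : 0 ≤ t) (h1 : t < G.len e) : G.fwdSlope f e t = R e t :=
  MetricGraph.fwdSlope_eq (h.1 e t h0 h1)

theorem HasSlopes.bwdSlope_eq {f : G.Point → ℝ} {R L : E → ℝ → ℤ} (h : G.HasSlopes f R L) {e : E}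
    {t : ℝ} (h0 : 0 < t) (h1 : t ≤ G.len e) : G.bwdSlope f e t = L e t :=
  MetricGraph.bwdSlope_eq (h.2 e t h0 h1)

theorem HasSlopes.add {f f' : G.Point → ℝ} {R L R' L' : E → ℝ → ℤ} (h : G.HasSlopes f R L)
    (h' : G.HasSlopes f' R' L') :
    G.HasSlopes (fun x => f x + f' x) (fun e t => R e t + R' e t) (fun e t => L e t + L' e t) :=
  ⟨fun e t h0 h1 => (h.1 e t h0 h1).add (h'.1 e t h0 h1),
    fun e t h0 h1 => (h.2 e t h0 h1).add (h'.2 e t h0 h1)⟩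

open Classical in
theorem HasSlopes.ord_vert [Fintype E] {f : G.Point → ℝ} {R L : E → ℝ → ℤ}
    (h : G.HasSlopes f R L) (v : V) :
    G.ord f (.vert v) = -∑ e : E, ((if G.tail e = v then R e 0 else 0) +
      (if G.head e = v then L e (G.len e) else 0)) := by
  simp only [ord]
  congr 1
  refine Finset.sum_congr rfl fun e _ => ?_
  rw [h.fwdSlope_eq le_rfl (G.len_pos e), h.bwdSlope_eq (G.len_pos e) le_rfl]

theorem HasSlopes.ord_inner [Fintype E] {f : G.Point → ℝ} {R L : E → ℝ → ℤ}
    (h : G.HasSlopes f R L) (e : E) (t : ℝ) (h0 h1) :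
    G.ord f (.inner e t h0 h1) = -(R e t + L e t) := by
  simp only [ord]
  rw [h.fwdSlope_eq h0.le h1, h.bwdSlope_eq h0 h1.le]

theorem IsPL.add {f f' : G.Point → ℝ} (hf : G.IsPL f) (hf' : G.IsPL f') :
    G.IsPL (fun x => f x + f' x) := (hf.hasSlopes.add hf'.hasSlopes).isPL

theorem ord_add [Fintype E] {f f' : G.Point → ℝ} (hf : G.IsPL f) (hf' : G.IsPL f') (x : G.Point) :
    G.ord (fun x => f x + f' x) x = G.ord f x + G.ord f' x := by
  classical
  have h := hf.hasSlopes.add hf'.hasSlopes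
  cases x with
  | vert v =>
    rw [h.ord_vert, hf.hasSlopes.ord_vert, hf'.hasSlopes.ord_vert, ← neg_add,
      ← Finset.sum_add_distrib]
    congr 1
    refine Finset.sum_congr rfl fun e _ => ?_
    split_ifs <;> ring
  | inner e t h0 h1 =>
    rw [h.ord_inner, hf.hasSlopes.ord_inner, hf'.hasSlopes.ord_inner]; ring

/-- Adding a function to one that moves `D` to `D'` moves the divisor further. -/
theorem Moves.add [Fintype E] {f χ : G.Point → ℝ} {D D' : G.Divisor} (hf : G.Moves f D D')
    (hχ : G.IsPL χ) (F : G.Divisor) (hF : ∀ x, G.ord χ x = F x) :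
    G.Moves (fun x => f x + χ x) D (D' + F) := by
  refine ⟨hf.1.add hχ, fun x => ?_⟩
  rw [ord_add hf.1 hχ, hf.2, hF, Finsupp.add_apply]; ring

variable (G) in
/-- The function given by its values at the vertices and its restrictions to the edges. The
endpoints of an edge take their values from `val`. -/
def ofEdges (val : V → ℝ) (ef : E → ℝ → ℝ) : G.Point → ℝ
  | .vert v => val v
  | .inner e t _ _ => ef e t

theorem ofEdges_edgePoint {val : V → ℝ} {ef : E → ℝ → ℝ} {e : E} (h0 : ef e 0 = val (G.tail e))
    (h1 : ef e (G.len e) = val (G.head e)) {t : ℝ} (ht : t ∈ Set.Icc 0 (G.len e)) :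
    G.ofEdges val ef (G.edgePoint e t) = ef e t := by
  rcases ht.1.eq_or_lt with rfl | ht0
  · rw [edgePoint_zero, h0]; rfl
  rcases ht.2.eq_or_lt with rfl | ht1
  · rw [edgePoint_len, h1]; rfl
  rw [G.edgePoint_of_mem e ht0 ht1]; rfl

theorem hasSlopes_ofEdges {val : V → ℝ} {ef : E → ℝ → ℝ} (h0 : ∀ e, ef e 0 = val (G.tail e))
    (h1 : ∀ e, ef e (G.len e) = val (G.head e)) {R L : E → ℝ → ℤ}
    (hR : ∀ e t, 0 ≤ t → t < G.len e → RightSlope (ef e) t (R e t))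
    (hL : ∀ e t, 0 < t → t ≤ G.len e → LeftSlope (ef e) t (L e t)) :
    G.HasSlopes (G.ofEdges val ef) R L := by
  refine ⟨fun e t ht0 ht1 => (hR e t ht0 ht1).congr (η := G.len e - t) (by linarith) ?_,
    fun e t ht0 ht1 => (hL e t ht0 ht1).congr (η := t) ht0 ?_⟩
  · exact fun u hu => ofEdges_edgePoint (h0 e) (h1 e) ⟨ht0.trans hu.1, by linarith [hu.2]⟩
  · exact fun u hu => ofEdges_edgePoint (h0 e) (h1 e) ⟨by linarith [hu.1], by linarith [hu.2]⟩

/-- Chips may be moved along edges: for finitely many points at position `a i` on the edge `e i`,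
some function moves `μ i` chips from there to the position `a i + δ`, provided that the
resulting jumps along the edges are the differences of a function `val` on the vertices. -/
theorem exists_moving [Fintype E] {ι : Type} [Fintype ι] (e : ι → E) (a : ι → ℝ) (μ : ι → ℤ)
    {δ : ℝ} (hδ : 0 < δ) (ha : ∀ i, 0 ≤ a i) (ha' : ∀ i, a i + δ ≤ G.len (e i)) (val : V → ℝ)
    (hval : ∀ e', val (G.head e') = val (G.tail e') +
      ∑ i, open Classical in if e i = e' then μ i * δ else 0) :
    ∃ χ : G.Point → ℝ, G.IsPL χ ∧ ∀ x, G.ord χ x =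
      (∑ i, (Finsupp.single (G.edgePoint (e i) (a i + δ)) (μ i) -
        Finsupp.single (G.edgePoint (e i) (a i)) (μ i)) : G.Divisor) x := by
  classical
  have hlt : ∀ i, a i < G.len (e i) := fun i => by linarith [ha' i]
  set ef : E → ℝ → ℝ := fun e' u => val (G.tail e') +
    ∑ i, (if e i = e' then μ i else 0 : ℤ) * (ramp (a i) u - ramp (a i + δ) u) with hef
  have h0 : ∀ e', ef e' 0 = val (G.tail e') := by
    intro e'
    simp only [hef]
    rw [Finset.sum_eq_zero, add_zero]
    intro i _
    rw [ramp_of_le (ha i), ramp_of_le (by linarith [ha i])]; ring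
  have h1 : ∀ e', ef e' (G.len e') = val (G.head e') := by
    intro e'
    simp only [hef, hval e']
    congr 1
    refine Finset.sum_congr rfl fun i _ => ?_
    split_ifs with hi
    · subst hi
      rw [ramp_of_ge (hlt i).le, ramp_of_ge (ha' i)]; ring
    · simp
  have hs := hasSlopes_ofEdges h0 h1
    (R := fun e' t => 0 + ∑ i, (if e i = e' then μ i else 0 : ℤ) *
      ((if a i ≤ t then 1 else 0) - (if a i + δ ≤ t then 1 else 0)))
    (L := fun e' t => 0 + ∑ i, (if e i = e' then μ i else 0 : ℤ) *
      ((if a i < t then -1 else 0) - (if a i + δ < t then -1 else 0)))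
    (fun e' t _ _ => (rightSlope_const _ _).add (RightSlope.sum _ fun i =>
      ((rightSlope_ramp _ _).sub (rightSlope_ramp _ _)).smul _))
    (fun e' t _ _ => (leftSlope_const _ _).add (LeftSlope.sum _ fun i =>
      ((leftSlope_ramp _ _).sub (leftSlope_ramp _ _)).smul _))
  refine ⟨_, hs.isPL, fun x => ?_⟩
  rw [Finsupp.finsetSum_apply]
  cases x with
  | vert v =>
    rw [hs.ord_vert]
    simp only [zero_add]
    have : ∀ e', ((if G.tail e' = v then ∑ i, (if e i = e' then μ i else 0 : ℤ) *
        ((if a i ≤ 0 then 1 else 0) - (if a i + δ ≤ 0 then 1 else 0)) else 0) +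
        (if G.head e' = v then ∑ i, (if e i = e' then μ i else 0 : ℤ) *
          ((if a i < G.len e' then -1 else 0) - (if a i + δ < G.len e' then -1 else 0)) else 0)) =
        ∑ i, if e i = e' then ((if G.tail e' = v then μ i *
          ((if a i ≤ 0 then 1 else 0) - (if a i + δ ≤ 0 then 1 else 0)) else 0) +
          (if G.head e' = v then μ i *
          ((if a i < G.len e' then -1 else 0) - (if a i + δ < G.len e' then -1 else 0)) else 0))
          else 0 := by
      intro e'
      split_ifs with h2 h3 h3
      · rw [← Finset.sum_add_distrib]
        refine Finset.sum_congr rfl fun i _ => ?_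
        split_ifs <;> simp
      · rw [add_zero]
        refine Finset.sum_congr rfl fun i _ => ?_
        split_ifs <;> simp
      · rw [zero_add]
        refine Finset.sum_congr rfl fun i _ => ?_
        split_ifs <;> simp
      · simp
    rw [Finset.sum_congr rfl fun e' _ => this e', Finset.sum_comm, ← Finset.sum_neg_distrib]
    refine Finset.sum_congr rfl fun i _ => ?_
    rw [Finset.sum_ite_eq Finset.univ (e i)]
    simp only [Finset.mem_univ, if_true, Finsupp.sub_apply, Finsupp.single_apply]
    have e1 : ¬ (a i + δ ≤ 0) := by linarith [ha i]
    have e2 : (G.edgePoint (e i) (a i + δ) = .vert v) ↔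
        (G.head (e i) = v ∧ ¬ (a i + δ < G.len (e i))) := by
      unfold edgePoint
      rw [dif_pos (by linarith [ha i])]
      split_ifs with h <;> simp [h]
    have e3 : (G.edgePoint (e i) (a i) = .vert v) ↔ (G.tail (e i) = v ∧ a i ≤ 0) := by
      unfold edgePoint
      split_ifs with h h'
      · simp [h]
      · exact absurd (hlt i) h'
      · simp [not_lt.1 h]
    simp only [e1, e2, e3, hlt i, if_true, if_false]
    by_cases c1 : G.tail (e i) = v <;> by_cases c2 : G.head (e i) = v <;>
      by_cases c3 : a i ≤ 0 <;> by_cases c4 : a i + δ < G.len (e i) <;> simp [c1, c2, c3, c4]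
  | inner e' t h0 h1 =>
    rw [hs.ord_inner, zero_add, zero_add, ← Finset.sum_add_distrib, ← Finset.sum_neg_distrib]
    refine Finset.sum_congr rfl fun i _ => ?_
    simp only [Finsupp.sub_apply, Finsupp.single_apply, edgePoint_eq_inner_iff]
    by_cases c1 : e i = e'
    · simp only [c1, if_true, true_and]
      have key : ∀ p : ℝ, ((if p = t then 1 else 0 : ℤ)) =
          (if p ≤ t then 1 else 0) + (if p < t then -1 else 0) := by
        intro p
        rcases lt_trichotomy p t with c | c | c
        · simp [c, c.le, c.ne]
        · simp [c]
        · simp [c.not_ge, c.not_gt, c.ne']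
      have key' : ∀ p : ℝ, (if p = t then μ i else 0 : ℤ) = μ i * if p = t then 1 else 0 := by
        intro p; simp
      rw [key', key', key, key]
      ring
    · simp [c1]

end MetricGraph

/-! ### Chips as kinks -/

/-- The function `h` on `[0, L]` vanishes to first order at `0`, has slope `N` at `L`, and its
slope increases by `e t` at each interior point `t`. -/
structure IsChipProfile (e : ℝ → ℤ) (L : ℝ) (h : ℝ → ℝ) (N : ℤ) : Prop where
  zero : h 0 = 0
  right : RightSlope h 0 0
  left : LeftSlope h L (-N)
  kink : ∀ t, 0 < t → t < L → ∃ r l, RightSlope h t r ∧ LeftSlope h t l ∧ r + l = e t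

theorem isChipProfile_zero {e : ℝ → ℤ} {L : ℝ} (he : ∀ t, 0 < t → t < L → e t = 0) :
    IsChipProfile e L (fun _ => 0) 0 :=
  ⟨rfl, rightSlope_const _ _, by simpa using leftSlope_const 0 L,
    fun t h0 h1 => ⟨0, 0, rightSlope_const _ _, leftSlope_const _ _, by simp [he t h0 h1]⟩⟩

theorem isChipProfile_ramp {e : ℝ → ℤ} {L d : ℝ} (hd0 : 0 < d) (hdL : d < L)
    (he : ∀ t, 0 < t → t < L → e t = if t = d then 1 else 0) :
    IsChipProfile e L (ramp d) 1 := by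
  refine ⟨ramp_of_le hd0.le, ?_, ?_, fun t h0 h1 =>
    ⟨_, _, rightSlope_ramp _ _, leftSlope_ramp _ _, ?_⟩⟩
  · simpa [hd0.not_ge] using rightSlope_ramp d 0
  · simpa [hdL] using leftSlope_ramp d L
  · rw [he t h0 h1]
    rcases lt_trichotomy d t with c | c | c
    · simp [c, c.le, c.ne']
    · simp [c]
    · simp [c.not_ge, c.not_gt, c.ne]

/-- A function whose kinks are prescribed by `e' - e` is determined by its value and slope
at `0`. -/
theorem IsChipProfile.eq_of_kinks {e e' : ℝ → ℤ} {L : ℝ} {h h' : ℝ → ℝ} {N N' : ℤ} (hL : 0 < L)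
    (H : IsChipProfile e L h N) (H' : IsChipProfile e' L h' N') {f : ℝ → ℝ} {p q : ℤ}
    (hp : RightSlope f 0 p) (hq : LeftSlope f L q)
    (hk : ∀ t, 0 < t → t < L → ∃ r l, RightSlope f t r ∧ LeftSlope f t l ∧ r + l = e' t - e t) :
    (∀ t ∈ Set.Icc 0 L, f t = f 0 + p * t - h t + h' t) ∧ q = -p + N - N' := by
  have key := affine_of_no_kink hL (h := fun u => f u + h u - h' u) (s := p + 0 - 0)
    ((hp.add H.right).sub H'.right) ⟨_, (hq.add H.left).sub H'.left⟩ (fun t h0 h1 => by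
      obtain ⟨r, l, hr, hl, hrl⟩ := hk t h0 h1
      obtain ⟨r1, l1, hr1, hl1, hrl1⟩ := H.kink t h0 h1
      obtain ⟨r2, l2, hr2, hl2, hrl2⟩ := H'.kink t h0 h1
      exact ⟨_, _, (hr.add hr1).sub hr2, (hl.add hl1).sub hl2, by linarith⟩)
  simp only [H.zero, H'.zero, add_zero, sub_zero] at key
  refine ⟨fun t ht => by linarith [key t ht], ?_⟩
  have h1 : LeftSlope (fun u => f u + h u - h' u) L (-p) := by
    refine ((leftSlope_linear p L).add (leftSlope_const (f 0) L)).congr hL (fun u hu => ?_) |>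
      fun h => by simpa using h
    rw [key u ⟨by linarith [hu.1], hu.2⟩]; ring
  have h2 := h1.unique ((hq.add H.left).sub H'.left)
  omega

namespace ChainOfLoops

open MetricGraph

variable {g : ℕ} (Γ : ChainOfLoops g)

/-- The point at distance `t` from the left end of the bridge `k`. -/
noncomputable abbrev bridgePt (k : Fin (g + 1)) (t : ℝ) : Γ.Point := Γ.graph.edgePoint (.inl k) t

/-- The point at distance `t` from the left end of the loop `k`, along its top edge. -/
noncomputable abbrev topPt (k : Fin g) (t : ℝ) : Γ.Point := Γ.graph.edgePoint (.inr (.inl k)) t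

/-- The point at distance `t` from the left end of the loop `k`, along its bottom edge. -/
noncomputable abbrev botPt (k : Fin g) (t : ℝ) : Γ.Point := Γ.graph.edgePoint (.inr (.inr k)) t

/-- The left end of the bridge `k`. -/
abbrev bridgeL (k : Fin (g + 1)) : Γ.Point := .vert (.lft k)

/-- The right end of the bridge `k`. -/
abbrev bridgeR (k : Fin (g + 1)) : Γ.Point := .vert (.rgt k)

theorem bridgePt_zero (k : Fin (g + 1)) : Γ.bridgePt k 0 = Γ.bridgeL k :=
  Γ.graph.edgePoint_zero (.inl k)

theorem bridgePt_len (k : Fin (g + 1)) : Γ.bridgePt k (Γ.n k) = Γ.bridgeR k :=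
  Γ.graph.edgePoint_len (.inl k)

theorem topPt_zero (k : Fin g) : Γ.topPt k 0 = Γ.bridgeR k.castSucc :=
  Γ.graph.edgePoint_zero (.inr (.inl k))

theorem topPt_len (k : Fin g) : Γ.topPt k (Γ.l k) = Γ.bridgeL k.succ :=
  Γ.graph.edgePoint_len (.inr (.inl k))

theorem botPt_zero (k : Fin g) : Γ.botPt k 0 = Γ.bridgeR k.castSucc :=
  Γ.graph.edgePoint_zero (.inr (.inr k))

theorem botPt_len (k : Fin g) : Γ.botPt k (Γ.m k) = Γ.bridgeL k.succ :=
  Γ.graph.edgePoint_len (.inr (.inr k))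

/-! ### Orders at the vertices -/

theorem ord_leftEnd (f : Γ.Point → ℝ) :
    Γ.graph.ord f Γ.leftEnd = -Γ.graph.fwdSlope f (.inl 0) 0 := by
  classical
  simp only [leftEnd, MetricGraph.ord, Fintype.sum_sum_type]
  simp [graph, (Fin.succ_ne_zero _)]

theorem ord_rightEnd (f : Γ.Point → ℝ) :
    Γ.graph.ord f Γ.rightEnd = -Γ.graph.bwdSlope f (.inl (Fin.last g)) (Γ.n (Fin.last g)) := by
  classical
  simp only [rightEnd, MetricGraph.ord, Fintype.sum_sum_type]
  simp [graph, Fin.castSucc_ne_last]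

theorem ord_bridgeR (f : Γ.Point → ℝ) (k : Fin g) :
    Γ.graph.ord f (Γ.bridgeR k.castSucc) =
      -(Γ.graph.bwdSlope f (.inl k.castSucc) (Γ.n k.castSucc) +
        Γ.graph.fwdSlope f (.inr (.inl k)) 0 + Γ.graph.fwdSlope f (.inr (.inr k)) 0) := by
  classical
  simp only [MetricGraph.ord, Fintype.sum_sum_type]
  simp [graph]
  ring

theorem ord_bridgeL (f : Γ.Point → ℝ) (k : Fin g) :
    Γ.graph.ord f (Γ.bridgeL k.succ) =
      -(Γ.graph.fwdSlope f (.inl k.succ) 0 +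
        Γ.graph.bwdSlope f (.inr (.inl k)) (Γ.l k) + Γ.graph.bwdSlope f (.inr (.inr k)) (Γ.m k)) := by
  classical
  simp only [MetricGraph.ord, Fintype.sum_sum_type]
  simp [graph]
  ring

/-! ### Rigidity of the distinguished divisors -/

variable {Γ}

/-- If a class contains only one distinguished divisor with given degrees at the ends, then its
chips cannot be moved without moving those at the ends. -/
theorem IsDistinguished.eq_zero {D F Δ : Γ.graph.Divisor} {r i : ℕ} (hF : Γ.IsDistinguished D r i F)
    (huniq : ∃! F, Γ.IsDistinguished D r i F) {χ : Γ.Point → ℝ} (hχ : Γ.graph.IsPL χ)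
    (hΔ : ∀ x, Γ.graph.ord χ x = Δ x) (heff : 0 ≤ F + Δ) (hl : Δ Γ.leftEnd = 0)
    (hr : Δ Γ.rightEnd = 0) : Δ = 0 := by
  obtain ⟨f, hf⟩ := hF.2.1
  have : Γ.IsDistinguished D r i (F + Δ) :=
    ⟨heff, ⟨_, hf.add hχ Δ hΔ⟩, by simp [hl, hF.2.2.1], by simp [hr, hF.2.2.2]⟩
  have h := huniq.unique this hF
  simpa using h

theorem single_le_of_one_le {D : Γ.graph.Divisor} (hD : 0 ≤ D) {x : Γ.Point} (h : 1 ≤ D x) :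
    Finsupp.single x 1 ≤ D := by
  classical
  intro y
  rw [Finsupp.single_apply]
  split_ifs with hxy
  · rwa [← hxy]
  · exact hD y

theorem single_add_single_le {D : Γ.graph.Divisor} (hD : 0 ≤ D) {x y : Γ.Point} (hxy : x ≠ y)
    (hx : 1 ≤ D x) (hy : 1 ≤ D y) : Finsupp.single x 1 + Finsupp.single y 1 ≤ D := by
  classical
  intro z
  rw [Finsupp.add_apply, Finsupp.single_apply, Finsupp.single_apply]
  split_ifs with h1 h2 h2
  · exact absurd (h1.trans h2.symm) hxy
  · rw [add_zero, ← h1]; exact hx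
  · rw [zero_add, ← h2]; exact hy
  · exact hD z

variable (Γ) in
/-- A chip may be moved along a bridge by any distance. -/
theorem exists_moving_bridge (k : Fin (g + 1)) {a δ : ℝ} (hδ : 0 < δ) (ha : 0 ≤ a)
    (ha' : a + δ ≤ Γ.n k) (μ : ℤ) :
    ∃ χ : Γ.Point → ℝ, Γ.graph.IsPL χ ∧ ∀ x, Γ.graph.ord χ x =
      (Finsupp.single (Γ.bridgePt k (a + δ)) μ - Finsupp.single (Γ.bridgePt k a) μ :
        Γ.graph.Divisor) x := by
  classical
  obtain ⟨χ, h1, h2⟩ := MetricGraph.exists_moving (G := Γ.graph) (ι := Unit) (fun _ => .inl k)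
    (fun _ => a) (fun _ => μ) hδ (fun _ => ha) (fun _ => ha')
    (fun | .lft j => if k < j then μ * δ else 0 | .rgt j => if k ≤ j then μ * δ else 0) (by
      rintro (j | j | j)
      · simp only [graph, Finset.univ_unique, Finset.sum_singleton]
        rcases lt_trichotomy k j with h | h | h
        · simp [h, h.le, h.ne]
        · simp [h]
        · simp [h.not_ge, h.not_gt, h.ne']
      · simp [graph, Fin.lt_def, Fin.le_def]
      · simp [graph, Fin.lt_def, Fin.le_def])
  exact ⟨χ, h1, fun x => by rw [h2]; simp⟩

theorem bridgePt_ne_vert (k : Fin (g + 1)) {t : ℝ} (h0 : 0 < t) (h1 : t < Γ.n k) (v : Vertex g) :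
    Γ.bridgePt k t ≠ .vert v := by
  rw [bridgePt, Γ.graph.edgePoint_of_mem (.inl k) h0 h1]; simp

theorem topPt_ne_vert (k : Fin g) {t : ℝ} (h0 : 0 < t) (h1 : t < Γ.l k) (v : Vertex g) :
    Γ.topPt k t ≠ .vert v := by
  rw [topPt, Γ.graph.edgePoint_of_mem (.inr (.inl k)) h0 h1]; simp

theorem botPt_ne_vert (k : Fin g) {t : ℝ} (h0 : 0 < t) (h1 : t < Γ.m k) (v : Vertex g) :
    Γ.botPt k t ≠ .vert v := by
  rw [botPt, Γ.graph.edgePoint_of_mem (.inr (.inr k)) h0 h1]; simp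

theorem edgePoint_ne {V E : Type} {G : MetricGraph V E} (e : E) {t t' : ℝ} (h : t ≠ t')
    (h0 : 0 < t) (h1 : t < G.len e) : G.edgePoint e t' ≠ G.edgePoint e t := by
  rw [G.edgePoint_of_mem e h0 h1, Ne, G.edgePoint_eq_inner_iff]
  exact fun hh => h hh.2.symm

theorem edgePoint_ne_of_ne {V E : Type} {G : MetricGraph V E} {e e' : E} (h : e' ≠ e)
    {t : ℝ} (h0 : 0 < t) (h1 : t < G.len e) (s : ℝ) : G.edgePoint e' s ≠ G.edgePoint e t := by
  rw [G.edgePoint_of_mem e h0 h1, Ne, G.edgePoint_eq_inner_iff]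
  exact fun hh => h hh.1

/-- A distinguished divisor has no chips in the interior of the bridges. -/
theorem IsDistinguished.bridgePt_eq_zero {D F : Γ.graph.Divisor} {r i : ℕ}
    (hF : Γ.IsDistinguished D r i F) (huniq : ∃! F, Γ.IsDistinguished D r i F) (k : Fin (g + 1))
    {t : ℝ} (h0 : 0 < t) (h1 : t < Γ.n k) : F (Γ.bridgePt k t) = 0 := by
  classical
  by_contra hne
  have h2 : 1 ≤ F (Γ.bridgePt k t) := lt_of_le_of_ne (hF.1 _) (Ne.symm hne)
  set δ := (Γ.n k - t) / 2 with hδ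
  have hδ0 : 0 < δ := by simp only [hδ]; linarith
  obtain ⟨χ, hχ, hord⟩ := Γ.exists_moving_bridge k hδ0 h0.le (by simp only [hδ]; linarith) 1
  have hlt : t + δ < Γ.n k := by simp only [hδ]; linarith
  have := hF.eq_zero huniq hχ hord ?_ ?_ ?_
  · have h3 := DFunLike.congr_fun this (Γ.bridgePt k t)
    rw [Finsupp.sub_apply, Finsupp.single_eq_same, Finsupp.single_eq_of_ne] at h3
    · simp at h3
    · exact (edgePoint_ne (G := Γ.graph) (.inl k) (by linarith) h0 h1).symm
  · rw [add_sub, add_sub_right_comm]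
    exact add_nonneg (sub_nonneg.2 (single_le_of_one_le hF.1 h2)) (by simp)
  · simp [leftEnd, bridgePt_ne_vert k h0 h1,
      bridgePt_ne_vert k (by linarith : 0 < t + δ) hlt]
  · simp [rightEnd, bridgePt_ne_vert k h0 h1,
      bridgePt_ne_vert k (by linarith : 0 < t + δ) hlt]

/-- A distinguished divisor has no chips at the right ends of the loops. -/
theorem IsDistinguished.bridgeL_eq_zero {D F : Γ.graph.Divisor} {r i : ℕ}
    (hF : Γ.IsDistinguished D r i F) (huniq : ∃! F, Γ.IsDistinguished D r i F) {k : Fin (g + 1)}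
    (hk : k ≠ 0) : F (Γ.bridgeL k) = 0 := by
  classical
  by_contra hne
  have h2 : 1 ≤ F (Γ.bridgeL k) := lt_of_le_of_ne (hF.1 _) (Ne.symm hne)
  set δ := Γ.n k / 2 with hδ
  have hn := Γ.n_pos k
  have hδ0 : 0 < δ := by simp only [hδ]; linarith
  obtain ⟨χ, hχ, hord⟩ := Γ.exists_moving_bridge k hδ0 le_rfl (by simp only [hδ]; linarith) 1
  rw [bridgePt_zero, zero_add] at hord
  have hlt : δ < Γ.n k := by simp only [hδ]; linarith
  have hne := bridgePt_ne_vert k hδ0 hlt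
  have := hF.eq_zero huniq hχ hord ?_ ?_ ?_
  · have h3 := DFunLike.congr_fun this (Γ.bridgeL k)
    rw [Finsupp.sub_apply, Finsupp.single_eq_same, Finsupp.single_eq_of_ne (hne _).symm] at h3
    simp at h3
  · rw [add_sub, add_sub_right_comm]
    exact add_nonneg (sub_nonneg.2 (single_le_of_one_le hF.1 h2)) (by simp)
  · simp [leftEnd, hne, hk]
  · simp [rightEnd, hne]

/-- A distinguished divisor has no chips at the left ends of the loops. -/
theorem IsDistinguished.bridgeR_eq_zero {D F : Γ.graph.Divisor} {r i : ℕ}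
    (hF : Γ.IsDistinguished D r i F) (huniq : ∃! F, Γ.IsDistinguished D r i F) {k : Fin (g + 1)}
    (hk : k ≠ Fin.last g) : F (Γ.bridgeR k) = 0 := by
  classical
  by_contra hne
  have h2 : 1 ≤ F (Γ.bridgeR k) := lt_of_le_of_ne (hF.1 _) (Ne.symm hne)
  set δ := Γ.n k / 2 with hδ
  have hn := Γ.n_pos k
  have hδ0 : 0 < δ := by simp only [hδ]; linarith
  obtain ⟨χ, hχ, hord⟩ := Γ.exists_moving_bridge k hδ0 hδ0.le (by simp only [hδ]; linarith) (-1)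
  rw [show δ + δ = Γ.n k by simp only [hδ]; ring, bridgePt_len] at hord
  have hlt : δ < Γ.n k := by simp only [hδ]; linarith
  have hne := bridgePt_ne_vert k hδ0 hlt
  have := hF.eq_zero huniq hχ hord ?_ ?_ ?_
  · have h3 := DFunLike.congr_fun this (Γ.bridgeR k)
    rw [Finsupp.sub_apply, Finsupp.single_eq_same, Finsupp.single_eq_of_ne (hne _).symm] at h3
    simp at h3
  · simp only [Finsupp.single_neg, sub_neg_eq_add, ← add_assoc, ← sub_eq_add_neg]
    exact add_nonneg (sub_nonneg.2 (single_le_of_one_le hF.1 h2)) (by simp)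
  · simp [leftEnd, hne]
  · simp [rightEnd, hne, hk]

/-- A distinguished divisor does not have two chips in the interior of the same edge. -/
theorem IsDistinguished.not_two_chips_edge {D F : Γ.graph.Divisor} {r i : ℕ}
    (hF : Γ.IsDistinguished D r i F) (huniq : ∃! F, Γ.IsDistinguished D r i F) (e : Edge g)
    {t t' : ℝ} (h0 : 0 < t) (htt : t ≤ t') (h1 : t' < Γ.graph.len e)
    (h : Finsupp.single (Γ.graph.edgePoint e t) 1 + Finsupp.single (Γ.graph.edgePoint e t') 1 ≤ F) :
    False := by
  classical
  set δ := min t (Γ.graph.len e - t') / 2 with hδ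
  have hδ0 : 0 < δ := by
    have : 0 < min t (Γ.graph.len e - t') := lt_min h0 (by linarith)
    simp only [hδ]; linarith
  have hδ1 : δ < t := by
    have := min_le_left t (Γ.graph.len e - t')
    simp only [hδ]; linarith
  have hδ2 : t' + δ < Γ.graph.len e := by
    have := min_le_right t (Γ.graph.len e - t')
    simp only [hδ]; linarith
  -- The chips are moved apart by the same distance, so that nothing changes outside the edge.
  obtain ⟨χ, hχ, hord⟩ := MetricGraph.exists_moving (G := Γ.graph) (ι := Bool) (fun _ => e)
    (fun b => if b then t' else t - δ) (fun b => if b then 1 else -1) hδ0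
    (by rintro (_ | _) <;> simp <;> linarith) (by rintro (_ | _) <;> simp <;> linarith)
    (fun _ => 0) (by intro e'; simp)
  simp only [Fintype.sum_bool, if_true, Bool.false_eq_true, if_false, sub_add_cancel] at hord
  have hne : ∀ s, 0 < s → s < Γ.graph.len e → ∀ v, Γ.graph.edgePoint e s ≠ .vert v := by
    intro s hs0 hs1 v
    rw [Γ.graph.edgePoint_of_mem e hs0 hs1]; simp
  have n1 := hne t h0 (by linarith)
  have n2 := hne t' (by linarith) h1
  have n3 := hne (t - δ) (by linarith) (by linarith)
  have n4 := hne (t' + δ) (by linarith) hδ2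
  have := hF.eq_zero huniq hχ hord ?_ ?_ ?_
  · have h3 := DFunLike.congr_fun this (Γ.graph.edgePoint e (t' + δ))
    have hh : ∀ s, s ≠ t' + δ → Γ.graph.edgePoint e s ≠ Γ.graph.edgePoint e (t' + δ) :=
      fun s hs => edgePoint_ne (G := Γ.graph) e hs.symm (by linarith) hδ2
    rw [Finsupp.add_apply, Finsupp.sub_apply, Finsupp.sub_apply, Finsupp.single_eq_same,
      Finsupp.single_eq_of_ne (hh t' (by linarith)).symm,
      Finsupp.single_eq_of_ne (hh t (by linarith)).symm,
      Finsupp.single_eq_of_ne (hh (t - δ) (by linarith)).symm] at h3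
    simp at h3
  · have e1 : F + ((Finsupp.single (Γ.graph.edgePoint e (t' + δ)) (1 : ℤ) -
        Finsupp.single (Γ.graph.edgePoint e t') 1) +
        (Finsupp.single (Γ.graph.edgePoint e t) (-1) -
          Finsupp.single (Γ.graph.edgePoint e (t - δ)) (-1))) =
        (F - (Finsupp.single (Γ.graph.edgePoint e t) 1 +
          Finsupp.single (Γ.graph.edgePoint e t') 1)) +
        (Finsupp.single (Γ.graph.edgePoint e (t' + δ)) 1 +
          Finsupp.single (Γ.graph.edgePoint e (t - δ)) 1) := by
      simp only [Finsupp.single_neg]; abel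
    rw [e1]
    exact add_nonneg (sub_nonneg.2 h) (add_nonneg (by simp) (by simp))
  · simp [leftEnd, n1, n2, n3, n4]
  · simp [rightEnd, n1, n2, n3, n4]

/-- A distinguished divisor does not have chips in the interior of both edges of a loop. -/
theorem IsDistinguished.not_two_chips_loop {D F : Γ.graph.Divisor} {r i : ℕ}
    (hF : Γ.IsDistinguished D r i F) (huniq : ∃! F, Γ.IsDistinguished D r i F) (k : Fin g)
    {t t' : ℝ} (h0 : 0 < t) (h1 : t < Γ.l k) (h0' : 0 < t') (h1' : t' < Γ.m k)
    (ht : 1 ≤ F (Γ.topPt k t)) (ht' : 1 ≤ F (Γ.botPt k t')) : False := by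
  classical
  -- Both chips are moved to the right by the same distance; the function that does this is constant
  -- on either side of the loop.
  have hne : Γ.topPt k t ≠ Γ.botPt k t' :=
    edgePoint_ne_of_ne (G := Γ.graph) (e := .inr (.inr k)) (by simp) h0' h1' t
  set δ := min (Γ.l k - t) (Γ.m k - t') / 2 with hδ
  have hδ0 : 0 < δ := by
    have : 0 < min (Γ.l k - t) (Γ.m k - t') := lt_min (by linarith) (by linarith)
    simp only [hδ]; linarith
  have hδ1 : t + δ < Γ.l k := by
    have := min_le_left (Γ.l k - t) (Γ.m k - t')
    simp only [hδ]; linarith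
  have hδ2 : t' + δ < Γ.m k := by
    have := min_le_right (Γ.l k - t) (Γ.m k - t')
    simp only [hδ]; linarith
  obtain ⟨χ, hχ, hord⟩ := MetricGraph.exists_moving (G := Γ.graph) (ι := Bool)
    (fun b => if b then .inr (.inl k) else .inr (.inr k))
    (fun b => if b then t else t') (fun b => 1) hδ0
    (by rintro (_ | _) <;> simp <;> linarith)
    (by rintro (_ | _) <;> simp [graph] <;> linarith)
    (fun | .lft j => if k.castSucc < j then δ else 0 | .rgt j => if k.castSucc < j then δ else 0)
    (by
      rintro (j | j | j)
      · simp [graph]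
      · simp only [graph, Fintype.sum_bool, Fin.lt_def, Fin.val_castSucc, Fin.val_succ,
          if_true, Bool.false_eq_true, if_false]
        rcases lt_trichotomy k j with h | h | h
        · have := Fin.lt_def.1 h
          simp [h.ne, this, Nat.lt_succ_of_lt this]
        · simp [h]
        · have := Fin.lt_def.1 h
          simp [h.ne', this.not_gt, show ¬ (k : ℕ) < j + 1 by omega]
      · simp only [graph, Fintype.sum_bool, Fin.lt_def, Fin.val_castSucc, Fin.val_succ,
          if_true, Bool.false_eq_true, if_false]
        rcases lt_trichotomy k j with h | h | h
        · have := Fin.lt_def.1 h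
          simp [h.ne, this, Nat.lt_succ_of_lt this]
        · simp [h]
        · have := Fin.lt_def.1 h
          simp [h.ne', this.not_gt, show ¬ (k : ℕ) < j + 1 by omega])
  simp only [Fintype.sum_bool, if_true, Bool.false_eq_true, if_false] at hord
  have n1 := topPt_ne_vert k h0 h1
  have n2 := botPt_ne_vert k h0' h1'
  have n3 := topPt_ne_vert (Γ := Γ) k (by linarith : 0 < t + δ) hδ1
  have n4 := botPt_ne_vert (Γ := Γ) k (by linarith : 0 < t' + δ) hδ2
  have := hF.eq_zero huniq hχ hord ?_ ?_ ?_
  · have h3 := DFunLike.congr_fun this (Γ.topPt k t)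
    have hb : ∀ s, Γ.botPt k s ≠ Γ.topPt k t :=
      edgePoint_ne_of_ne (G := Γ.graph) (e := .inr (.inl k)) (by simp) h0 h1
    have ha : Γ.topPt k (t + δ) ≠ Γ.topPt k t :=
      edgePoint_ne (G := Γ.graph) (.inr (.inl k)) (by linarith) h0 h1
    rw [Finsupp.add_apply, Finsupp.sub_apply, Finsupp.sub_apply, Finsupp.single_eq_same,
      Finsupp.single_eq_of_ne ha.symm, Finsupp.single_eq_of_ne (hb _).symm,
      Finsupp.single_eq_of_ne (hb _).symm] at h3
    simp at h3
  · have e1 : F + ((Finsupp.single (Γ.topPt k (t + δ)) (1 : ℤ) -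
        Finsupp.single (Γ.topPt k t) 1) +
        (Finsupp.single (Γ.botPt k (t' + δ)) 1 - Finsupp.single (Γ.botPt k t') 1)) =
        (F - (Finsupp.single (Γ.topPt k t) 1 + Finsupp.single (Γ.botPt k t') 1)) +
        (Finsupp.single (Γ.topPt k (t + δ)) 1 + Finsupp.single (Γ.botPt k (t' + δ)) 1) := by
      abel
    rw [e1]
    exact add_nonneg (sub_nonneg.2 (single_add_single_le hF.1 hne ht ht'))
      (add_nonneg (by simp) (by simp))
  · simp [leftEnd, n1, n2, n3, n4]
  · simp [rightEnd, n1, n2, n3, n4]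

end ChainOfLoops

/-! ### Gluing functions along a separating edge -/

namespace MetricGraph

variable {V E : Type} {G : MetricGraph V E}

open Classical in
/-- Two functions can be glued along an edge whose removal separates the graph: the result has
the orders of `f` on the side of the tail of `e₀` and those of `f'` on the side of its head; on `e₀`
it has a single kink, at an arbitrary position. -/
theorem exists_glue [Fintype E] {f f' : G.Point → ℝ} (hf : G.IsPL f) (hf' : G.IsPL f') (e₀ : E)
    (left : V → Prop) (ht : left (G.tail e₀)) (hh : ¬ left (G.head e₀))
    (hleft : ∀ e, e ≠ e₀ → (left (G.tail e) ↔ left (G.head e))) {t₁ : ℝ} (h0 : 0 < t₁)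
    (h1 : t₁ < G.len e₀) {s s' : ℤ} (hs : G.fwdSlope f e₀ 0 = s)
    (hs' : G.bwdSlope f' e₀ (G.len e₀) = -s') :
    ∃ h : G.Point → ℝ, G.IsPL h ∧
      (∀ v, G.ord h (.vert v) = if left v then G.ord f (.vert v) else G.ord f' (.vert v)) ∧
      (∀ e t h0 h1, G.ord h (.inner e t h0 h1) = if e = e₀ then (if t = t₁ then s - s' else 0) else
        if left (G.tail e) then G.ord f (.inner e t h0 h1) else G.ord f' (.inner e t h0 h1)) := by
  obtain ⟨c, hc⟩ : ∃ c : ℝ, c = f (.vert (G.tail e₀)) + s * G.len e₀ +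
    (s' - s : ℤ) * (G.len e₀ - t₁) - f' (.vert (G.head e₀)) := ⟨_, rfl⟩
  set val : V → ℝ := fun v => if left v then f (.vert v) else f' (.vert v) + c with hval
  set ef : E → ℝ → ℝ := fun e => if e = e₀ then
      fun u => f (.vert (G.tail e₀)) + s * u + (s' - s : ℤ) * ramp t₁ u
    else if left (G.tail e) then fun u => f (G.edgePoint e u)
    else fun u => f' (G.edgePoint e u) + c with hef
  set R : E → ℝ → ℤ := fun e t => if e = e₀ then 0 + s + (s' - s) * (if t₁ ≤ t then 1 else 0)
    else if left (G.tail e) then G.fwdSlope f e t else G.fwdSlope f' e t + 0 with hR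
  set L : E → ℝ → ℤ := fun e t => if e = e₀ then 0 + -s + (s' - s) * (if t₁ < t then -1 else 0)
    else if left (G.tail e) then G.bwdSlope f e t else G.bwdSlope f' e t + 0 with hL
  have hsl : G.HasSlopes (G.ofEdges val ef) R L := by
    refine hasSlopes_ofEdges ?_ ?_ ?_ ?_
    · intro e
      by_cases he : e = e₀
      · subst he
        simp [hef, hval, ht, ramp_of_le h0.le]
      · by_cases hl : left (G.tail e) <;> simp [hef, hval, he, hl, edgePoint_zero]
    · intro e
      by_cases he : e = e₀
      · subst he
        simp only [hef, hval, hh, if_true, if_false, ramp_of_ge h1.le, hc]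
        ring
      · by_cases hl : left (G.tail e) <;>
          simp [hef, hval, he, hl, edgePoint_len, (hleft e he).symm]
    · intro e t ht0 ht1
      by_cases he : e = e₀
      · simp only [hef, hR, if_pos he]
        exact ((rightSlope_const _ _).add (rightSlope_linear _ _)).add
          ((rightSlope_ramp _ _).smul _)
      · by_cases hl : left (G.tail e)
        · simp only [hef, hR, if_neg he, if_pos hl]
          exact hf.hasFwdSlope ht0 ht1
        · simp only [hef, hR, if_neg he, if_neg hl]
          exact (hf'.hasFwdSlope ht0 ht1).add (rightSlope_const _ _)
    · intro e t ht0 ht1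
      by_cases he : e = e₀
      · simp only [hef, hL, if_pos he]
        exact ((leftSlope_const _ _).add (leftSlope_linear _ _)).add
          ((leftSlope_ramp _ _).smul _)
      · by_cases hl : left (G.tail e)
        · simp only [hef, hL, if_neg he, if_pos hl]
          exact hf.hasBwdSlope ht0 ht1
        · simp only [hef, hL, if_neg he, if_neg hl]
          exact (hf'.hasBwdSlope ht0 ht1).add (leftSlope_const _ _)
  refine ⟨_, hsl.isPL, fun v => ?_, fun e t ht0 ht1 => ?_⟩
  · rw [hsl.ord_vert]
    split_ifs with hv
    · rw [hf.hasSlopes.ord_vert]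
      congr 1
      refine Finset.sum_congr rfl fun e _ => ?_
      congr 1
      · split_ifs with he
        · by_cases he0 : e = e₀
          · subst he0
            simp [hR, h0.not_ge, hs]
          · simp [hR, he0, he, hv]
        · rfl
      · split_ifs with he
        · have he0 : e ≠ e₀ := by rintro rfl; exact hh (he ▸ hv)
          simp [hL, he0, (hleft e he0).2 (he ▸ hv)]
        · rfl
    · rw [hf'.hasSlopes.ord_vert]
      congr 1
      refine Finset.sum_congr rfl fun e _ => ?_
      congr 1
      · split_ifs with he
        · have he0 : e ≠ e₀ := by rintro rfl; exact hv (he ▸ ht)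
          simp [hR, he0, he, hv]
        · rfl
      · split_ifs with he
        · by_cases he0 : e = e₀
          · subst he0
            simp only [hL, hs', if_true, if_pos h1]; ring
          · have : ¬ left (G.tail e) := fun h => hv (he ▸ (hleft e he0).1 h)
            simp [hL, he0, this]
        · rfl
  · rw [hsl.ord_inner]
    by_cases he : e = e₀
    · simp only [hR, hL, if_pos he]
      rcases lt_trichotomy t₁ t with h | h | h
      · simp [h, h.le, h.ne']
      · simp [h, sub_eq_add_neg]
      · simp [h.not_ge, h.not_gt, h.ne]
    · by_cases hl : left (G.tail e)
      · simp only [hR, hL, if_neg he, if_pos hl]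
        rw [hf.hasSlopes.ord_inner]
      · simp only [hR, hL, if_neg he, if_neg hl]
        rw [hf'.hasSlopes.ord_inner]; ring

end MetricGraph

namespace ChainOfLoops

open MetricGraph

variable {g : ℕ} {Γ : ChainOfLoops g}

/-! ### Break divisors -/

theorem mem_loop_cases {k : Fin g} {x : Γ.Point} (hx : x ∈ Γ.loop k) :
    x = Γ.bridgeR k.castSucc ∨ x = Γ.bridgeL k.succ ∨
      (∃ t, 0 < t ∧ t < Γ.l k ∧ x = Γ.topPt k t) ∨ ∃ t, 0 < t ∧ t < Γ.m k ∧ x = Γ.botPt k t := by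
  rcases hx with ⟨t, ht, rfl⟩ | ⟨t, ht, rfl⟩
  · rcases ht.1.eq_or_lt with rfl | h0
    · exact .inl (Γ.topPt_zero k)
    rcases ht.2.eq_or_lt with rfl | h1
    · exact .inr (.inl (Γ.topPt_len k))
    exact .inr (.inr (.inl ⟨t, h0, h1, rfl⟩))
  · rcases ht.1.eq_or_lt with rfl | h0
    · exact .inl (Γ.botPt_zero k)
    rcases ht.2.eq_or_lt with rfl | h1
    · exact .inr (.inl (Γ.botPt_len k))
    exact .inr (.inr (.inr ⟨t, h0, h1, rfl⟩))

theorem bridgeR_mem_loop (k : Fin g) : Γ.bridgeR k.castSucc ∈ Γ.loop k :=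
  .inl ⟨0, ⟨le_rfl, (Γ.l_pos k).le⟩, (Γ.topPt_zero k).symm⟩

theorem bridgeL_mem_loop (k : Fin g) : Γ.bridgeL k.succ ∈ Γ.loop k :=
  .inl ⟨Γ.l k, ⟨(Γ.l_pos k).le, le_rfl⟩, (Γ.topPt_len k).symm⟩

theorem topPt_mem_loop (k : Fin g) {t : ℝ} (h0 : 0 ≤ t) (h1 : t ≤ Γ.l k) :
    Γ.topPt k t ∈ Γ.loop k := .inl ⟨t, ⟨h0, h1⟩, rfl⟩

theorem botPt_mem_loop (k : Fin g) {t : ℝ} (h0 : 0 ≤ t) (h1 : t ≤ Γ.m k) :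
    Γ.botPt k t ∈ Γ.loop k := .inr ⟨t, ⟨h0, h1⟩, rfl⟩

theorem eq_of_mem_loop {j k : Fin g} {x : Γ.Point} (hj : x ∈ Γ.loop j) (hk : x ∈ Γ.loop k) :
    j = k := by
  have ht : ∀ (i : Fin g) t (h0 : 0 < t) (h1 : t < Γ.l i),
      Γ.topPt i t = .inner (.inr (.inl i)) t h0 h1 :=
    fun i t h0 h1 => Γ.graph.edgePoint_of_mem (.inr (.inl i)) h0 h1
  have hb : ∀ (i : Fin g) t (h0 : 0 < t) (h1 : t < Γ.m i),
      Γ.botPt i t = .inner (.inr (.inr i)) t h0 h1 :=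
    fun i t h0 h1 => Γ.graph.edgePoint_of_mem (.inr (.inr i)) h0 h1
  rcases mem_loop_cases hj with rfl | rfl | ⟨t, h0, h1, rfl⟩ | ⟨t, h0, h1, rfl⟩ <;>
    rcases mem_loop_cases hk with h | h | ⟨t', h0', h1', h⟩ | ⟨t', h0', h1', h⟩ <;>
    (try rw [ht _ _ h0 h1] at h) <;> (try rw [hb _ _ h0 h1] at h) <;>
    (try rw [ht _ _ h0' h1'] at h) <;> (try rw [hb _ _ h0' h1'] at h) <;>
    first | (simp at h; done) | simpa using h | (cases h; rfl) | cases h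

theorem leftEnd_notMem_loop (k : Fin g) : Γ.leftEnd ∉ Γ.loop k := by
  intro h
  rcases mem_loop_cases h with h | h | ⟨t, h0, h1, h⟩ | ⟨t, h0, h1, h⟩
  · simp [leftEnd] at h
  · simp [leftEnd, (Fin.succ_ne_zero _).symm] at h
  · exact topPt_ne_vert k h0 h1 _ h.symm
  · exact botPt_ne_vert k h0 h1 _ h.symm

theorem rightEnd_notMem_loop (k : Fin g) : Γ.rightEnd ∉ Γ.loop k := by
  intro h
  rcases mem_loop_cases h with h | h | ⟨t, h0, h1, h⟩ | ⟨t, h0, h1, h⟩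
  · simp [rightEnd, (Fin.castSucc_ne_last _).symm] at h
  · simp [rightEnd] at h
  · exact topPt_ne_vert k h0 h1 _ h.symm
  · exact botPt_ne_vert k h0 h1 _ h.symm

theorem bridgePt_notMem_loop (k : Fin g) (j : Fin (g + 1)) {t : ℝ} (h0 : 0 < t) (h1 : t < Γ.n j) :
    Γ.bridgePt j t ∉ Γ.loop k := by
  intro h
  rcases h with ⟨t', -, h⟩ | ⟨t', -, h⟩
  · exact edgePoint_ne_of_ne (G := Γ.graph) (e := .inl j) (by simp) h0 h1 t' h.symm
  · exact edgePoint_ne_of_ne (G := Γ.graph) (e := .inl j) (by simp) h0 h1 t' h.symm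

/-- The values of a break divisor. -/
theorem IsBreak.apply_eq {D : Γ.graph.Divisor} (hD : Γ.IsBreak D) :
    D Γ.leftEnd = Γ.graph.degree D - g ∧
    (∀ x, x ≠ Γ.leftEnd → (∀ k, x ∉ Γ.loop k) → D x = 0) ∧
    ∀ k, ∃ y ∈ Γ.loop k, ∀ x ∈ Γ.loop k, D x = open Classical in if x = y then 1 else 0 := by
  classical
  obtain ⟨y, hy, hD⟩ := hD
  have key : ∀ x, D x = (if Γ.leftEnd = x then Γ.graph.degree D - g else 0) +
      ∑ k, if y k = x then 1 else 0 := by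
    intro x
    conv_lhs => rw [hD]
    rw [Finsupp.add_apply, Finsupp.finsetSum_apply, Finsupp.single_apply]
    simp only [Finsupp.single_apply]
  refine ⟨?_, fun x hx hxk => ?_, fun k => ⟨y k, hy k, fun x hx => ?_⟩⟩
  · rw [key, if_pos rfl, Finset.sum_eq_zero, add_zero]
    intro k _
    rw [if_neg]
    intro h
    exact leftEnd_notMem_loop k (h ▸ hy k)
  · rw [key, if_neg (Ne.symm hx), Finset.sum_eq_zero, add_zero]
    intro k _
    rw [if_neg]
    intro h
    exact hxk k (h ▸ hy k)
  · rw [key, if_neg, zero_add, Finset.sum_eq_single k]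
    · simp [eq_comm]
    · intro j _ hj
      rw [if_neg]
      intro h
      exact hj (eq_of_mem_loop (h ▸ hy j) hx)
    · simp
    · intro h
      exact leftEnd_notMem_loop k (h ▸ hx)

/-- The chip of a break divisor on a loop, encoded by the functions on the two edges of the loop
that bend there. -/
theorem IsBreak.exists_profile {D : Γ.graph.Divisor} (hD : Γ.IsBreak D) (k : Fin g) :
    ∃ (hT hB : ℝ → ℝ) (NT NB : ℤ), IsChipProfile (fun t => D (Γ.topPt k t)) (Γ.l k) hT NT ∧
      IsChipProfile (fun t => D (Γ.botPt k t)) (Γ.m k) hB NB ∧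
      D (Γ.bridgeR k.castSucc) + D (Γ.bridgeL k.succ) + NT + NB = 1 := by
  classical
  obtain ⟨y, hy, hDy⟩ := hD.apply_eq.2.2 k
  have hT : ∀ t, 0 < t → t < Γ.l k → D (Γ.topPt k t) = if Γ.topPt k t = y then 1 else 0 :=
    fun t h0 h1 => hDy _ (topPt_mem_loop k h0.le h1.le)
  have hB : ∀ t, 0 < t → t < Γ.m k → D (Γ.botPt k t) = if Γ.botPt k t = y then 1 else 0 :=
    fun t h0 h1 => hDy _ (botPt_mem_loop k h0.le h1.le)
  rw [hDy _ (bridgeR_mem_loop k), hDy _ (bridgeL_mem_loop k)]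
  rcases mem_loop_cases hy with rfl | rfl | ⟨d, h0, h1, rfl⟩ | ⟨d, h0, h1, rfl⟩
  · refine ⟨_, _, _, _, isChipProfile_zero fun t h0 h1 => ?_, isChipProfile_zero fun t h0 h1 => ?_,
      by simp⟩
    · rw [hT t h0 h1, if_neg (topPt_ne_vert k h0 h1 _)]
    · rw [hB t h0 h1, if_neg (botPt_ne_vert k h0 h1 _)]
  · refine ⟨_, _, _, _, isChipProfile_zero fun t h0 h1 => ?_, isChipProfile_zero fun t h0 h1 => ?_,
      by simp⟩
    · rw [hT t h0 h1, if_neg (topPt_ne_vert k h0 h1 _)]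
    · rw [hB t h0 h1, if_neg (botPt_ne_vert k h0 h1 _)]
  · refine ⟨_, _, _, _, isChipProfile_ramp h0 h1 fun t h0' h1' => ?_,
      isChipProfile_zero fun t h0' h1' => ?_, ?_⟩
    · rw [hT t h0' h1']
      congr 1
      refine propext ⟨fun h => ?_, fun h => h ▸ rfl⟩
      by_contra hne
      exact edgePoint_ne (G := Γ.graph) (.inr (.inl k)) (Ne.symm hne) h0 h1 h
    · rw [hB t h0' h1', if_neg]
      exact edgePoint_ne_of_ne (G := Γ.graph) (e := .inr (.inl k)) (by simp) h0 h1 t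
    · rw [if_neg (topPt_ne_vert k h0 h1 _).symm, if_neg (topPt_ne_vert k h0 h1 _).symm]; norm_num
  · refine ⟨_, _, _, _, isChipProfile_zero fun t h0' h1' => ?_,
      isChipProfile_ramp h0 h1 fun t h0' h1' => ?_, ?_⟩
    · rw [hT t h0' h1', if_neg]
      exact edgePoint_ne_of_ne (G := Γ.graph) (e := .inr (.inr k)) (by simp) h0 h1 t
    · rw [hB t h0' h1']
      congr 1
      refine propext ⟨fun h => ?_, fun h => h ▸ rfl⟩
      by_contra hne
      exact edgePoint_ne (G := Γ.graph) (.inr (.inr k)) (Ne.symm hne) h0 h1 h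
    · rw [if_neg (botPt_ne_vert k h0 h1 _).symm, if_neg (botPt_ne_vert k h0 h1 _).symm]; norm_num

end ChainOfLoops

/-! ### Slopes on the bridges -/

namespace ChainOfLoops

open MetricGraph

variable {g : ℕ} {Γ : ChainOfLoops g}

/-- The data of a vertex avoiding class of degree `g + 3` and rank `6`: the break divisor `D`,
the distinguished divisors `E i`, and functions `φ i` which move `D` to `E i`. -/
structure VASystem (Γ : ChainOfLoops g) (D : Γ.graph.Divisor) (E : Fin 7 → Γ.graph.Divisor)
    (φ : Fin 7 → Γ.Point → ℝ) : Prop where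
  isBreak : Γ.IsBreak D
  deg : Γ.graph.degree D = g + 3
  uniq : ∀ i : Fin 7, ∃! F, Γ.IsDistinguished D 6 i F
  dist : ∀ i : Fin 7, Γ.IsDistinguished D 6 i (E i)
  moves : ∀ i, Γ.graph.Moves (φ i) D (E i)

/-- The slope of `f` on the bridge `k` (at its left end). -/
noncomputable def slope (f : Γ.Point → ℝ) (k : Fin (g + 1)) : ℤ := Γ.graph.fwdSlope f (.inl k) 0

/-- The vertices to the left of the bridge `k`. -/
def leftOf (k : Fin (g + 1)) : Vertex g → Prop
  | .lft j => j ≤ k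
  | .rgt j => j < k

namespace VASystem

variable {D : Γ.graph.Divisor} {E : Fin 7 → Γ.graph.Divisor} {φ : Fin 7 → Γ.Point → ℝ}
  (S : VASystem Γ D E φ)

include S

theorem apply_bridgePt (k : Fin (g + 1)) {t : ℝ} (h0 : 0 < t) (h1 : t < Γ.n k) :
    D (Γ.bridgePt k t) = 0 :=
  S.isBreak.apply_eq.2.1 _ (bridgePt_ne_vert k h0 h1 _) fun j => bridgePt_notMem_loop j k h0 h1

theorem kink {e : Edge g} (i : Fin 7) {t : ℝ} (h0 : 0 < t) (h1 : t < Γ.graph.len e) :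
    ∃ r l, RightSlope (fun u => φ i (Γ.graph.edgePoint e u)) t r ∧
      LeftSlope (fun u => φ i (Γ.graph.edgePoint e u)) t l ∧
      r + l = D (Γ.graph.edgePoint e t) - E i (Γ.graph.edgePoint e t) := by
  refine ⟨_, _, (S.moves i).1.hasFwdSlope h0.le h1, (S.moves i).1.hasBwdSlope h0 h1.le, ?_⟩
  have := (S.moves i).2 (Γ.graph.edgePoint e t)
  rw [Γ.graph.edgePoint_of_mem e h0 h1] at this ⊢
  rw [(S.moves i).1.hasSlopes.ord_inner] at this
  omega

theorem bridge_affine (i : Fin 7) (k : Fin (g + 1)) :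
    (∀ t ∈ Set.Icc 0 (Γ.n k), φ i (Γ.bridgePt k t) = φ i (Γ.bridgeL k) + slope (φ i) k * t) ∧
      Γ.graph.bwdSlope (φ i) (.inl k) (Γ.n k) = -slope (φ i) k := by
  have hn := Γ.n_pos k
  have h := IsChipProfile.eq_of_kinks (f := fun u => φ i (Γ.bridgePt k u)) hn
    (isChipProfile_zero (e := fun t => E i (Γ.bridgePt k t))
      fun t h0 h1 => (S.dist i).bridgePt_eq_zero (S.uniq i) k h0 h1)
    (isChipProfile_zero (e := fun t => D (Γ.bridgePt k t)) fun t h0 h1 => S.apply_bridgePt k h0 h1)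
    ((S.moves i).1.hasFwdSlope (e := .inl k) le_rfl hn)
    ((S.moves i).1.hasBwdSlope (e := .inl k) hn le_rfl)
    fun t h0 h1 => S.kink (e := .inl k) i h0 h1
  refine ⟨fun t ht => ?_, by simpa [slope] using h.2⟩
  have := h.1 t ht
  simp only [sub_zero, add_zero, bridgePt_zero] at this
  exact this

theorem slope_zero (i : Fin 7) : slope (φ i) 0 = (i : ℤ) - 3 := by
  have h := (S.moves i).2 Γ.leftEnd
  rw [Γ.ord_leftEnd, (S.dist i).2.2.1, S.isBreak.apply_eq.1, S.deg] at h
  simp only [slope]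
  push_cast at h
  omega

theorem slope_last (i : Fin 7) : slope (φ i) (Fin.last g) = i := by
  have h := (S.moves i).2 Γ.rightEnd
  rw [Γ.ord_rightEnd, (S.bridge_affine i _).2, (S.dist i).2.2.2,
    S.isBreak.apply_eq.2.1 _ (by simp [rightEnd, leftEnd]) rightEnd_notMem_loop] at h
  omega

/-- The slopes on a bridge are strictly increasing in the index: otherwise one may follow `φ i` to
the left and `φ i'` to the right of the bridge, which leaves chips to spare at the right end. -/
theorem slope_strictMono (k : Fin (g + 1)) : StrictMono fun i => slope (φ i) k := by
  classical
  intro i i' hii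
  by_contra hle
  have hle : slope (φ i') k ≤ slope (φ i) k := not_lt.1 hle
  have hn := Γ.n_pos k
  obtain ⟨h, hPL, hv, he⟩ := MetricGraph.exists_glue (S.moves i).1 (S.moves i').1 (.inl k)
    (leftOf k) (le_refl k) (lt_irrefl k)
    (by
      rintro (j | j | j) hj
      · simp only [graph, leftOf]
        exact ⟨fun h => lt_of_le_of_ne h fun h' => hj (h' ▸ rfl), le_of_lt⟩
      · simp only [graph, leftOf]
        rw [Fin.lt_def, Fin.le_def, Fin.val_castSucc, Fin.val_succ]; omega
      · simp only [graph, leftOf]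
        rw [Fin.lt_def, Fin.le_def, Fin.val_castSucc, Fin.val_succ]; omega)
    (t₁ := Γ.n k / 2) (by linarith) (show Γ.n k / 2 < Γ.n k by linarith)
    (s := slope (φ i) k) (s' := slope (φ i') k) rfl (S.bridge_affine i' k).2
  set P : Γ.Point → Prop := fun
    | .vert v => leftOf k v | .inner e _ _ _ => e ≠ .inl k ∧ leftOf k (Γ.graph.tail e) with hP
  set Q : Γ.Point → Prop := fun
    | .vert v => ¬ leftOf k v | .inner e _ _ _ => e ≠ .inl k ∧ ¬ leftOf k (Γ.graph.tail e) with hQ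
  have hPi : ∀ e t h0 h1, P (.inner e t h0 h1) ↔ e ≠ .inl k ∧ leftOf k (Γ.graph.tail e) :=
    fun _ _ _ _ => Iff.rfl
  have hQi : ∀ e t h0 h1, Q (.inner e t h0 h1) ↔ e ≠ .inl k ∧ ¬ leftOf k (Γ.graph.tail e) :=
    fun _ _ _ _ => Iff.rfl
  set F : Γ.graph.Divisor := (E i).filter P + (E i').filter Q +
    Finsupp.single (Γ.bridgePt k (Γ.n k / 2)) (slope (φ i) k - slope (φ i') k) with hF
  have hmoves : Γ.graph.Moves h D F := by
    refine ⟨hPL, fun x => ?_⟩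
    simp only [hF, Finsupp.add_apply, Finsupp.filter_apply, Finsupp.single_apply]
    cases x with
    | vert v =>
      rw [hv, if_neg (bridgePt_ne_vert k (by linarith) (by linarith) v)]
      by_cases hl : leftOf k v
      · simp only [hP, hQ, hl, if_true, not_true, if_false]
        rw [(S.moves i).2]; ring
      · simp only [hP, hQ, hl, if_false, not_false_eq_true, if_true]
        rw [(S.moves i').2]; ring
    | inner e t h0 h1 =>
      rw [he]
      simp only [bridgePt, edgePoint_eq_inner_iff]
      by_cases hek : e = .inl k
      · subst hek
        have hD : D (.inner (.inl k) t h0 h1) = 0 := by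
          have := S.apply_bridgePt k h0 h1
          rwa [bridgePt, Γ.graph.edgePoint_of_mem (.inl k) h0 h1] at this
        simp [hP, hQ, hD, eq_comm]
      · rw [if_neg hek, if_neg (show ¬ (Sum.inl k = e ∧ Γ.n k / 2 = t) from
          fun hh => hek hh.1.symm)]
        by_cases hl : leftOf k (Γ.graph.tail e)
        · have hp : P (.inner e t h0 h1) := (hPi e t h0 h1).2 ⟨hek, hl⟩
          have hq : ¬ Q (.inner e t h0 h1) := fun hh => ((hQi e t h0 h1).1 hh).2 hl
          rw [if_pos hl, if_pos hp, if_neg hq, (S.moves i).2]; ring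
        · have hp : ¬ P (.inner e t h0 h1) := fun hh => hl ((hPi e t h0 h1).1 hh).2
          have hq : Q (.inner e t h0 h1) := (hQi e t h0 h1).2 ⟨hek, hl⟩
          rw [if_neg hl, if_neg hp, if_pos hq, (S.moves i').2]; ring
  have hF0 : 0 ≤ F := by
    refine add_nonneg (add_nonneg ?_ ?_) (by simpa using hle)
    · intro x
      rw [Finsupp.filter_apply]
      split_ifs
      exacts [(S.dist i).1 x, le_rfl]
    · intro x
      rw [Finsupp.filter_apply]
      split_ifs
      exacts [(S.dist i').1 x, le_rfl]
  have hFl : F Γ.leftEnd = 6 - i := by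
    have h1 : P Γ.leftEnd := Fin.zero_le k
    have h2 : ¬ Q Γ.leftEnd := not_not.2 h1
    simp only [hF, Finsupp.add_apply, Finsupp.filter_apply, if_pos h1, if_neg h2]
    rw [Finsupp.single_eq_of_ne, (S.dist i).2.2.1]
    · push_cast; ring
    · exact (bridgePt_ne_vert k (by linarith) (by linarith) _).symm
  have hFr : F Γ.rightEnd = i' := by
    have h1 : ¬ P Γ.rightEnd := not_lt.2 (Fin.le_last k)
    have h2 : Q Γ.rightEnd := h1
    simp only [hF, Finsupp.add_apply, Finsupp.filter_apply, if_neg h1, if_pos h2]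
    rw [Finsupp.single_eq_of_ne, (S.dist i').2.2.2]
    · ring
    · exact (bridgePt_ne_vert k (by linarith) (by linarith) _).symm
  -- The `i' - i` spare chips at the right end may be placed anywhere on the last bridge.
  have hg := Γ.n_pos (Fin.last g)
  set c : ℤ := i' - i with hc
  have hcpos : 0 < c := by simp only [hc]; have := Fin.lt_def.1 hii; omega
  have place : ∀ a, 0 < a → a < Γ.n (Fin.last g) → Γ.IsDistinguished D 6 i
      (F + (Finsupp.single Γ.rightEnd (-c) + Finsupp.single (Γ.bridgePt (Fin.last g) a) c)) := by
    intro a ha0 ha1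
    obtain ⟨χ, hχ, hord⟩ := Γ.exists_moving_bridge (Fin.last g) (a := a)
      (δ := Γ.n (Fin.last g) - a) (by linarith) ha0.le (by linarith) (-c)
    rw [show a + (Γ.n (Fin.last g) - a) = Γ.n (Fin.last g) by ring, bridgePt_len] at hord
    have n1 := bridgePt_ne_vert (Γ := Γ) (Fin.last g) ha0 ha1
    have e1 : (Finsupp.single (Γ.bridgeR (Fin.last g)) (-c) -
        Finsupp.single (Γ.bridgePt (Fin.last g) a) (-c) : Γ.graph.Divisor) =
        Finsupp.single Γ.rightEnd (-c) + Finsupp.single (Γ.bridgePt (Fin.last g) a) c := by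
      rw [rightEnd]; simp
    rw [e1] at hord
    refine ⟨?_, ⟨_, hmoves.add hχ _ hord⟩, ?_, ?_⟩
    · rw [← add_assoc]
      refine add_nonneg (fun x => ?_) (by simpa using hcpos.le)
      rw [Finsupp.add_apply, Finsupp.single_apply]
      split_ifs with hx
      · rw [← hx, hFr]; simp only [hc, Finsupp.coe_zero, Pi.zero_apply]; omega
      · simpa using hF0 x
    · rw [Finsupp.add_apply, hFl, Finsupp.add_apply, Finsupp.single_eq_of_ne,
        Finsupp.single_eq_of_ne (show Γ.leftEnd ≠ _ from (n1 _).symm)]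
      · push_cast; ring
      · simp [rightEnd, leftEnd]
    · rw [Finsupp.add_apply, hFr, Finsupp.add_apply, Finsupp.single_eq_same,
        Finsupp.single_eq_of_ne (show Γ.rightEnd ≠ _ from (n1 _).symm)]
      simp only [hc]; ring
  have h1 := (S.uniq i).unique (place (Γ.n (Fin.last g) / 2) (by linarith) (by linarith))
    (place (Γ.n (Fin.last g) / 3) (by linarith) (by linarith))
  have h2 := DFunLike.congr_fun (add_left_cancel (add_left_cancel h1))
    (Γ.bridgePt (Fin.last g) (Γ.n (Fin.last g) / 2))
  have hne : Γ.bridgePt (Fin.last g) (Γ.n (Fin.last g) / 3) ≠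
      Γ.bridgePt (Fin.last g) (Γ.n (Fin.last g) / 2) :=
    edgePoint_ne (G := Γ.graph) (.inl (Fin.last g)) (by linarith) (by linarith)
      (show Γ.n (Fin.last g) / 2 < Γ.n (Fin.last g) by linarith)
  rw [Finsupp.single_eq_same, Finsupp.single_eq_of_ne hne.symm] at h2
  omega

end VASystem

end ChainOfLoops

/-! ### The functions on a loop -/

namespace ChainOfLoops

open MetricGraph

variable {g : ℕ} {Γ : ChainOfLoops g}

/-- The functions `hT` and `hB` on the two edges, of lengths `l` and `m`, of a loop encode a set of
`N ≤ 1` chips in the interior of these edges. -/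
def IsLoopChip (l m : ℝ) (hT hB : ℝ → ℝ) (N : ℤ) : Prop :=
  ((hT = fun _ => 0) ∧ (hB = fun _ => 0) ∧ N = 0) ∨
  (∃ d, 0 < d ∧ d < l ∧ hT = ramp d ∧ (hB = fun _ => 0) ∧ N = 1) ∨
  (∃ d, 0 < d ∧ d < m ∧ (hT = fun _ => 0) ∧ hB = ramp d ∧ N = 1)

theorem ramp_end_mem {d L : ℝ} (h0 : 0 < d) (h1 : d < L) : ramp d L ∈ Set.Icc 0 L := by
  rw [ramp_of_ge h1.le]; constructor <;> linarith

theorem IsLoopChip.top_mem {l m : ℝ} {hT hB : ℝ → ℝ} {N : ℤ} (hl : 0 ≤ l)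
    (H : IsLoopChip l m hT hB N) : hT l ∈ Set.Icc 0 l := by
  rcases H with ⟨rfl, -⟩ | ⟨d, h0, h1, rfl, -⟩ | ⟨d, h0, h1, rfl, -⟩
  exacts [⟨le_rfl, hl⟩, ramp_end_mem h0 h1, ⟨le_rfl, hl⟩]

theorem IsLoopChip.bot_mem {l m : ℝ} {hT hB : ℝ → ℝ} {N : ℤ} (hm : 0 ≤ m)
    (H : IsLoopChip l m hT hB N) : hB m ∈ Set.Icc 0 m := by
  rcases H with ⟨-, rfl, -⟩ | ⟨d, h0, h1, -, rfl, -⟩ | ⟨d, h0, h1, -, rfl, -⟩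
  exacts [⟨le_rfl, hm⟩, ⟨le_rfl, hm⟩, ramp_end_mem h0 h1]

namespace VASystem

variable {D : Γ.graph.Divisor} {E : Fin 7 → Γ.graph.Divisor} {φ : Fin 7 → Γ.Point → ℝ}
  (S : VASystem Γ D E φ)

include S

/-- On an edge, a distinguished divisor has at most one chip in the interior. -/
theorem edge_chip_unique (i : Fin 7) (e : Edge g) {d : ℝ} (h0 : 0 < d) (h1 : d < Γ.graph.len e)
    (hd : E i (Γ.graph.edgePoint e d) ≠ 0) {t : ℝ} (ht0 : 0 < t) (ht1 : t < Γ.graph.len e) :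
    E i (Γ.graph.edgePoint e t) = open Classical in if t = d then 1 else 0 := by
  classical
  have hpos := (S.dist i).1
  have hd1 : 1 ≤ E i (Γ.graph.edgePoint e d) := lt_of_le_of_ne (hpos _) hd.symm
  split_ifs with htd
  · subst htd
    by_contra hne
    refine (S.dist i).not_two_chips_edge (S.uniq i) e ht0 le_rfl ht1 fun x => ?_
    rw [← Finsupp.single_add, Finsupp.single_apply]
    split_ifs with hx
    · rw [← hx]; omega
    · exact hpos x
  · by_contra hne
    have ht : 1 ≤ E i (Γ.graph.edgePoint e t) := lt_of_le_of_ne (hpos _) (Ne.symm hne)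
    rcases lt_or_gt_of_ne htd with hlt | hlt
    · exact (S.dist i).not_two_chips_edge (S.uniq i) e ht0 hlt.le h1 (single_add_single_le hpos
        (edgePoint_ne (G := Γ.graph) e (ne_of_gt hlt) h0 h1) ht hd1)
    · exact (S.dist i).not_two_chips_edge (S.uniq i) e h0 hlt.le ht1 (single_add_single_le hpos
        (edgePoint_ne (G := Γ.graph) e (ne_of_gt hlt) ht0 ht1) hd1 ht)

theorem exists_isLoopChip (i : Fin 7) (k : Fin g) :
    ∃ (hT hB : ℝ → ℝ) (N NT NB : ℤ), IsLoopChip (Γ.l k) (Γ.m k) hT hB N ∧ N = NT + NB ∧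
      IsChipProfile (fun t => E i (Γ.topPt k t)) (Γ.l k) hT NT ∧
      IsChipProfile (fun t => E i (Γ.botPt k t)) (Γ.m k) hB NB := by
  have hpos := (S.dist i).1
  by_cases hT : ∃ d, 0 < d ∧ d < Γ.l k ∧ E i (Γ.topPt k d) ≠ 0
  · obtain ⟨d, h0, h1, hd⟩ := hT
    have hB : ∀ t, 0 < t → t < Γ.m k → E i (Γ.botPt k t) = 0 := by
      intro t ht0 ht1
      by_contra hne
      exact (S.dist i).not_two_chips_loop (S.uniq i) k h0 h1 ht0 ht1
        (lt_of_le_of_ne (hpos _) hd.symm) (lt_of_le_of_ne (hpos _) (Ne.symm hne))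
    refine ⟨ramp d, fun _ => 0, 1, 1, 0, .inr (.inl ⟨d, h0, h1, rfl, rfl, rfl⟩), by simp,
      isChipProfile_ramp h0 h1 fun t ht0 ht1 => ?_, isChipProfile_zero hB⟩
    have := S.edge_chip_unique i (.inr (.inl k)) h0 h1 hd ht0 ht1
    convert this
  · push Not at hT
    by_cases hB : ∃ d, 0 < d ∧ d < Γ.m k ∧ E i (Γ.botPt k d) ≠ 0
    · obtain ⟨d, h0, h1, hd⟩ := hB
      refine ⟨fun _ => 0, ramp d, 1, 0, 1, .inr (.inr ⟨d, h0, h1, rfl, rfl, rfl⟩), by simp,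
        isChipProfile_zero hT, isChipProfile_ramp h0 h1 fun t ht0 ht1 => ?_⟩
      have := S.edge_chip_unique i (.inr (.inr k)) h0 h1 hd ht0 ht1
      convert this
    · push Not at hB
      exact ⟨fun _ => 0, fun _ => 0, 0, 0, 0, .inl ⟨rfl, rfl, rfl⟩, by simp,
        isChipProfile_zero hT, isChipProfile_zero hB⟩

/-- The restrictions of the functions `φ i` to a loop, up to terms `cT`, `cB`, `κ` that come from the
chip of the break divisor and do not depend on `i`. -/
theorem loop_shape (k : Fin g) : ∃ (cT cB : ℝ → ℝ) (κ : ℤ), ∀ i, ∃ (hT hB : ℝ → ℝ) (N p q : ℤ),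
    IsLoopChip (Γ.l k) (Γ.m k) hT hB N ∧
    slope (φ i) k.succ = slope (φ i) k.castSucc + 1 - N ∧
    p + q = slope (φ i) k.castSucc + κ ∧
    (∀ t ∈ Set.Icc 0 (Γ.l k),
      φ i (Γ.topPt k t) = φ i (Γ.bridgeR k.castSucc) + p * t - hT t + cT t) ∧
    (∀ t ∈ Set.Icc 0 (Γ.m k),
      φ i (Γ.botPt k t) = φ i (Γ.bridgeR k.castSucc) + q * t - hB t + cB t) := by
  obtain ⟨cT, cB, MT, MB, HcT, HcB, hM⟩ := S.isBreak.exists_profile k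
  refine ⟨cT, cB, D (Γ.bridgeR k.castSucc), fun i => ?_⟩
  obtain ⟨hT, hB, N, NT, NB, hchip, rfl, HT, HB⟩ := S.exists_isLoopChip i k
  have hPL := (S.moves i).1
  have topShape := HT.eq_of_kinks (f := fun u => φ i (Γ.topPt k u)) (Γ.l_pos k) HcT
    (hPL.hasFwdSlope (e := .inr (.inl k)) le_rfl (Γ.l_pos k))
    (hPL.hasBwdSlope (e := .inr (.inl k)) (Γ.l_pos k) le_rfl)
    (fun t h0 h1 => S.kink (e := .inr (.inl k)) i h0 h1)
  have botShape := HB.eq_of_kinks (f := fun u => φ i (Γ.botPt k u)) (Γ.m_pos k) HcB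
    (hPL.hasFwdSlope (e := .inr (.inr k)) le_rfl (Γ.m_pos k))
    (hPL.hasBwdSlope (e := .inr (.inr k)) (Γ.m_pos k) le_rfl)
    (fun t h0 h1 => S.kink (e := .inr (.inr k)) i h0 h1)
  have hv := (S.moves i).2 (Γ.bridgeR k.castSucc)
  have hw := (S.moves i).2 (Γ.bridgeL k.succ)
  rw [ord_bridgeR, (S.bridge_affine i _).2,
    (S.dist i).bridgeR_eq_zero (S.uniq i) (Fin.castSucc_ne_last k)] at hv
  rw [ord_bridgeL, (S.dist i).bridgeL_eq_zero (S.uniq i) (Fin.succ_ne_zero k)] at hw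
  have hT2 := topShape.2
  have hB2 := botShape.2
  have hw' : slope (φ i) k.succ = Γ.graph.fwdSlope (φ i) (.inl k.succ) 0 := rfl
  refine ⟨hT, hB, NT + NB, Γ.graph.fwdSlope (φ i) (.inr (.inl k)) 0,
    Γ.graph.fwdSlope (φ i) (.inr (.inr k)) 0, hchip, ?_, ?_, fun t ht => ?_, fun t ht => ?_⟩
  rotate_left 2
  · have := topShape.1 t ht
    rwa [topPt_zero] at this
  · have := botShape.1 t ht
    rwa [botPt_zero] at this
  · linarith
  · linarith

theorem slope_succ (i : Fin 7) (k : Fin g) :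
    slope (φ i) k.succ = slope (φ i) k.castSucc ∨
      slope (φ i) k.succ = slope (φ i) k.castSucc + 1 := by
  obtain ⟨cT, cB, κ, h⟩ := S.loop_shape k
  obtain ⟨hT, hB, N, p, q, hN, hs, -⟩ := h i
  rcases hN with ⟨-, -, rfl⟩ | ⟨d, -, -, -, -, rfl⟩ | ⟨d, -, -, -, -, rfl⟩
  · right; omega
  · left; omega
  · left; omega

theorem slope_monotone (i : Fin 7) : Monotone (slope (φ i)) := by
  rw [Fin.monotone_iff_le_succ]
  intro k
  rcases S.slope_succ i k with h | h <;> omega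

theorem slope_bounds (i : Fin 7) (k : Fin (g + 1)) :
    (i : ℤ) - 3 ≤ slope (φ i) k ∧ slope (φ i) k ≤ i :=
  ⟨S.slope_zero i ▸ S.slope_monotone i (Fin.zero_le k),
    S.slope_last i ▸ S.slope_monotone i (Fin.le_last k)⟩

theorem abs_slope_sub_le (i i' : Fin 7) (k : Fin (g + 1)) :
    |slope (φ i) k - slope (φ i') k| ≤ 9 := by
  have h1 := S.slope_bounds i k
  have h2 := S.slope_bounds i' k
  have := i.2
  have := i'.2
  rw [abs_le]; omega

end VASystem

/-- On a loop with a short bottom edge, the difference of two functions whose incoming slopes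
differ by `a` changes by a multiple of the length of the bottom edge. -/
theorem loop_change_bound {l m x y δ : ℝ} {p q a : ℤ} (hm : 0 < m) (hlm : 1000 * m ≤ l)
    (hpq : p + q = a) (ha : |a| ≤ 9) (hx : |x| ≤ l) (hy : |y| ≤ m) (hT : δ = p * l - x)
    (hB : δ = q * m - y) : |δ| ≤ 11 * m := by
  have hpq' : (p : ℝ) + q = a := by exact_mod_cast hpq
  have ha1 : (-9 : ℝ) ≤ a := by exact_mod_cast (abs_le.1 ha).1
  have ha2 : (a : ℝ) ≤ 9 := by exact_mod_cast (abs_le.1 ha).2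
  rw [abs_le] at hx hy ⊢
  have e : (p : ℝ) * (l + m) = a * m + x - y := by
    rw [← hpq']; linarith
  have hp1 : p < 2 := by
    by_contra h
    have : (2 : ℝ) ≤ p := by exact_mod_cast not_lt.1 h
    nlinarith
  have hp2 : -2 < p := by
    by_contra h
    have : (p : ℝ) ≤ -2 := by exact_mod_cast not_lt.1 h
    nlinarith
  have hp3 : (p : ℝ) ≤ 1 := by exact_mod_cast (by omega : p ≤ 1)
  have hp4 : (-1 : ℝ) ≤ p := by exact_mod_cast (by omega : -1 ≤ p)
  constructor <;> nlinarith

/-- On a loop with a short bottom edge, two functions with different incoming slopes cannot both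
be without a chip. -/
theorem loop_no_two_free {l m : ℝ} {p q a : ℤ} (hm : 0 < m) (hlm : 1000 * m ≤ l)
    (hpq : p + q = a) (ha : |a| ≤ 9) (h : (p : ℝ) * l = q * m) : a = 0 := by
  have hpq' : (p : ℝ) + q = a := by exact_mod_cast hpq
  have ha1 : (-9 : ℝ) ≤ a := by exact_mod_cast (abs_le.1 ha).1
  have ha2 : (a : ℝ) ≤ 9 := by exact_mod_cast (abs_le.1 ha).2
  have e : (p : ℝ) * (l + m) = a * m := by rw [← hpq']; linarith
  have hp1 : p < 1 := by
    by_contra h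
    have : (1 : ℝ) ≤ p := by exact_mod_cast not_lt.1 h
    nlinarith
  have hp2 : -1 < p := by
    by_contra h
    have : (p : ℝ) ≤ -1 := by exact_mod_cast not_lt.1 h
    nlinarith
  have hp : p = 0 := by omega
  rw [hp] at e
  have : (a : ℝ) * m = 0 := by rw [← e]; simp
  rcases mul_eq_zero.1 this with h | h
  · exact_mod_cast h
  · exact absurd h hm.ne'

/-- The position of the chip of a function, relative to one without a chip, on a loop with a short
bottom edge. -/
theorem loop_chip_position {l m : ℝ} {p q a N : ℤ} {hT hB : ℝ → ℝ} (hm : 0 < m)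
    (hlm : 1000 * m ≤ l) (hpq : p + q = a) (ha : |a| ≤ 9)
    (hchip : IsLoopChip l m hT hB N) (hN : N ≠ 0) (h : p * l - hT l = q * m - hB m) :
    (2 ≤ a ∧ p = 1 ∧ hT = ramp ((a - 1) * m)) ∨ (a < 0 ∧ p = 0 ∧ hT = ramp (l + a * m)) := by
  have hpq' : (p : ℝ) + q = a := by exact_mod_cast hpq
  have ha1 : (-9 : ℝ) ≤ a := by exact_mod_cast (abs_le.1 ha).1
  have ha2 : (a : ℝ) ≤ 9 := by exact_mod_cast (abs_le.1 ha).2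
  rcases hchip with ⟨-, -, rfl⟩ | ⟨d, h0, h1, rfl, rfl, -⟩ | ⟨d, h0, h1, rfl, rfl, -⟩
  · exact absurd rfl hN
  · rw [ramp_of_ge h1.le] at h
    have e : (p : ℝ) * (l + m) = a * m + l - d := by rw [← hpq']; linarith
    have hp1 : p < 2 := by
      by_contra h
      have : (2 : ℝ) ≤ p := by exact_mod_cast not_lt.1 h
      nlinarith
    have hp2 : -1 < p := by
      by_contra h
      have : (p : ℝ) ≤ -1 := by exact_mod_cast not_lt.1 h
      nlinarith
    obtain rfl | rfl : p = 0 ∨ p = 1 := by omega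
    · right
      have hd : d = l + a * m := by push_cast at e; linarith
      have : a < 0 := by
        by_contra hn
        have : (0 : ℝ) ≤ a := by exact_mod_cast not_lt.1 hn
        nlinarith
      exact ⟨this, rfl, by rw [hd]⟩
    · left
      have hd : d = (a - 1) * m := by push_cast at e; linarith
      have : 1 < a := by
        by_contra hn
        have : (a : ℝ) ≤ 1 := by exact_mod_cast not_lt.1 hn
        nlinarith
      exact ⟨this, rfl, by rw [hd]⟩
  · exfalso
    rw [ramp_of_ge h1.le] at h
    have e : (p : ℝ) * (l + m) = (a - 1) * m + d := by rw [← hpq']; linarith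
    have hp1 : p < 1 := by
      by_contra h
      have : (1 : ℝ) ≤ p := by exact_mod_cast not_lt.1 h
      nlinarith
    have hp2 : -1 < p := by
      by_contra h
      have : (p : ℝ) ≤ -1 := by exact_mod_cast not_lt.1 h
      nlinarith
    have hp : p = 0 := by omega
    rw [hp] at e
    have h2 : d = (1 - a) * m := by push_cast at e; linarith
    have h3 : (0 : ℝ) < 1 - a := by
      by_contra hn
      nlinarith
    have h4 : (1 : ℝ) - a < 1 := by
      by_contra hn
      nlinarith
    have h3' : a < 1 := by exact_mod_cast (by linarith : (a : ℝ) < 1)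
    have h4' : 0 < a := by exact_mod_cast (by linarith : (0 : ℝ) < a)
    omega

/-- The value, in units of the length `m` of the bottom edge, at distance `c * m` from the left end
on the top edge, relative to the value at the right end; here `α` is the outgoing slope. Both are
relative to the function without a chip on the loop. -/
def nearLeft (c : ℕ) (α : ℤ) : ℤ := if α < 0 then -α - 1 else -max 0 (α - c)

/-- The value, in units of the length `m` of the bottom edge, at distance `c * m` from the right end
on the top edge, relative to the value at the right end; here `α` is the outgoing slope. Both are
relative to the function without a chip on the loop. -/
def nearRight (c : ℕ) (α : ℤ) : ℤ := if α < 0 then min c (-α - 1) else 0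

namespace VASystem

variable {D : Γ.graph.Divisor} {E : Fin 7 → Γ.graph.Divisor} {φ : Fin 7 → Γ.Point → ℝ}
  (S : VASystem Γ D E φ)

include S

theorem abs_change_le (i i' : Fin 7) (k : Fin g) (hlm : 1000 * Γ.m k ≤ Γ.l k) :
    |(φ i (Γ.bridgeL k.succ) - φ i (Γ.bridgeR k.castSucc)) -
      (φ i' (Γ.bridgeL k.succ) - φ i' (Γ.bridgeR k.castSucc))| ≤ 11 * Γ.m k := by
  have hm := Γ.m_pos k
  have hl := Γ.l_pos k
  obtain ⟨cT, cB, κ, h⟩ := S.loop_shape k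
  obtain ⟨hT, hB, N, p, q, hN, -, hpq, hpT, hpB⟩ := h i
  obtain ⟨hT', hB', N', p', q', hN', -, hpq', hpT', hpB'⟩ := h i'
  have e1 := hpT _ ⟨hl.le, le_rfl⟩
  have e2 := hpB _ ⟨hm.le, le_rfl⟩
  have e1' := hpT' _ ⟨hl.le, le_rfl⟩
  have e2' := hpB' _ ⟨hm.le, le_rfl⟩
  rw [topPt_len] at e1 e1'
  rw [botPt_len] at e2 e2'
  have b1 := hN.top_mem hl.le
  have b2 := hN.bot_mem hm.le
  have b1' := hN'.top_mem hl.le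
  have b2' := hN'.bot_mem hm.le
  refine loop_change_bound (p := p - p') (q := q - q')
    (x := hT (Γ.l k) - hT' (Γ.l k)) (y := hB (Γ.m k) - hB' (Γ.m k)) hm hlm rfl ?_ ?_ ?_ ?_ ?_
  · rw [show p - p' + (q - q') = slope (φ i) k.castSucc - slope (φ i') k.castSucc by omega]
    exact S.abs_slope_sub_le i i' _
  · rw [abs_le]; constructor <;> linarith [b1.1, b1.2, b1'.1, b1'.2]
  · rw [abs_le]; constructor <;> linarith [b2.1, b2.2, b2'.1, b2'.2]
  · push_cast; linarith
  · push_cast; linarith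

theorem jump_unique {i i' : Fin 7} {k : Fin g} (hlm : 1000 * Γ.m k ≤ Γ.l k)
    (hi : slope (φ i) k.succ = slope (φ i) k.castSucc + 1)
    (hi' : slope (φ i') k.succ = slope (φ i') k.castSucc + 1) : i = i' := by
  have hm := Γ.m_pos k
  have hl := Γ.l_pos k
  obtain ⟨cT, cB, κ, h⟩ := S.loop_shape k
  obtain ⟨hT, hB, N, p, q, hN, hs, hpq, hpT, hpB⟩ := h i
  obtain ⟨hT', hB', N', p', q', hN', hs', hpq', hpT', hpB'⟩ := h i'
  have e1 := hpT _ ⟨hl.le, le_rfl⟩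
  have e2 := hpB _ ⟨hm.le, le_rfl⟩
  have e1' := hpT' _ ⟨hl.le, le_rfl⟩
  have e2' := hpB' _ ⟨hm.le, le_rfl⟩
  rw [topPt_len] at e1 e1'
  rw [botPt_len] at e2 e2'
  obtain rfl : N = 0 := by omega
  obtain rfl : N' = 0 := by omega
  simp only [IsLoopChip, zero_ne_one, and_false, exists_false, or_false, and_true] at hN hN'
  obtain ⟨rfl, rfl⟩ := hN
  obtain ⟨rfl, rfl⟩ := hN'
  have := loop_no_two_free (p := p - p') (q := q - q') hm hlm rfl (by
    rw [show p - p' + (q - q') = slope (φ i) k.castSucc - slope (φ i') k.castSucc by omega]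
    exact S.abs_slope_sub_le i i' _) (by push_cast; linarith)
  refine (S.slope_strictMono k.castSucc).injective ?_
  omega

/-- The functions on a loop, relative to the function `φ j` without a chip there. -/
theorem loop_values {j : Fin 7} {k : Fin g} (hlm : 1000 * Γ.m k ≤ Γ.l k)
    (hj : slope (φ j) k.succ = slope (φ j) k.castSucc + 1) (i : Fin 7) {c : ℕ} (hc : c ≤ 10) :
    (φ i (Γ.topPt k (c * Γ.m k)) - φ i (Γ.bridgeL k.succ)) -
        (φ j (Γ.topPt k (c * Γ.m k)) - φ j (Γ.bridgeL k.succ)) =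
      Γ.m k * nearLeft c (slope (φ i) k.succ - slope (φ j) k.succ) ∧
    (φ i (Γ.topPt k (Γ.l k - c * Γ.m k)) - φ i (Γ.bridgeL k.succ)) -
        (φ j (Γ.topPt k (Γ.l k - c * Γ.m k)) - φ j (Γ.bridgeL k.succ)) =
      Γ.m k * nearRight c (slope (φ i) k.succ - slope (φ j) k.succ) := by
  have hm := Γ.m_pos k
  have hl := Γ.l_pos k
  have hc' : (c : ℝ) ≤ 10 := by exact_mod_cast hc
  have hc0 : (0 : ℝ) ≤ c := Nat.cast_nonneg c
  have hcm0 : 0 ≤ c * Γ.m k := by positivity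
  have hcm : c * Γ.m k ≤ 10 * Γ.m k := by gcongr
  rcases eq_or_ne i j with rfl | hij
  · simp [nearLeft, nearRight]
  have hnj : slope (φ i) k.succ ≠ slope (φ i) k.castSucc + 1 :=
    fun h => hij (S.jump_unique hlm h hj)
  have hi : slope (φ i) k.succ = slope (φ i) k.castSucc :=
    (S.slope_succ i k).resolve_right hnj
  obtain ⟨cT, cB, κ, h⟩ := S.loop_shape k
  obtain ⟨hT, hB, N, p, q, hN, hs, hpq, hpT, hpB⟩ := h i
  obtain ⟨hT', hB', N', p', q', hN', hs', hpq', hpT', hpB'⟩ := h j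
  have e1 := hpT _ ⟨hl.le, le_rfl⟩
  have e2 := hpB _ ⟨hm.le, le_rfl⟩
  have e1' := hpT' _ ⟨hl.le, le_rfl⟩
  have e2' := hpB' _ ⟨hm.le, le_rfl⟩
  rw [topPt_len] at e1 e1'
  rw [botPt_len] at e2 e2'
  have m1 : c * Γ.m k ∈ Set.Icc 0 (Γ.l k) := ⟨hcm0, by linarith⟩
  have m2 : Γ.l k - c * Γ.m k ∈ Set.Icc 0 (Γ.l k) := ⟨by linarith, by linarith⟩
  rw [hpT _ m1, hpT' _ m1, hpT _ m2, hpT' _ m2, e1, e1']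
  obtain rfl : N' = 0 := by omega
  simp only [IsLoopChip, zero_ne_one, and_false, exists_false, or_false, and_true] at hN'
  obtain ⟨rfl, rfl⟩ := hN'
  set a : ℤ := slope (φ i) k.castSucc - slope (φ j) k.castSucc with ha
  have ha9 : |a| ≤ 9 := S.abs_slope_sub_le i j _
  have ha0 : a ≠ 0 := fun h0 => hij ((S.slope_strictMono k.castSucc).injective (by
    omega))
  have hα : slope (φ i) k.succ - slope (φ j) k.succ = a - 1 := by omega
  rw [hα]
  have ha1 : (-9 : ℝ) ≤ a := by exact_mod_cast (abs_le.1 ha9).1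
  have ha2 : (a : ℝ) ≤ 9 := by exact_mod_cast (abs_le.1 ha9).2
  rcases loop_chip_position (p := p - p') (q := q - q') hm hlm (by omega) ha9 hN (by omega)
    (by push_cast; linarith) with ⟨h2, hp, rfl⟩ | ⟨h2, hp, rfl⟩
  · have hp' : (p : ℝ) = p' + 1 := by exact_mod_cast (by omega : p = p' + 1)
    have h2' : (2 : ℝ) ≤ a := by exact_mod_cast h2
    have f1 : ((a : ℝ) - 1) * Γ.m k ≤ 8 * Γ.m k := by gcongr; linarith
    rw [ramp_of_ge (show ((a : ℝ) - 1) * Γ.m k ≤ Γ.l k by linarith),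
      ramp_of_ge (show ((a : ℝ) - 1) * Γ.m k ≤ Γ.l k - c * Γ.m k by linarith), hp',
      nearLeft, nearRight, if_neg (by omega), if_neg (by omega)]
    refine ⟨?_, by push_cast; ring⟩
    rcases le_total (c : ℤ) (a - 1) with hca | hca
    · have hca' : (c : ℝ) ≤ a - 1 := by exact_mod_cast hca
      rw [ramp_of_le (by gcongr), max_eq_right (by omega)]
      push_cast; ring
    · have hca' : (a : ℝ) - 1 ≤ c := by exact_mod_cast hca
      rw [ramp_of_ge (by gcongr), max_eq_left (by omega)]
      push_cast; ring
  · have hp' : (p : ℝ) = p' := by exact_mod_cast (by omega : p = p')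
    have h2' : (a : ℝ) ≤ -1 := by exact_mod_cast (by omega : a ≤ -1)
    have f1 : -9 * Γ.m k ≤ (a : ℝ) * Γ.m k := by gcongr
    have f2 : (a : ℝ) * Γ.m k ≤ -1 * Γ.m k := by gcongr
    rw [ramp_of_ge (show Γ.l k + a * Γ.m k ≤ Γ.l k by linarith),
      ramp_of_le (show c * Γ.m k ≤ Γ.l k + a * Γ.m k by linarith), hp',
      nearLeft, nearRight, if_pos (by omega), if_pos (by omega)]
    refine ⟨by push_cast; ring, ?_⟩
    rcases le_total (c : ℤ) (-(a - 1) - 1) with hca | hca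
    · have hca' : (c : ℝ) ≤ -a := by
        have : (c : ℤ) ≤ -a := by omega
        exact_mod_cast this
      have f3 : c * Γ.m k ≤ -a * Γ.m k := by gcongr
      rw [ramp_of_ge (by linarith), min_eq_left (by omega)]
      push_cast; ring
    · have hca' : -(a : ℝ) ≤ c := by
        have : -a ≤ (c : ℤ) := by omega
        exact_mod_cast this
      have f3 : -a * Γ.m k ≤ c * Γ.m k := by gcongr
      rw [ramp_of_le (by linarith), min_eq_right (by omega)]
      push_cast; ring

end VASystem

end ChainOfLoops

/-! ### A smallest function on a loop -/

/-- Pairs of indices `i ≤ j`, which index the functions `φ i + φ j`. -/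
abbrev IdxPair : Type := {p : Fin 7 × Fin 7 // p.1 ≤ p.2}

theorem IdxPair.eq_of_sum_eq {α : Fin 7 → ℤ} (hα : StrictMono α) {p q : IdxPair}
    (h1 : α p.1.1 = α q.1.1) (h : α p.1.1 + α p.1.2 = α q.1.1 + α q.1.2) : p = q :=
  Subtype.ext (Prod.ext (hα.injective h1) (hα.injective (by omega)))

open ChainOfLoops in
/-- Among at most three functions which have the same outgoing slope on a loop and are aligned at
its right end, one is smaller than the others at some point of the loop. What matters is the number
of negative slopes in each pair: a pair with strictly the most of them wins at the left
vertex, and one with strictly the fewest wins near the right vertex. -/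
theorem exists_loop_winner {α : Fin 7 → ℤ} (hα : StrictMono α) (hne : ∀ i, α i ≠ -1)
    (h9 : ∀ i, |α i| ≤ 9) {A : Finset IdxPair} (hA : A.Nonempty) (hcard : A.card ≤ 3) {τ : ℤ}
    (hτ : ∀ p ∈ A, α p.1.1 + α p.1.2 = τ) :
    ∃ p ∈ A, ∃ c : ℕ, c ≤ 10 ∧
      ((∀ q ∈ A, q ≠ p → nearLeft c (α p.1.1) + nearLeft c (α p.1.2) + 1 ≤
        nearLeft c (α q.1.1) + nearLeft c (α q.1.2)) ∨
      (∀ q ∈ A, q ≠ p → nearRight c (α p.1.1) + nearRight c (α p.1.2) + 1 ≤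
        nearRight c (α q.1.1) + nearRight c (α q.1.2))) := by
  classical
  set low : IdxPair → ℤ := fun p => (if α p.1.1 < 0 then 1 else 0) + (if α p.1.2 < 0 then 1 else 0)
    with hlow
  have hle : ∀ p : IdxPair, α p.1.1 ≤ α p.1.2 := fun p => hα.monotone p.2
  have hb : ∀ i, -9 ≤ α i ∧ α i ≤ 9 := fun i => abs_le.1 (h9 i)
  have hL0 : ∀ p ∈ A, nearLeft 0 (α p.1.1) + nearLeft 0 (α p.1.2) = -τ - low p := by
    intro p hp
    have := hτ p hp
    simp only [nearLeft, hlow]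
    split_ifs <;> omega
  have hR1 : ∀ p ∈ A, nearRight 1 (α p.1.1) + nearRight 1 (α p.1.2) = low p := by
    intro p hp
    have := hne p.1.1
    have := hne p.1.2
    simp only [nearRight, hlow]
    split_ifs <;> omega
  obtain ⟨a, haA, ha⟩ := A.exists_max_image low hA
  obtain ⟨b, hbA, hb'⟩ := A.exists_min_image low hA
  by_cases hmax : ∀ q ∈ A, q ≠ a → low q < low a
  · refine ⟨a, haA, 0, by omega, .inl fun q hq hqa => ?_⟩
    rw [hL0 a haA, hL0 q hq]
    have := hmax q hq hqa
    omega
  by_cases hmin : ∀ q ∈ A, q ≠ b → low b < low q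
  · refine ⟨b, hbA, 1, by omega, .inr fun q hq hqa => ?_⟩
    rw [hR1 b hbA, hR1 q hq]
    have := hmin q hq hqa
    omega
  have hall : ∀ q ∈ A, low q = low a := by
    by_contra hcon
    push Not at hmax hmin hcon
    obtain ⟨q, hq, hqa⟩ := hcon
    obtain ⟨a', ha'A, ha'ne, ha'⟩ := hmax
    obtain ⟨b', hb'A, hb'ne, hb''⟩ := hmin
    have h1 := ha q hq
    have h2 := ha a' ha'A
    have h3 := hb' q hq
    have h4 := hb' b' hb'A
    have d1 : a ≠ b := by rintro rfl; omega
    have d2 : a' ≠ b := by rintro rfl; omega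
    have d3 : a ≠ b' := by rintro rfl; omega
    have d4 : a' ≠ b' := by rintro rfl; omega
    have hsub : ({a, a', b, b'} : Finset IdxPair) ⊆ A := by
      intro x hx
      simp only [Finset.mem_insert, Finset.mem_singleton] at hx
      rcases hx with rfl | rfl | rfl | rfl <;> assumption
    have hc := Finset.card_le_card hsub
    rw [Finset.card_insert_of_notMem (by simp [ha'ne.symm, d1, d3]),
      Finset.card_insert_of_notMem (by simp [d2, d4]),
      Finset.card_insert_of_notMem (by simp [hb'ne.symm]), Finset.card_singleton] at hc
    omega
  have hlt : ∀ p q : IdxPair, p ∈ A → q ∈ A → q ≠ p → α p.1.1 ≤ α q.1.1 →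
      α p.1.1 < α q.1.1 ∧ α q.1.2 < α p.1.2 := by
    intro p q hp hq hqp h
    have h1 := hτ p hp
    have h2 := hτ q hq
    have h3 : α p.1.1 ≠ α q.1.1 := fun h' => hqp (IdxPair.eq_of_sum_eq hα h' (by omega)).symm
    omega
  obtain ⟨p, hpA, hp⟩ := A.exists_min_image (fun p => α p.1.1) hA
  obtain ⟨p', hpA', hp'⟩ := A.exists_max_image (fun p => α p.1.1) hA
  rcases lt_or_ge (α a.1.2) 0 with h2 | h2
  · -- All slopes are negative: the outermost pair wins near the right vertex.
    have hneg : ∀ q ∈ A, α q.1.1 < 0 ∧ α q.1.2 < 0 := by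
      intro q hq
      have h1 := hall q hq
      have h3 := hle a
      simp only [hlow] at h1
      rw [if_pos h2, if_pos (by omega : α a.1.1 < 0)] at h1
      split_ifs at h1 <;> omega
    refine ⟨p, hpA, (-α p.1.2).toNat, by have := hb p.1.2; omega, .inr fun q hq hqp => ?_⟩
    have h3 := hlt p q hpA hq hqp (hp q hq)
    have h4 := hneg p hpA
    have h5 := hneg q hq
    have h6 := hle q
    rw [nearRight, nearRight, nearRight, nearRight, if_pos h4.1, if_pos h4.2, if_pos h5.1,
      if_pos h5.2]
    omega
  rcases lt_or_ge (α a.1.1) 0 with h1 | h1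
  · -- One slope of each pair is negative: the innermost pair wins in the middle.
    have hneg : ∀ q ∈ A, α q.1.1 < 0 ∧ 0 ≤ α q.1.2 := by
      intro q hq
      have h3 := hall q hq
      have h4 := hle q
      simp only [hlow] at h3
      rw [if_pos h1, if_neg (by omega : ¬ α a.1.2 < 0)] at h3
      split_ifs at h3 <;> omega
    refine ⟨p', hpA', 10, le_rfl, .inl fun q hq hqp => ?_⟩
    have h3 := hlt q p' hq hpA' (Ne.symm hqp) (hp' q hq)
    have h4 := hneg p' hpA'
    have h5 := hneg q hq
    have h6 := hb p'.1.2
    have h7 := hb q.1.2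
    rw [nearLeft, nearLeft, nearLeft, nearLeft, if_pos h4.1, if_neg (by omega), if_pos h5.1,
      if_neg (by omega)]
    push_cast
    omega
  · -- No slope is negative: the outermost pair wins near the left vertex.
    have hneg : ∀ q ∈ A, 0 ≤ α q.1.1 ∧ 0 ≤ α q.1.2 := by
      intro q hq
      have h3 := hall q hq
      have h4 := hle q
      simp only [hlow] at h3
      rw [if_neg (by omega : ¬ α a.1.1 < 0), if_neg (by omega : ¬ α a.1.2 < 0)] at h3
      split_ifs at h3 <;> omega
    refine ⟨p, hpA, (α p.1.1 + 1).toNat, by have := hb p.1.1; omega, .inl fun q hq hqp => ?_⟩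
    have h3 := hlt p q hpA hq hqp (hp q hq)
    have h4 := hneg p hpA
    have h5 := hneg q hq
    have h6 := hle q
    rw [nearLeft, nearLeft, nearLeft, nearLeft, if_neg (by omega), if_neg (by omega),
      if_neg (by omega), if_neg (by omega)]
    have h7 := hτ p hpA
    have h8 := hτ q hq
    have hc : ((α p.1.1 + 1).toNat : ℤ) = α p.1.1 + 1 := Int.toNat_of_nonneg (by omega)
    rw [hc, max_eq_left (by omega), max_eq_right (by omega), max_eq_right (by omega),
      max_eq_right (by omega)]
    omega

/-! ### Counting pairs by their slope -/

/-- The number of pairs of indices with slope at least `σ`. -/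
def pairCount (s : Fin 7 → ℤ) (σ : ℤ) : ℕ :=
  (Finset.univ.filter fun p : IdxPair => σ ≤ s p.1.1 + s p.1.2).card

/-- The number of pairs of entries of a list whose sum is at least `θ`. -/
def listPairCount (θ : ℕ) : List ℕ → ℕ
  | [] => 0
  | x :: xs => (x :: xs).countP (fun y => θ.ble (x + y)) + listPairCount θ xs

/-- The inequalities that control the blocks of the construction, for a slope vector given by the
list `L` of its entries plus `3`; `A` is the number of preceding jumps. The first ensures that
the block of slope `σ` does not end before that of slope `σ + 1`, and the second that it has at
most two pairs to spare. -/
def BlockBounds (σ A : ℕ) (L : List ℕ) : Prop :=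
  (listPairCount (σ + 7) L + σ = A + 6 → A + 7 ≤ listPairCount (σ + 6) L + σ) ∧
    (listPairCount (σ + 7) L + σ = A + 5 → listPairCount (σ + 6) L + σ ≤ A + 8)

instance (σ A : ℕ) (L : List ℕ) : Decidable (BlockBounds σ A L) :=
  inferInstanceAs (Decidable (_ ∧ _))

set_option maxRecDepth 100000 in
/-- The inequalities hold for all `120` possible slope vectors. -/
theorem blockBounds_table : ∀ a b : Fin 4, a ≤ b → ∀ c : Fin 4, b ≤ c → ∀ d : Fin 4, c ≤ d →
    ∀ e : Fin 4, d ≤ e → ∀ f : Fin 4, e ≤ f → ∀ h : Fin 4, f ≤ h → ∀ σ : Fin 7,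
    BlockBounds σ (a + b + c + d + e + f + h : ℕ)
      [(a : ℕ), 1 + b, 2 + c, 3 + d, 4 + e, 5 + f, 6 + h] := by
  decide

theorem pairCount_eq_list {s : Fin 7 → ℤ} (a : Fin 7 → ℕ) (ha : ∀ i : Fin 7, s i = a i + i - 3)
    (σ : ℕ) : pairCount s σ = listPairCount (σ + 6)
      [a 0, 1 + a 1, 2 + a 2, 3 + a 3, 4 + a 4, 5 + a 5, 6 + a 6] := by
  have key : ∀ i j : Fin 7, ((σ : ℤ) ≤ s i + s j) ↔ σ + 6 ≤ (i + a i) + (j + a j) := by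
    intro i j
    rw [ha, ha]; omega
  have h1 : pairCount s σ = ∑ i : Fin 7, ∑ j : Fin 7,
      if i ≤ j then (if σ + 6 ≤ (i + a i) + (j + a j) then 1 else 0) else 0 := by
    rw [pairCount, Finset.card_filter, ← Fintype.sum_prod_type',
      ← Finset.sum_filter (fun p : Fin 7 × Fin 7 => p.1 ≤ p.2)]
    rw [Finset.sum_subtype (F := inferInstanceAs (Fintype IdxPair))
      (p := fun p : Fin 7 × Fin 7 => p.1 ≤ p.2) _ (by simp)]
    simp only [key]
  rw [h1]
  simp only [Fin.sum_univ_succ, Fin.sum_univ_zero, listPairCount, List.countP_cons, List.countP_nil]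
  simp [Fin.le_def]
  ring

/-- The number of jumps that lead from the initial slopes to the slope vector `s`. -/
def jumpCount (s : Fin 7 → ℤ) : ℤ := ∑ i, (s i - i + 3)

theorem pairCount_bounds {s : Fin 7 → ℤ} (hs : StrictMono s)
    (hb : ∀ i : Fin 7, (i : ℤ) - 3 ≤ s i ∧ s i ≤ i) {σ : ℕ} (hσ : σ ≤ 6) :
    ((pairCount s (σ + 1) : ℤ) + σ = jumpCount s + 6 → jumpCount s + 7 ≤ pairCount s σ + σ) ∧
    ((pairCount s (σ + 1) : ℤ) + σ = jumpCount s + 5 → pairCount s σ + σ ≤ jumpCount s + 8) := by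
  have hex : ∀ i : Fin 7, ∃ a : Fin 4, s i = ((a : ℕ) : ℤ) + i - 3 := by
    intro i
    have := hb i
    refine ⟨⟨(s i - i + 3).toNat, by omega⟩, ?_⟩
    have h := Int.toNat_of_nonneg (show 0 ≤ s i - i + 3 by omega)
    simp only
    omega
  choose a ha using hex
  have hmono : ∀ i j : Fin 7, (j : ℕ) = i + 1 → a i ≤ a j := by
    intro i j hij
    have h1 := hs (show i < j by rw [Fin.lt_def]; omega)
    rw [ha, ha] at h1
    rw [Fin.le_def]
    omega
  have h := blockBounds_table (a 0) (a 1) (hmono _ _ rfl) (a 2) (hmono _ _ rfl) (a 3)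
    (hmono _ _ rfl) (a 4) (hmono _ _ rfl) (a 5) (hmono _ _ rfl) (a 6) (hmono _ _ rfl)
    ⟨σ, by omega⟩
  have hJ : jumpCount s = (a 0 + a 1 + a 2 + a 3 + a 4 + a 5 + a 6 : ℕ) := by
    have : ∀ i : Fin 7, s i - i + 3 = (a i : ℕ) := fun i => by rw [ha]; ring
    simp only [jumpCount, this, Fin.sum_univ_succ, Fin.sum_univ_zero]
    push_cast
    ring_nf
  have h0 := pairCount_eq_list (s := s) (fun i => a i) ha σ
  have h1 := pairCount_eq_list (s := s) (fun i => a i) ha (σ + 1)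
  push_cast at h1
  rw [h0, h1, hJ]
  obtain ⟨h2, h3⟩ := h
  constructor
  · intro h4
    exact_mod_cast h2 (by exact_mod_cast h4)
  · intro h4
    exact_mod_cast h3 (by exact_mod_cast h4)

/-- When one slope jumps, at most one pair reaches the slope `σ`. -/
theorem pair_reaching_unique {s s' : Fin 7 → ℤ} {j : Fin 7} (hs : StrictMono s)
    (hs' : StrictMono s') (hj : s' = Function.update s j (s j + 1)) {σ : ℤ} {p q : IdxPair}
    (hp : s p.1.1 + s p.1.2 < σ) (hp' : σ ≤ s' p.1.1 + s' p.1.2)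
    (hq : s q.1.1 + s q.1.2 < σ) (hq' : σ ≤ s' q.1.1 + s' q.1.2) : p = q := by
  have hval : ∀ i, s' i = if i = j then s j + 1 else s i := by
    intro i
    rw [hj, Function.update_apply]
  -- A pair that reaches the slope `σ` consists of `j` and an index of slope `σ - 1 - s j`, except
  -- for the pair `(j, j)`, which excludes all others.
  have key : ∀ p : IdxPair, s p.1.1 + s p.1.2 < σ → σ ≤ s' p.1.1 + s' p.1.2 →
      (p.1.1 = j ∧ p.1.2 = j ∧ 2 * s j + 2 ≥ σ ∧ 2 * s j < σ) ∨
      (p.1.1 = j ∧ p.1.2 ≠ j ∧ s p.1.2 = σ - 1 - s j) ∨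
      (p.1.1 ≠ j ∧ p.1.2 = j ∧ s p.1.1 = σ - 1 - s j) := by
    intro p hp hp'
    rw [hval, hval] at hp'
    by_cases h1 : p.1.1 = j <;> by_cases h2 : p.1.2 = j
    · rw [if_pos h1, if_pos h2] at hp'
      rw [h1, h2] at hp
      exact .inl ⟨h1, h2, by omega, by omega⟩
    · rw [if_pos h1, if_neg h2] at hp'
      rw [h1] at hp
      exact .inr (.inl ⟨h1, h2, by omega⟩)
    · rw [if_neg h1, if_pos h2] at hp'
      rw [h2] at hp
      exact .inr (.inr ⟨h1, h2, by omega⟩)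
    · rw [if_neg h1, if_neg h2] at hp'
      omega
  have hno : ∀ i, i ≠ j → s i ≠ s j ∧ s i ≠ s j + 1 := by
    intro i hi
    refine ⟨fun h => hi (hs.injective h), fun h => hi (hs'.injective ?_)⟩
    rw [hval, hval, if_neg hi, if_pos rfl, h]
  have hp2 := p.2
  have hq2 := q.2
  rcases key p hp hp' with ⟨a1, a2, a3, a4⟩ | ⟨a1, a2, a3⟩ | ⟨a1, a2, a3⟩ <;>
    rcases key q hq hq' with ⟨b1, b2, b3, b4⟩ | ⟨b1, b2, b3⟩ | ⟨b1, b2, b3⟩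
  · exact Subtype.ext (Prod.ext (a1.trans b1.symm) (a2.trans b2.symm))
  · have := hno _ b2; omega
  · have := hno _ b1; omega
  · have := hno _ a2; omega
  · exact Subtype.ext (Prod.ext (a1.trans b1.symm) (hs.injective (a3.trans b3.symm)))
  · have h := hs.injective (a3.trans b3.symm)
    rw [a1, h] at hp2
    rw [b2] at hq2
    exact absurd (le_antisymm hp2 hq2).symm b1
  · have := hno _ a1; omega
  · have h := hs.injective (a3.trans b3.symm)
    rw [a2, h] at hp2
    rw [b1] at hq2
    exact absurd (le_antisymm hp2 hq2) b2
  · exact Subtype.ext (Prod.ext (hs.injective (a3.trans b3.symm)) (a2.trans b2.symm))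

/-- The slopes of the functions `φ i` along a chain of `g` loops: at each loop, at most one of them
increases, by one. -/
structure SlopePath (g : ℕ) (s : ℕ → Fin 7 → ℤ) : Prop where
  zero : ∀ i : Fin 7, s 0 i = (i : ℤ) - 3
  last : ∀ i : Fin 7, s g i = i
  strictMono : ∀ k, StrictMono (s k)
  step : ∀ k, s (k + 1) = s k ∨ (k < g ∧ ∃ j, s (k + 1) = Function.update (s k) j (s k j + 1))

/-- The slope of `φ i + φ j` for a pair `(i, j)`. -/
def pairSlope (s : Fin 7 → ℤ) (p : IdxPair) : ℤ := s p.1.1 + s p.1.2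

/-- The number of pairs of slope at least `σ` that are left for the block of slope `σ`. Indeed, one
pair is used up for each jump so far, and one more at the end of each of the `6 - σ` blocks of
larger slope. -/
def surplus (s : Fin 7 → ℤ) (σ : ℕ) : ℤ := pairCount s σ - jumpCount s + σ - 6

theorem pairCount_mono {s s' : Fin 7 → ℤ} (h : s ≤ s') (σ : ℤ) : pairCount s σ ≤ pairCount s' σ :=
  Finset.card_le_card fun p hp => by
    simp only [Finset.mem_filter, Finset.mem_univ, true_and] at hp ⊢
    have h1 : s p.1.1 ≤ s' p.1.1 := h _
    have h2 : s p.1.2 ≤ s' p.1.2 := h _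
    omega

theorem jumpCount_update (s : Fin 7 → ℤ) (j : Fin 7) :
    jumpCount (Function.update s j (s j + 1)) = jumpCount s + 1 := by
  have : ∀ i : Fin 7, Function.update s j (s j + 1) i - i + 3 =
      (s i - i + 3) + if i = j then 1 else 0 := by
    intro i
    rw [Function.update_apply]
    split_ifs with h
    · rw [h]; ring
    · ring
  simp only [jumpCount, this]
  rw [Finset.sum_add_distrib]
  simp

namespace SlopePath

variable {g : ℕ} {s : ℕ → Fin 7 → ℤ} (H : SlopePath g s)

include H

theorem monotone : Monotone s := by
  refine monotone_nat_of_le_succ fun k => ?_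
  rcases H.step k with h | ⟨-, j, h⟩
  · exact h.ge
  · rw [h]
    exact le_update_iff.2 ⟨by omega, fun _ _ => le_rfl⟩

theorem pairSlope_mono {k k' : ℕ} (h : k ≤ k') (p : IdxPair) :
    pairSlope (s k) p ≤ pairSlope (s k') p :=
  add_le_add (H.monotone h _) (H.monotone h _)

theorem bounds {k : ℕ} (hk : k ≤ g) (i : Fin 7) : (i : ℤ) - 3 ≤ s k i ∧ s k i ≤ i :=
  ⟨H.zero i ▸ H.monotone (Nat.zero_le k) i, H.last i ▸ H.monotone hk i⟩

theorem surplus_succ (σ k : ℕ) :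
    surplus (s (k + 1)) σ ≤ surplus (s k) σ ∧ surplus (s k) σ - 1 ≤ surplus (s (k + 1)) σ := by
  rcases H.step k with h | ⟨-, j, h⟩
  · rw [h]; exact ⟨le_rfl, by omega⟩
  · have hJ : jumpCount (s (k + 1)) = jumpCount (s k) + 1 := by rw [h, jumpCount_update]
    have h1 := pairCount_mono (H.monotone (Nat.le_succ k)) σ
    have h2 : pairCount (s (k + 1)) σ ≤ pairCount (s k) σ + 1 := by
      classical
      have hsub : (Finset.univ.filter fun p : IdxPair =>
            (σ : ℤ) ≤ s (k + 1) p.1.1 + s (k + 1) p.1.2) ⊆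
          (Finset.univ.filter fun p : IdxPair => (σ : ℤ) ≤ s k p.1.1 + s k p.1.2) ∪
          (Finset.univ.filter fun p : IdxPair => s k p.1.1 + s k p.1.2 < σ ∧
            (σ : ℤ) ≤ s (k + 1) p.1.1 + s (k + 1) p.1.2) := by
        intro p hp
        simp only [Finset.mem_union, Finset.mem_filter, Finset.mem_univ, true_and] at hp ⊢
        omega
      refine (Finset.card_le_card hsub).trans ((Finset.card_union_le _ _).trans
        (Nat.add_le_add_left (Finset.card_le_one.2 fun p hp q hq => ?_) _))
      simp only [Finset.mem_filter, Finset.mem_univ, true_and] at hp hq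
      exact pair_reaching_unique (H.strictMono k) (H.strictMono (k + 1)) h hp.1 hp.2 hq.1 hq.2
    simp only [surplus, Nat.succ_eq_add_one] at *
    omega

theorem surplus_anti (σ : ℕ) : Antitone fun k => surplus (s k) σ :=
  antitone_nat_of_succ_le fun k => (H.surplus_succ σ k).1

theorem surplus_zero (σ : ℕ) : surplus (s 0) σ =
    listPairCount (σ + 6) [0, 1, 2, 3, 4, 5, 6] + σ - 6 := by
  have h := pairCount_eq_list (s := s 0) (fun _ => 0) (fun i => by rw [H.zero]; simp) σ
  have hJ : jumpCount (s 0) = 0 := by simp [jumpCount, H.zero]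
  rw [surplus, h, hJ]; simp

theorem surplus_last (σ : ℕ) : surplus (s g) σ =
    listPairCount (σ + 6) [3, 4, 5, 6, 7, 8, 9] + σ - 27 := by
  have h := pairCount_eq_list (s := s g) (fun _ => 3) (fun i => by rw [H.last]; push_cast; ring) σ
  have hJ : jumpCount (s g) = 21 := by simp [jumpCount, H.last]
  rw [surplus, h, hJ]; norm_num; ring

theorem one_le_surplus_zero {σ : ℕ} (hσ : σ ≤ 6) : 1 ≤ surplus (s 0) σ := by
  rw [H.surplus_zero]
  interval_cases σ <;> decide

theorem surplus_last_le {σ : ℕ} (hσ : σ ≤ 6) : surplus (s g) σ ≤ 1 := by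
  rw [H.surplus_last]
  interval_cases σ <;> decide

end SlopePath

open Classical in
/-- The index of the bridge at which the block of slope `σ` ends: the last one on which exactly one
pair is left for this block. The value `0` for `σ > 6` marks the beginning of the first block. -/
noncomputable def blockEnd (g : ℕ) (s : ℕ → Fin 7 → ℤ) (σ : ℕ) : ℕ :=
  if σ ≤ 6 then Nat.findGreatest (fun k => surplus (s k) σ = 1) g else 0

theorem blockEnd_le (g : ℕ) (s : ℕ → Fin 7 → ℤ) (σ : ℕ) : blockEnd g s σ ≤ g := by
  unfold blockEnd
  split_ifs
  exacts [Nat.findGreatest_le _, Nat.zero_le _]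

namespace SlopePath

variable {g : ℕ} {s : ℕ → Fin 7 → ℤ} (H : SlopePath g s)

include H

theorem surplus_blockEnd {σ : ℕ} (hσ : σ ≤ 6) : surplus (s (blockEnd g s σ)) σ = 1 := by
  classical
  have hex : ∃ k ≤ g, surplus (s k) σ = 1 := by
    by_contra hcon
    push Not at hcon
    have : ∀ k ≤ g, 1 < surplus (s k) σ := by
      intro k
      induction k with
      | zero => exact fun h => lt_of_le_of_ne (H.one_le_surplus_zero hσ) (hcon 0 h).symm
      | succ k ih =>
        intro h
        have h1 := ih (by omega)
        have h2 := (H.surplus_succ σ k).2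
        exact lt_of_le_of_ne (by omega) (hcon _ h).symm
    have h1 := this g le_rfl
    have h2 := H.surplus_last_le hσ
    omega
  obtain ⟨k, hk, h⟩ := hex
  rw [blockEnd, if_pos hσ]
  exact Nat.findGreatest_spec (P := fun k => surplus (s k) σ = 1) hk h

theorem surplus_of_gt {σ k : ℕ} (hσ : σ ≤ 6) (h : blockEnd g s σ < k) (hk : k ≤ g) :
    surplus (s k) σ ≤ 0 := by
  classical
  have h1 := H.surplus_anti σ h.le
  simp only [H.surplus_blockEnd hσ] at h1
  have h2 : surplus (s k) σ ≠ 1 := by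
    rw [blockEnd, if_pos hσ] at h
    exact Nat.findGreatest_is_greatest h hk
  omega

theorem one_le_surplus {σ k : ℕ} (hσ : σ ≤ 6) (h : k ≤ blockEnd g s σ) :
    1 ≤ surplus (s k) σ := by
  have := H.surplus_anti σ h
  simp only [H.surplus_blockEnd hσ] at this
  exact this

theorem surplus_bounds {k σ : ℕ} (hk : k ≤ g) (hσ : σ ≤ 6) :
    (surplus (s k) (σ + 1) = 1 → 1 ≤ surplus (s k) σ) ∧
    (surplus (s k) (σ + 1) = 0 → surplus (s k) σ ≤ 2) := by
  have := pairCount_bounds (H.strictMono k) (H.bounds hk) hσ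
  simp only [surplus]
  push_cast at this ⊢
  constructor
  · intro h
    have := this.1 (by omega)
    omega
  · intro h
    have := this.2 (by omega)
    omega

theorem blockEnd_succ_le (σ : ℕ) : blockEnd g s (σ + 1) ≤ blockEnd g s σ := by
  by_cases hσ : σ + 1 ≤ 6
  · by_contra hlt
    have h1 := H.surplus_of_gt (by omega : σ ≤ 6) (not_le.1 hlt) (blockEnd_le _ _ _)
    have h2 := (H.surplus_bounds (blockEnd_le g s (σ + 1)) (by omega : σ ≤ 6)).1
      (H.surplus_blockEnd hσ)
    omega
  · rw [blockEnd, if_neg hσ]; exact Nat.zero_le _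

theorem blockEnd_zero : blockEnd g s 0 = g := by
  refine le_antisymm (blockEnd_le _ _ _) ?_
  by_contra hlt
  have h1 := H.surplus_of_gt (by omega : 0 ≤ 6) (not_le.1 hlt) le_rfl
  have h2 := H.surplus_last 0
  rw [h2] at h1
  revert h1
  decide

/-- After the first bridge of a block, at most two pairs are left for it. -/
theorem surplus_le_two {σ k : ℕ} (hσ : σ ≤ 6) (h : blockEnd g s (σ + 1) < k) (hk : k ≤ g) :
    surplus (s k) σ ≤ 2 := by
  rcases hσ.eq_or_lt with rfl | hσ'
  · have h1 := H.surplus_anti 6 (Nat.zero_le k)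
    have h2 : surplus (s 0) 6 = 1 := by rw [H.surplus_zero]; decide
    simp only [h2] at h1
    omega
  · have h1 := H.surplus_of_gt (by omega : σ + 1 ≤ 6) (Nat.lt_succ_self _) (by omega)
    have h2 := (H.surplus_succ (σ + 1) (blockEnd g s (σ + 1))).2
    rw [H.surplus_blockEnd (by omega)] at h2
    have h3 := (H.surplus_bounds (k := blockEnd g s (σ + 1) + 1) (by omega) hσ).2 (by
      simp only [Nat.succ_eq_add_one] at h1; omega)
    exact (H.surplus_anti σ (Nat.succ_le_of_lt h)).trans h3

theorem pairCount_blockEnd {σ : ℕ} (hσ : σ ≤ 7) :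
    (pairCount (s (blockEnd g s σ)) σ : ℤ) = jumpCount (s (blockEnd g s σ)) + 7 - σ := by
  rcases hσ.eq_or_lt with rfl | hσ'
  · have h : surplus (s 0) 7 = 1 := by rw [H.surplus_zero]; decide
    rw [blockEnd, if_neg (by omega)]
    simp only [surplus] at h
    push_cast at h ⊢
    omega
  · have h := H.surplus_blockEnd (by omega : σ ≤ 6)
    simp only [surplus] at h
    omega

end SlopePath

/-! ### Assigning a station to each function -/

/-- The pairs whose slope passes through the value `σ` between the bridges `a` and `b`. -/
def slopePool (s : ℕ → Fin 7 → ℤ) (σ a b : ℕ) : Finset IdxPair :=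
  Finset.univ.filter fun p => pairSlope (s a) p ≤ σ ∧ (σ : ℤ) ≤ pairSlope (s b) p

theorem mem_slopePool {s : ℕ → Fin 7 → ℤ} {σ a b : ℕ} {p : IdxPair} :
    p ∈ slopePool s σ a b ↔ pairSlope (s a) p ≤ σ ∧ (σ : ℤ) ≤ pairSlope (s b) p := by
  simp [slopePool]

/-- An assignment of the pairs in `P` to loops in the block from `a` to `b`, made for the loops
before the bridge `k`. The value `b` stands for a pair that has no loop yet. A pair is assigned
either to a loop at which its slope jumps above `σ`, or to a loop where it wins against all pairs
of slope at least `σ` that are not yet assigned. -/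
structure PartialSchedule (s : ℕ → Fin 7 → ℤ) (Win : ℕ → IdxPair → Finset IdxPair → Prop)
    (σ a b : ℕ) (P : Finset IdxPair) (k : ℕ) (st : IdxPair → ℕ) : Prop where
  card : ((P.filter (st · < b)).card : ℤ) = jumpCount (s k) - jumpCount (s a)
  le : ∀ p ∈ P, st p ≤ b
  idle : ∀ p ∈ P, st p = b → pairSlope (s k) p ≤ σ
  assigned : ∀ p ∈ P, st p < b → a ≤ st p ∧ st p < k ∧ pairSlope (s (st p)) p ≤ σ ∧
    σ ≤ pairSlope (s (st p + 1)) p ∧ (σ < pairSlope (s (st p + 1)) p ∨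
      ∃ A, Win (st p) p A ∧ ∀ q ∈ P, st p < st q → σ ≤ pairSlope (s (st p + 1)) q → q ∈ A)
  inj : ∀ p ∈ P, ∀ q ∈ P, st p = st q → st p < b → p = q

namespace SlopePath

variable {g : ℕ} {s : ℕ → Fin 7 → ℤ} (H : SlopePath g s)

include H

theorem card_slopePool_filter {σ k : ℕ} (hσ : σ ≤ 6) (hk : blockEnd g s (σ + 1) ≤ k)
    (hk' : k ≤ blockEnd g s σ) :
    (((slopePool s σ (blockEnd g s (σ + 1)) (blockEnd g s σ)).filter
      fun p => (σ : ℤ) ≤ pairSlope (s k) p).card : ℤ) =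
      surplus (s k) σ + jumpCount (s k) - jumpCount (s (blockEnd g s (σ + 1))) := by
  classical
  have h1 : (slopePool s σ (blockEnd g s (σ + 1)) (blockEnd g s σ)).filter
      (fun p => (σ : ℤ) ≤ pairSlope (s k) p) =
      (Finset.univ.filter fun p : IdxPair => (σ : ℤ) ≤ s k p.1.1 + s k p.1.2) \
        (Finset.univ.filter fun p : IdxPair => ((σ + 1 : ℕ) : ℤ) ≤
          s (blockEnd g s (σ + 1)) p.1.1 + s (blockEnd g s (σ + 1)) p.1.2) := by
    ext p
    have h1 := H.pairSlope_mono hk p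
    have h2 := H.pairSlope_mono hk' p
    rw [Finset.mem_filter, mem_slopePool, Finset.mem_sdiff, Finset.mem_filter, Finset.mem_filter]
    simp only [Finset.mem_univ, true_and, pairSlope] at *
    push_cast
    omega
  have h2 : (Finset.univ.filter fun p : IdxPair => ((σ + 1 : ℕ) : ℤ) ≤
          s (blockEnd g s (σ + 1)) p.1.1 + s (blockEnd g s (σ + 1)) p.1.2) ⊆
      (Finset.univ.filter fun p : IdxPair => (σ : ℤ) ≤ s k p.1.1 + s k p.1.2) := by
    intro p
    have h1 := H.pairSlope_mono hk p
    simp only [Finset.mem_filter, Finset.mem_univ, true_and, pairSlope] at *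
    push_cast
    omega
  have h3 := H.pairCount_blockEnd (σ := σ + 1) (by omega)
  have h4 := Finset.card_le_card h2
  rw [h1, Finset.card_sdiff_of_subset h2, Nat.cast_sub h4]
  simp only [surplus, pairCount] at *
  push_cast at *
  omega

theorem partialSchedule_succ {Win : ℕ → IdxPair → Finset IdxPair → Prop}
    (geo : ∀ k < g, s (k + 1) ≠ s k → ∀ A : Finset IdxPair, A.Nonempty → A.card ≤ 3 → ∀ τ : ℤ,
      (∀ p ∈ A, pairSlope (s (k + 1)) p = τ) → ∃ p ∈ A, Win k p A)
    {σ a b k : ℕ} (hσ : σ ≤ 6) (ha : blockEnd g s (σ + 1) = a) (hb : blockEnd g s σ = b)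
    (hak : a ≤ k) (hkb : k < b) {st : IdxPair → ℕ}
    (S : PartialSchedule s Win σ a b (slopePool s σ a b) k st) :
    ∃ st', PartialSchedule s Win σ a b (slopePool s σ a b) (k + 1) st' := by
  classical
  have hbg : b ≤ g := hb ▸ blockEnd_le g s σ
  rcases H.step k with h | ⟨-, j, hj⟩
  · refine ⟨st, by rw [h]; exact S.card, S.le, by rw [h]; exact S.idle, fun p hp hpb => ?_, S.inj⟩
    obtain ⟨h1, h2, h3⟩ := S.assigned p hp hpb
    exact ⟨h1, by omega, h3⟩
  have hJ : jumpCount (s (k + 1)) = jumpCount (s k) + 1 := by rw [hj, jumpCount_update]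
  have hjump : s (k + 1) ≠ s k := fun h => by rw [h] at hJ; omega
  set P := slopePool s σ a b with hP
  set A := P.filter (fun p => st p = b ∧ (σ : ℤ) ≤ pairSlope (s (k + 1)) p) with hA
  have hmemA : ∀ p, p ∈ A ↔ p ∈ P ∧ st p = b ∧ (σ : ℤ) ≤ pairSlope (s (k + 1)) p := by
    intro p; rw [hA, Finset.mem_filter]
  have hcardA : (A.card : ℤ) = surplus (s (k + 1)) σ + 1 := by
    have h1 : A = P.filter (fun p => (σ : ℤ) ≤ pairSlope (s (k + 1)) p) \
        P.filter (st · < b) := by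
      ext p
      have := S.le p
      simp only [hmemA, Finset.mem_sdiff, Finset.mem_filter]
      constructor
      · rintro ⟨h1, h2, h3⟩; exact ⟨⟨h1, h3⟩, fun h => by omega⟩
      · rintro ⟨⟨h1, h2⟩, h3⟩
        have h4 := this h1
        have h5 : ¬ st p < b := fun h => h3 ⟨h1, h⟩
        exact ⟨h1, by omega, h2⟩
    have h2 : P.filter (st · < b) ⊆ P.filter (fun p => (σ : ℤ) ≤ pairSlope (s (k + 1)) p) := by
      intro p hp
      rw [Finset.mem_filter] at hp ⊢
      obtain ⟨-, h3, -, h4, -⟩ := S.assigned p hp.1 hp.2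
      exact ⟨hp.1, h4.trans (H.pairSlope_mono (by omega) p)⟩
    have h3 := H.card_slopePool_filter (k := k + 1) hσ (by omega) (by omega)
    rw [ha, hb, ← hP] at h3
    rw [h1, Finset.card_sdiff_of_subset h2, Nat.cast_sub (Finset.card_le_card h2), h3, S.card]
    omega
  have h1 := H.one_le_surplus (k := k + 1) hσ (by omega)
  have h2 := H.surplus_le_two (k := k + 1) hσ (by omega) (by omega)
  have hAne : A.Nonempty := Finset.card_pos.1 (by omega)
  -- A pair whose slope jumps above `σ` is taken first; otherwise the winner on the loop is taken.
  obtain ⟨p, hpA, hidle, hwin⟩ : ∃ p ∈ A,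
      (∀ q ∈ P, st q = b → q ≠ p → pairSlope (s (k + 1)) q ≤ σ) ∧
      (σ < pairSlope (s (k + 1)) p ∨ Win k p A) := by
    by_cases hex : ∃ p ∈ A, (σ : ℤ) < pairSlope (s (k + 1)) p
    · obtain ⟨p, hpA, hp⟩ := hex
      refine ⟨p, hpA, fun q hqP hqb hqp => ?_, .inl hp⟩
      by_contra hlt
      have hpA' := (hmemA p).1 hpA
      have hp1 := S.idle p hpA'.1 hpA'.2.1
      have hq1 := S.idle q hqP hqb
      simp only [pairSlope] at hp hp1 hq1 hlt
      exact hqp (pair_reaching_unique (H.strictMono k) (H.strictMono (k + 1)) hj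
        (σ := (σ : ℤ) + 1) (by omega) (by omega) (by omega) (by omega))
    · push Not at hex
      obtain ⟨p, hpA, hp⟩ := geo k (by omega) hjump A hAne (by omega) σ
        (fun p hp => le_antisymm (hex p hp) ((hmemA p).1 hp).2.2)
      refine ⟨p, hpA, fun q hqP hqb hqp => ?_, .inr hp⟩
      by_contra hlt
      exact hlt (hex q ((hmemA q).2 ⟨hqP, hqb, by omega⟩))
  obtain ⟨hpP, hpb, hpσ⟩ := (hmemA p).1 hpA
  have hval : ∀ q, Function.update st p k q = if q = p then k else st q := fun q => by
    rw [Function.update_apply]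
  refine ⟨Function.update st p k, ?_, ?_, ?_, ?_, ?_⟩
  · have h3 : P.filter (Function.update st p k · < b) = insert p (P.filter (st · < b)) := by
      ext q
      rw [Finset.mem_insert, Finset.mem_filter, Finset.mem_filter, hval]
      by_cases hqp : q = p
      · simp [hqp, hpP, hkb]
      · simp [hqp]
    rw [h3, Finset.card_insert_of_notMem (by rw [Finset.mem_filter]; omega)]
    push_cast
    rw [S.card]
    omega
  · intro q hq
    rw [hval]
    split_ifs
    exacts [by omega, S.le q hq]
  · intro q hq hqb
    rw [hval] at hqb
    split_ifs at hqb with h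
    · omega
    · exact hidle q hq hqb h
  · intro q hq hqb
    by_cases hqp : q = p
    · subst hqp
      rw [hval, if_pos rfl]
      refine ⟨hak, by omega, S.idle q hq hpb, hpσ, hwin.imp_right fun hw =>
        ⟨A, hw, fun r hr hkr hr' => (hmemA r).2 ⟨hr, ?_, hr'⟩⟩⟩
      rw [hval] at hkr
      split_ifs at hkr with h
      · omega
      · by_contra hne
        have := (S.assigned r hr (lt_of_le_of_ne (S.le r hr) hne)).2.1
        omega
    · rw [hval, if_neg hqp] at hqb ⊢
      obtain ⟨h3, h4, h5, h6, h7⟩ := S.assigned q hq hqb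
      refine ⟨h3, by omega, h5, h6, h7.imp_right fun ⟨B, hB, hB'⟩ => ⟨B, hB, fun r hr hqr =>
        hB' r hr ?_⟩⟩
      rw [hval] at hqr
      split_ifs at hqr with h
      · rw [h]; omega
      · exact hqr
  · intro q hq r hr hqr hqb
    rw [hval] at hqb
    rw [hval, hval] at hqr
    by_cases h3 : q = p <;> by_cases h4 : r = p
    · rw [h3, h4]
    · rw [if_pos h3, if_neg h4] at hqr
      have := (S.assigned r hr (by omega)).2.1
      omega
    · rw [if_neg h3, if_pos h4] at hqr
      rw [if_neg h3] at hqb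
      have := (S.assigned q hq (by omega)).2.1
      omega
    · rw [if_neg h3, if_neg h4] at hqr
      rw [if_neg h3] at hqb
      exact S.inj q hq r hr hqr hqb

theorem exists_block_schedule {Win : ℕ → IdxPair → Finset IdxPair → Prop}
    (geo : ∀ k < g, s (k + 1) ≠ s k → ∀ A : Finset IdxPair, A.Nonempty → A.card ≤ 3 → ∀ τ : ℤ,
      (∀ p ∈ A, pairSlope (s (k + 1)) p = τ) → ∃ p ∈ A, Win k p A)
    {σ a b : ℕ} (hσ : σ ≤ 6) (ha : blockEnd g s (σ + 1) = a) (hb : blockEnd g s σ = b) :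
    ∃ st, PartialSchedule s Win σ a b (slopePool s σ a b) b st := by
  have hab : a ≤ b := ha ▸ hb ▸ H.blockEnd_succ_le σ
  suffices ∀ k, a ≤ k → k ≤ b → ∃ st, PartialSchedule s Win σ a b (slopePool s σ a b) k st from
    this b hab le_rfl
  intro k hk
  induction k, hk using Nat.le_induction with
  | base =>
    intro _
    exact ⟨fun _ => b, by simp, fun _ _ => le_rfl, fun p hp _ => (mem_slopePool.1 hp).1,
      fun _ _ h => absurd h (lt_irrefl b), fun _ _ _ _ _ h => absurd h (lt_irrefl b)⟩
  | succ k hk ih =>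
    intro hkb
    obtain ⟨st, S⟩ := ih (by omega)
    exact H.partialSchedule_succ geo hσ ha hb hk (by omega) S

end SlopePath

/-- A complete schedule: each pair has a class `cl p`, which is the slope of the combination in the
block where the pair is to achieve the minimum, and a station `st p` in this block. The station is
the loop after the bridge `st p`, or, for the last pair of its class, the bridge at the end of
the block. -/
structure Schedule (g : ℕ) (s : ℕ → Fin 7 → ℤ) (Win : ℕ → IdxPair → Finset IdxPair → Prop)
    (cl st : IdxPair → ℕ) : Prop where
  cl_le : ∀ p, cl p ≤ 6
  le_slope_end : ∀ p, cl p ≤ pairSlope (s (blockEnd g s (cl p))) p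
  start_le : ∀ p, blockEnd g s (cl p + 1) ≤ st p
  le_end : ∀ p, st p ≤ blockEnd g s (cl p)
  slope_le : ∀ p, pairSlope (s (st p)) p ≤ cl p
  le_slope_succ : ∀ p, st p < blockEnd g s (cl p) → cl p ≤ pairSlope (s (st p + 1)) p
  loop : ∀ p, st p < blockEnd g s (cl p) → cl p < pairSlope (s (st p + 1)) p ∨
    ∃ A, Win (st p) p A ∧
      ∀ q, cl q = cl p → st p < st q → cl p ≤ pairSlope (s (st p + 1)) q → q ∈ A
  inj : ∀ p q, cl q = cl p → st q = st p → q = p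

theorem SlopePath.exists_schedule {g : ℕ} {s : ℕ → Fin 7 → ℤ} (H : SlopePath g s)
    {Win : ℕ → IdxPair → Finset IdxPair → Prop}
    (geo : ∀ k < g, s (k + 1) ≠ s k → ∀ A : Finset IdxPair, A.Nonempty → A.card ≤ 3 → ∀ τ : ℤ,
      (∀ p ∈ A, pairSlope (s (k + 1)) p = τ) → ∃ p ∈ A, Win k p A) :
    ∃ cl st : IdxPair → ℕ, Schedule g s Win cl st := by
  classical
  have hblock : ∀ σ : Fin 7, ∃ st, PartialSchedule s Win σ (blockEnd g s (σ + 1)) (blockEnd g s σ)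
      (slopePool s σ (blockEnd g s (σ + 1)) (blockEnd g s σ)) (blockEnd g s σ) st :=
    fun σ => H.exists_block_schedule geo (by omega) rfl rfl
  choose st S using hblock
  have hcl : ∀ p : IdxPair, ∃ σ : Fin 7,
      p ∈ slopePool s σ (blockEnd g s (σ + 1)) (blockEnd g s σ) := by
    intro p
    set σ := Nat.findGreatest (fun σ => (σ : ℤ) ≤ pairSlope (s (blockEnd g s σ)) p) 6 with hσ
    have h6 : σ ≤ 6 := Nat.findGreatest_le 6
    refine ⟨⟨σ, by omega⟩, mem_slopePool.2 ⟨?_, ?_⟩⟩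
    · rcases h6.eq_or_lt with h | h
      · simp only [h]
        rw [blockEnd, if_neg (by norm_num), pairSlope, H.zero, H.zero]
        push_cast
        omega
      · have := Nat.findGreatest_is_greatest (P := fun σ => (σ : ℤ) ≤
          pairSlope (s (blockEnd g s σ)) p) (k := σ + 1) (n := 6) (by omega) (by omega)
        simp only [not_le] at this
        push_cast at this
        simp only
        omega
    · have := Nat.findGreatest_spec (P := fun σ => (σ : ℤ) ≤ pairSlope (s (blockEnd g s σ)) p)
        (m := 0) (n := 6) (by omega) (by
          rw [H.blockEnd_zero, pairSlope, H.last, H.last]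
          push_cast
          omega)
      exact this
  choose cl hmem using hcl
  -- At the end of a block, exactly one pair is left.
  have hone : ∀ (σ : Fin 7) (p q : IdxPair), cl p = σ → cl q = σ → st σ p = blockEnd g s σ →
      st σ q = blockEnd g s σ → p = q := by
    rintro σ p q rfl hq hpb hqb
    set P := slopePool s (cl p) (blockEnd g s (cl p + 1)) (blockEnd g s (cl p)) with hP
    have h1 := H.card_slopePool_filter (σ := cl p) (k := blockEnd g s (cl p)) (by omega)
      (H.blockEnd_succ_le _) le_rfl
    rw [Finset.filter_true_of_mem (fun q hq => (mem_slopePool.1 hq).2),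
      H.surplus_blockEnd (by omega)] at h1
    have h2 := (S (cl p)).card
    have h3 := Finset.card_filter_add_card_filter_not (s := P) (st (cl p) · < blockEnd g s (cl p))
    have h4 : (P.filter (¬ st (cl p) · < blockEnd g s (cl p))).card ≤ 1 := by
      simp only [← hP] at h1 h2
      omega
    have hqP : q ∈ P := by rw [hP, ← hq]; exact hmem q
    exact Finset.card_le_one.1 h4 p (Finset.mem_filter.2 ⟨hmem p, by omega⟩) q
      (Finset.mem_filter.2 ⟨hqP, by omega⟩)
  have hmem' : ∀ p q, (cl q : ℕ) = cl p → cl q = cl p ∧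
      q ∈ slopePool s (cl p) (blockEnd g s (cl p + 1)) (blockEnd g s (cl p)) := by
    intro p q hq
    have hq' := Fin.ext hq
    exact ⟨hq', hq' ▸ hmem q⟩
  refine ⟨fun p => cl p, fun p => st (cl p) p, fun p => by omega,
    fun p => (mem_slopePool.1 (hmem p)).2, fun p => ?_, fun p => (S (cl p)).le p (hmem p),
    fun p => ?_, fun p hlt => ((S (cl p)).assigned p (hmem p) hlt).2.2.2.1, fun p hlt => ?_,
    fun p q hq hqp => ?_⟩
  · rcases ((S (cl p)).le p (hmem p)).eq_or_lt with h | h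
    · simp only [h]; exact H.blockEnd_succ_le _
    · exact ((S (cl p)).assigned p (hmem p) h).1
  · rcases ((S (cl p)).le p (hmem p)).eq_or_lt with h | h
    · have := (S (cl p)).idle p (hmem p) h
      rwa [← h] at this
    · exact ((S (cl p)).assigned p (hmem p) h).2.2.1
  · obtain ⟨-, -, -, h4, h5⟩ := (S (cl p)).assigned p (hmem p) hlt
    refine h5.imp_right fun ⟨A, hA, hA'⟩ => ⟨A, hA, fun q hq hst hq' => ?_⟩
    obtain ⟨hq1, hq2⟩ := hmem' p q hq
    simp only [hq1] at hst
    exact hA' q hq2 hst hq'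
  · obtain ⟨hq1, hq2⟩ := hmem' p q hq
    simp only [hq1] at hqp
    rcases ((S (cl p)).le p (hmem p)).eq_or_lt with h | h
    · exact hone (cl p) q p hq1 rfl (hqp.trans h) h
    · exact (S (cl p)).inj q hq2 p (hmem p) hqp (hqp ▸ h)

/-! ### The coefficients -/

section Drift

variable {v a n m : ℕ → ℝ} {g κ : ℕ}

/-- A sequence with prescribed increments `a k * n k`, up to errors that decrease geometrically, is
nearly bounded below by its value at `κ` if the increments before `κ` are not positive. -/
theorem drift_before (hm0 : ∀ k, 0 ≤ m k) (hm : ∀ k, m (k + 1) ≤ m k / 1000) (hn : ∀ k, 0 ≤ n k)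
    (hv : ∀ k < g, |v (k + 1) - (v k + a k * n k)| ≤ 22 * m k) (hκ : κ ≤ g)
    (ha : ∀ j < κ, a j ≤ 0) {j : ℕ} (hj : j ≤ κ) :
    v κ - 23 * (m j - m κ) ≤ v j ∧ (j < κ → v κ - 23 * (m j - m κ) ≤ v j + a j * n j) := by
  induction hj using Nat.decreasingInduction with
  | self => exact ⟨by linarith, fun h => absurd h (lt_irrefl _)⟩
  | of_succ j hj ih =>
    have h1 := abs_le.1 (hv j (by omega))
    have h2 := hm j
    have h3 := hm0 j
    have h4 := mul_nonpos_of_nonpos_of_nonneg (ha j hj) (hn j)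
    have h5 : v κ - 23 * (m j - m κ) ≤ v j + a j * n j := by linarith [ih.1]
    exact ⟨by linarith, fun _ => h5⟩

theorem drift_after (hm0 : ∀ k, 0 ≤ m k) (hm : ∀ k, m (k + 1) ≤ m k / 1000) (hn : ∀ k, 0 ≤ n k)
    (hv : ∀ k < g, |v (k + 1) - (v k + a k * n k)| ≤ 22 * m k)
    (ha : ∀ j, κ ≤ j → 0 ≤ a j) {j : ℕ} (hj : κ ≤ j) (hjg : j ≤ g) :
    v κ - 23 * (m κ - m j) ≤ v j := by
  induction j, hj using Nat.le_induction with
  | base => linarith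
  | succ j hj ih =>
    have h1 := abs_le.1 (hv j (by omega))
    have h2 := hm j
    have h3 := hm0 j
    have h4 := mul_nonneg (ha j hj) (hn j)
    linarith [ih (by omega)]

end Drift

/-- The position of the bridge `k`, when loops are contracted. -/
noncomputable def bridgePos (n : ℕ → ℝ) (k : ℕ) : ℝ := ∑ j ∈ Finset.range k, n j

/-- The position at which the combination is to change its slope from `σ` to `σ - 1`, on the bridge
`T σ`. -/
noncomputable def breakPos (n : ℕ → ℝ) (T : ℕ → ℕ) (σ : ℕ) : ℝ :=
  bridgePos n (T σ) + n (T σ) * ((7 - σ) / 7)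

/-- The affine function of slope `σ` that the combination is to agree with, approximately, between
the positions `breakPos n T (σ + 1)` and `breakPos n T σ`. -/
noncomputable def blockLine (n : ℕ → ℝ) (T : ℕ → ℕ) (σ : ℕ) (x : ℝ) : ℝ :=
  σ * x + ∑ τ ∈ Finset.Ioc σ 6, breakPos n T τ

section Lines

variable {n : ℕ → ℝ} {T : ℕ → ℕ}

theorem bridgePos_succ (n : ℕ → ℝ) (k : ℕ) : bridgePos n (k + 1) = bridgePos n k + n k :=
  Finset.sum_range_succ _ _

theorem bridgePos_mono (hn : ∀ k, 0 < n k) : Monotone (bridgePos n) :=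
  monotone_nat_of_le_succ fun k => by rw [bridgePos_succ]; linarith [hn k]

theorem bridgePos_add_le (hn : ∀ k, 0 < n k) {j k : ℕ} (h : j < k) :
    bridgePos n j + n j ≤ bridgePos n k := by
  rw [← bridgePos_succ]
  exact bridgePos_mono hn h

theorem le_breakPos (hn : ∀ k, 0 < n k) {σ k : ℕ} (hσ : σ ≤ 6) (hk : k ≤ T σ) :
    bridgePos n k + n k / 7 ≤ breakPos n T σ := by
  have h6 : (σ : ℝ) ≤ 6 := by exact_mod_cast hσ
  have h1 := hn (T σ)
  have h2 := hn k
  have h3 : n (T σ) / 7 ≤ n (T σ) * ((7 - σ) / 7) := by nlinarith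
  rw [breakPos]
  rcases hk.eq_or_lt with rfl | h
  · linarith
  · linarith [bridgePos_add_le hn h]

theorem breakPos_le (hn : ∀ k, 0 < n k) {σ k : ℕ} (hσ : 1 ≤ σ) (hk : T σ < k) :
    breakPos n T σ + n (T σ) / 7 ≤ bridgePos n k := by
  have h6 : (1 : ℝ) ≤ σ := by exact_mod_cast hσ
  have h1 := hn (T σ)
  have h3 : n (T σ) * ((7 - σ) / 7) ≤ n (T σ) * (6 / 7) := by nlinarith
  rw [breakPos]
  linarith [bridgePos_add_le hn hk]

theorem breakPos_succ_le (hn : ∀ k, 0 < n k) (hT : ∀ σ, T (σ + 1) ≤ T σ) {σ : ℕ} (hσ : σ ≤ 6) :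
    breakPos n T (σ + 1) ≤ breakPos n T σ := by
  rcases (hT σ).eq_or_lt with h | h
  · rw [breakPos, breakPos, h]
    push_cast
    nlinarith [hn (T σ)]
  · have h1 := breakPos_le (T := T) hn (by omega : 1 ≤ σ + 1) h
    have h2 := le_breakPos (T := T) hn hσ le_rfl
    linarith [hn (T σ), hn (T (σ + 1))]

theorem breakPos_anti (hn : ∀ k, 0 < n k) (hT : ∀ σ, T (σ + 1) ≤ T σ) {σ τ : ℕ} (h : σ ≤ τ)
    (hτ : τ ≤ 7) : breakPos n T τ ≤ breakPos n T σ := by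
  induction τ, h using Nat.le_induction with
  | base => exact le_rfl
  | succ τ h ih => exact (breakPos_succ_le hn hT (by omega)).trans (ih (by omega))

theorem blockLine_succ (n : ℕ → ℝ) (T : ℕ → ℕ) {σ : ℕ} (hσ : σ + 1 ≤ 6) (x : ℝ) :
    blockLine n T σ x - blockLine n T (σ + 1) x = breakPos n T (σ + 1) - x := by
  have h : Finset.Ioc σ 6 = insert (σ + 1) (Finset.Ioc (σ + 1) 6) := by
    ext y; simp only [Finset.mem_Ioc, Finset.mem_insert]; omega
  rw [blockLine, blockLine, h, Finset.sum_insert (by simp)]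
  push_cast
  ring

theorem blockLine_add (n : ℕ → ℝ) (T : ℕ → ℕ) (σ : ℕ) (x y : ℝ) :
    blockLine n T σ (x + y) = blockLine n T σ x + σ * y := by
  rw [blockLine, blockLine]; ring

theorem blockLine_gap_of_lt (hn : ∀ k, 0 < n k) (hT : ∀ σ, T (σ + 1) ≤ T σ) {σ τ : ℕ} (h : τ < σ)
    (hσ : σ ≤ 6) {x : ℝ} (hx : x ≤ breakPos n T σ) :
    breakPos n T σ - x ≤ blockLine n T τ x - blockLine n T σ x := by
  induction σ, Nat.succ_le_of_lt h using Nat.le_induction with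
  | base => exact (blockLine_succ n T hσ x).ge
  | succ σ h' ih =>
    have h1 := breakPos_succ_le (T := T) hn hT (by omega : σ ≤ 6)
    have h2 := ih h' (by omega) (hx.trans h1)
    have h3 := blockLine_succ n T hσ x
    linarith

theorem blockLine_gap_of_gt (hn : ∀ k, 0 < n k) (hT : ∀ σ, T (σ + 1) ≤ T σ) {σ τ : ℕ} (h : σ < τ)
    (hτ : τ ≤ 6) {x : ℝ} (hx : breakPos n T (σ + 1) ≤ x) :
    x - breakPos n T τ ≤ blockLine n T τ x - blockLine n T σ x := by
  induction τ, Nat.succ_le_of_lt h using Nat.le_induction with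
  | base => linarith [blockLine_succ n T hτ x]
  | succ τ h' ih =>
    have h1 := breakPos_anti (T := T) hn hT h' (by omega)
    have h2 := ih h' (by omega)
    have h3 := blockLine_succ n T hτ x
    linarith

end Lines

/-- Estimates for the values `H k p` of the functions `φ i + φ j`, normalized on each bridge
by a constant, at the left end of the bridge `k`: the bridge `k` contributes its length `n k` times
the slope, and the error made on the loop after it is bounded in terms of its short edge `m k`. -/
structure BridgeValues (g : ℕ) (s : ℕ → Fin 7 → ℤ) (n m : ℕ → ℝ) (H : ℕ → IdxPair → ℝ) : Prop where
  m_nonneg : ∀ k, 0 ≤ m k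
  m_pos : ∀ k < g, 0 < m k
  m_succ : ∀ k, m (k + 1) ≤ m k / 1000
  n_pos : ∀ k, 0 < n k
  m_le : ∀ k, 1000 * m k ≤ n k
  m_le_succ : ∀ k, 1000 * m k ≤ n (k + 1)
  n_succ : ∀ k, n (k + 1) ≤ n k
  step : ∀ k < g, ∀ p, |H (k + 1) p - H k p - pairSlope (s k) p * n k| ≤ 22 * m k

/-- The pair `p` wins on the loop after the bridge `k` against the other pairs of `A`: for some
vector `u` of values in `U`, which represents a point of this loop. -/
def LoopWin (m : ℕ → ℝ) (H : ℕ → IdxPair → ℝ) (U : Set (IdxPair → ℝ)) (k : ℕ) (p : IdxPair)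
    (A : Finset IdxPair) : Prop :=
  ∃ u ∈ U, (∀ q, |u q - H (k + 1) q| ≤ 20 * m k) ∧
    ∀ q ∈ A, q ≠ p → u p - H (k + 1) p + m k ≤ u q - H (k + 1) q

/-! ### Comparison at the stations -/

section Coefficients

variable {g : ℕ} {s : ℕ → Fin 7 → ℤ} {n m : ℕ → ℝ} {H : ℕ → IdxPair → ℝ}
  {U : Set (IdxPair → ℝ)} {cl st : IdxPair → ℕ}

theorem BridgeValues.m_anti (B : BridgeValues g s n m H) : Antitone m :=
  antitone_nat_of_succ_le fun k => (B.m_succ k).trans (by linarith [B.m_nonneg k])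

variable (g s n m H cl st)

open Classical in
/-- The bridge next to the station of a pair, at the left end of which its value is prescribed. -/
noncomputable def stationBridge (p : IdxPair) : ℕ :=
  if st p < blockEnd g s (cl p) then st p + 1 else st p

open Classical in
/-- A small correction of the coefficients. A function whose slope jumps above that of the
combination is lowered, and a function that wins on a loop without such a jump is raised: it is
to win only there, and not on the bridge that follows. -/
noncomputable def offset (p : IdxPair) : ℝ :=
  if st p < blockEnd g s (cl p) then
    if (cl p : ℤ) < pairSlope (s (st p + 1)) p then -m (st p) else m (st p) / 2
  else 0

/-- The coefficients of the combination: the function indexed by `p` meets the line of its block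
next to its station, up to the offset. -/
noncomputable def coeff (p : IdxPair) : ℝ :=
  blockLine n (blockEnd g s) (cl p) (bridgePos n (stationBridge g s cl st p)) -
    H (stationBridge g s cl st p) p + offset g s m cl st p

/-- The excess of the function indexed by `p` over the line of its block, at the left end of the
bridge `k`. -/
noncomputable def excess (k : ℕ) (p : IdxPair) : ℝ :=
  H k p + coeff g s n m H cl st p - blockLine n (blockEnd g s) (cl p) (bridgePos n k)

variable {g s n m H cl st}

theorem excess_stationBridge (p : IdxPair) :
    excess g s n m H cl st (stationBridge g s cl st p) p = offset g s m cl st p := by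
  rw [excess, coeff]; ring

theorem excess_step (B : BridgeValues g s n m H) (p : IdxPair) {k : ℕ} (hk : k < g) :
    |excess g s n m H cl st (k + 1) p - (excess g s n m H cl st k p +
      ((pairSlope (s k) p : ℝ) - cl p) * n k)| ≤ 22 * m k := by
  refine le_of_eq_of_le ?_ (B.step k hk p)
  rw [excess, excess, bridgePos_succ, blockLine_add]
  congr 1
  ring

variable (B : BridgeValues g s n m H) (P : SlopePath g s)
  (S : Schedule g s (LoopWin m H U) cl st)

include B P S

theorem excess_before_aux (p : IdxPair) {j : ℕ} (hj : j ≤ st p) :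
    (stationBridge g s cl st p = j ∧ excess g s n m H cl st j p = 0 ∧
      (pairSlope (s j) p : ℤ) = cl p) ∨
    (-24 * m j ≤ excess g s n m H cl st j p + ((pairSlope (s j) p : ℝ) - cl p) * n j ∧
      (pairSlope (s j) p : ℤ) ≤ cl p) := by
  have hst := excess_stationBridge (n := n) (m := m) (H := H) (g := g) (s := s) (cl := cl)
    (st := st) p
  have hle : ∀ i ≤ st p, (pairSlope (s i) p : ℤ) ≤ cl p := fun i hi =>
    (P.pairSlope_mono hi p).trans (S.slope_le p)
  have hdr := fun hκ ha => drift_before (v := fun k => excess g s n m H cl st k p)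
    (a := fun k => (pairSlope (s k) p : ℝ) - cl p) (κ := stationBridge g s cl st p) B.m_nonneg
    B.m_succ (fun k => (B.n_pos k).le) (fun k hk => excess_step B p hk) hκ ha (j := j)
  have hend := S.le_end p
  have hbg := blockEnd_le g s (cl p)
  by_cases h : st p < blockEnd g s (cl p)
  · have hκ : stationBridge g s cl st p = st p + 1 := if_pos h
    rw [hκ] at hst hdr
    right
    have h1 := (hdr (by omega) (fun i hi => by
      have : (pairSlope (s i) p : ℝ) ≤ cl p := by exact_mod_cast hle i (by omega)
      linarith) (by omega)).2 (by omega)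
    simp only [hst] at h1
    have h2 : -m (st p) ≤ offset g s m cl st p := by
      rw [offset, if_pos h]
      split_ifs
      exacts [le_rfl, by linarith [B.m_nonneg (st p)]]
    have h3 := B.m_anti hj
    have h4 := B.m_nonneg (st p + 1)
    exact ⟨by linarith, hle j hj⟩
  · have hκ : stationBridge g s cl st p = st p := if_neg h
    have hT : st p = blockEnd g s (cl p) := by omega
    rw [hκ] at hst hdr
    have h0 : offset g s m cl st p = 0 := if_neg h
    rw [h0] at hst
    rcases hj.eq_or_lt with rfl | hj'
    · refine .inl ⟨hκ, hst, le_antisymm (hle _ le_rfl) ?_⟩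
      have := S.le_slope_end p
      rwa [← hT] at this
    · right
      have h1 := (hdr (by omega) (fun i hi => by
        have : (pairSlope (s i) p : ℝ) ≤ cl p := by exact_mod_cast hle i (by omega)
        linarith) hj).2 hj'
      simp only [hst] at h1
      have h3 := B.m_nonneg j
      have h4 := B.m_nonneg (st p)
      exact ⟨by linarith, hle j hj⟩

/-- Before its station, a function lies above the line of its block. -/
theorem excess_before (p : IdxPair) {j : ℕ} (hj : j ≤ st p) {t : ℝ} (ht' : t ≤ n j) :
    -24 * m j ≤ excess g s n m H cl st j p + ((pairSlope (s j) p : ℝ) - cl p) * t := by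
  rcases excess_before_aux B P S p hj with ⟨-, h1, h2⟩ | ⟨h1, h2⟩
  · have h3 : (pairSlope (s j) p : ℝ) = cl p := by exact_mod_cast h2
    rw [h1, h3]
    linarith [B.m_nonneg j]
  · have h3 : (pairSlope (s j) p : ℝ) ≤ cl p := by exact_mod_cast h2
    nlinarith

theorem excess_before_of_lt (p : IdxPair) {j : ℕ} (hj : j ≤ st p)
    (h : pairSlope (s j) p < cl p) : n j - 24 * m j ≤ excess g s n m H cl st j p := by
  rcases excess_before_aux B P S p hj with ⟨-, h1, h2⟩ | ⟨h1, h2⟩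
  · omega
  · have h3 : (pairSlope (s j) p : ℝ) + 1 ≤ cl p := by exact_mod_cast h
    nlinarith [B.n_pos j]

/-- After the loop where it is stationed, a function lies above the line of its block. -/
theorem excess_after_loop (p : IdxPair) (hp : st p < blockEnd g s (cl p)) {j : ℕ}
    (hj : st p + 1 ≤ j) (hjg : j ≤ g) {t : ℝ} (ht : 0 ≤ t) (h : st p + 1 < j ∨ n j / 14 ≤ t) :
    m (st p) / 4 ≤ excess g s n m H cl st j p + ((pairSlope (s j) p : ℝ) - cl p) * t := by
  have hst := excess_stationBridge (n := n) (m := m) (H := H) (g := g) (s := s) (cl := cl)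
    (st := st) p
  have hκ : stationBridge g s cl st p = st p + 1 := if_pos hp
  have hle : ∀ i, st p + 1 ≤ i → 0 ≤ (pairSlope (s i) p : ℝ) - cl p := fun i hi => by
    have h1 := (S.le_slope_succ p hp).trans (P.pairSlope_mono hi p)
    have h2 : (cl p : ℝ) ≤ pairSlope (s i) p := by exact_mod_cast h1
    linarith
  have hdr := fun κ hκ hj => drift_after (v := fun k => excess g s n m H cl st k p)
    (a := fun k => (pairSlope (s k) p : ℝ) - cl p) (κ := κ) B.m_nonneg
    B.m_succ (fun k => (B.n_pos k).le) (fun k hk => excess_step B p hk)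
    (fun i hi => hle i (le_trans hκ hi)) (j := j) hj hjg
  rw [hκ] at hst
  have hm := B.m_succ (st p)
  have hm0 := B.m_nonneg (st p)
  have hm1 := B.m_nonneg (st p + 1)
  have hmj := B.m_nonneg j
  have hat := mul_nonneg (hle j hj) ht
  by_cases hdep : (cl p : ℤ) < pairSlope (s (st p + 1)) p
  · -- The slope exceeds that of the line, which makes up for the offset.
    have h0 : offset g s m cl st p = -m (st p) := by rw [offset, if_pos hp, if_pos hdep]
    have hn := B.m_le_succ (st p)
    have h1 : 1 ≤ (pairSlope (s (st p + 1)) p : ℝ) - cl p := by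
      have : (cl p : ℝ) + 1 ≤ pairSlope (s (st p + 1)) p := by exact_mod_cast hdep
      linarith
    rcases hj.eq_or_lt with rfl | hj'
    · rw [hst, h0]
      have h2 : n (st p + 1) / 14 ≤ t := h.resolve_left (lt_irrefl _)
      nlinarith
    · have h2 := hdr (st p + 1 + 1) (by omega) hj'
      have h3 := abs_le.1 (excess_step (cl := cl) (st := st) B p (k := st p + 1) (by omega))
      rw [hst, h0] at h3
      have h4 := B.m_succ (st p + 1)
      have h5 : n (st p + 1) ≤ ((pairSlope (s (st p + 1)) p : ℝ) - cl p) * n (st p + 1) := by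
        nlinarith [B.n_pos (st p + 1)]
      linarith
  · have h0 : offset g s m cl st p = m (st p) / 2 := by rw [offset, if_pos hp, if_neg hdep]
    have h2 := hdr (st p + 1) le_rfl hj
    rw [hst, h0] at h2
    linarith

/-- After its block, a function lies above the line of this block, up to a small error. -/
theorem excess_after (p : IdxPair) {j : ℕ} (hj : blockEnd g s (cl p) ≤ j) (hjg : j ≤ g) {t : ℝ}
    (ht : 0 ≤ t) (h : blockEnd g s (cl p) < j ∨ n j / 14 ≤ t) :
    -23 * m (blockEnd g s (cl p)) ≤
      excess g s n m H cl st j p + ((pairSlope (s j) p : ℝ) - cl p) * t := by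
  have hend := S.le_end p
  by_cases hp : st p < blockEnd g s (cl p)
  · have h1 := excess_after_loop B P S p hp (by omega) hjg ht (h.imp_left (by omega))
    linarith [B.m_nonneg (st p), B.m_nonneg (blockEnd g s (cl p))]
  · have hst := excess_stationBridge (n := n) (m := m) (H := H) (g := g) (s := s) (cl := cl)
      (st := st) p
    have hκ : stationBridge g s cl st p = blockEnd g s (cl p) := by
      rw [stationBridge, if_neg hp]; omega
    have h0 : offset g s m cl st p = 0 := if_neg hp
    rw [hκ, h0] at hst
    have hle : ∀ i, blockEnd g s (cl p) ≤ i → 0 ≤ (pairSlope (s i) p : ℝ) - cl p := fun i hi => by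
      have h1 := (S.le_slope_end p).trans (P.pairSlope_mono hi p)
      have h2 : (cl p : ℝ) ≤ pairSlope (s i) p := by exact_mod_cast h1
      linarith
    have h1 := drift_after (v := fun k => excess g s n m H cl st k p)
      (a := fun k => (pairSlope (s k) p : ℝ) - cl p) B.m_nonneg
      B.m_succ (fun k => (B.n_pos k).le) (fun k hk => excess_step B p hk) hle hj hjg
    simp only [hst] at h1
    have h2 := mul_nonneg (hle j hj) ht
    linarith [B.m_nonneg j]

omit B P S in
theorem add_coeff (p : IdxPair) (k : ℕ) (x : ℝ) : x + coeff g s n m H cl st p =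
    blockLine n (blockEnd g s) (cl p) (bridgePos n k) + excess g s n m H cl st k p +
      (x - H k p) := by
  rw [excess]; ring

/-- At its station on a loop, a function is smaller than all others. -/
theorem lt_of_loop_station (p : IdxPair) (hp : st p < blockEnd g s (cl p)) {u : IdxPair → ℝ}
    (hu : ∀ q, |u q - H (st p + 1) q| ≤ 20 * m (st p))
    (hw : ((cl p : ℤ) < pairSlope (s (st p + 1)) p ∧ u = H (st p + 1)) ∨
      (pairSlope (s (st p + 1)) p ≤ cl p ∧ ∀ q, cl q = cl p → st p < st q →
        cl p ≤ pairSlope (s (st p + 1)) q → u p - H (st p + 1) p + m (st p) ≤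
          u q - H (st p + 1) q))
    (q : IdxPair) (hq : q ≠ p) :
    u p + coeff g s n m H cl st p < u q + coeff g s n m H cl st q := by
  have hT : ∀ σ, blockEnd g s (σ + 1) ≤ blockEnd g s σ := P.blockEnd_succ_le
  have hTa : Antitone (blockEnd g s) := antitone_nat_of_succ_le hT
  have hbg := blockEnd_le g s (cl p)
  have hst := excess_stationBridge (n := n) (m := m) (H := H) (g := g) (s := s) (cl := cl)
    (st := st) p
  have hκ : stationBridge g s cl st p = st p + 1 := if_pos hp
  rw [hκ] at hst
  rw [add_coeff p (st p + 1), add_coeff q (st p + 1), hst]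
  have hup := abs_le.1 (hu p)
  have huq := abs_le.1 (hu q)
  have hmp := B.m_pos (st p) (by omega)
  have hm := B.m_succ (st p)
  have hn := B.m_le_succ (st p)
  have hm1 := B.m_nonneg (st p + 1)
  have hoff : offset g s m cl st p ≤ m (st p) / 2 := by
    rw [offset, if_pos hp]
    split_ifs <;> linarith
  have hstart := S.start_le p
  rcases lt_trichotomy (cl q) (cl p) with hcl | hcl | hcl
  · -- The other function is stationed in a later block.
    have h1 : st p + 1 ≤ st q := by
      have := hTa (show cl q + 1 ≤ cl p by omega)
      have := S.start_le q
      omega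
    have h2 := excess_before B P S q h1 (t := 0) (B.n_pos _).le
    have h3 := le_breakPos (T := blockEnd g s) B.n_pos (S.cl_le p) (k := st p + 1) hp
    have h4 := blockLine_gap_of_lt (T := blockEnd g s) B.n_pos hT hcl (S.cl_le p)
      (x := bridgePos n (st p + 1)) (by linarith [B.n_pos (st p + 1)])
    rw [mul_zero, add_zero] at h2
    linarith
  · rw [hcl]
    rcases lt_trichotomy (st q) (st p) with h | h | h
    · have h1 := excess_after_loop B P S q (by rw [hcl]; omega) (j := st p + 1) (by omega)
        (by omega) (t := 0) le_rfl (.inl (by omega))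
      rw [mul_zero, add_zero] at h1
      have h2 := B.m_anti (Nat.succ_le_of_lt h)
      have h3 := B.m_succ (st q)
      simp only [Nat.succ_eq_add_one] at h2
      linarith
    · exact absurd (S.inj p q hcl h) hq
    · have h1 := excess_before B P S q (j := st p + 1) h (t := 0) (B.n_pos _).le
      rw [mul_zero, add_zero] at h1
      rcases hw with ⟨hw1, rfl⟩ | ⟨hw1, hw2⟩
      · have h2 : offset g s m cl st p = -m (st p) := by rw [offset, if_pos hp, if_pos hw1]
        rw [h2]
        linarith
      · rcases lt_or_ge (pairSlope (s (st p + 1)) q) (cl p : ℤ) with h3 | h3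
        · have h4 := excess_before_of_lt B P S q (j := st p + 1) h (by rw [hcl]; exact h3)
          linarith
        · have h4 := hw2 q hcl h h3
          linarith
  · -- The block of the other function is over.
    have h1 : blockEnd g s (cl q) ≤ st p := (hTa (show cl p + 1 ≤ cl q by omega)).trans hstart
    have h2 := excess_after B P S q (j := st p + 1) (by omega) (by omega) (t := 0) le_rfl
      (.inl (by omega))
    have h3 := breakPos_le (T := blockEnd g s) B.n_pos (σ := cl q) (k := st p + 1) (by omega)
      (by omega)
    have h3' := breakPos_le (T := blockEnd g s) B.n_pos (σ := cl p + 1) (k := st p + 1) (by omega)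
      (by omega)
    have h4 := blockLine_gap_of_gt (T := blockEnd g s) B.n_pos hT hcl (S.cl_le q)
      (x := bridgePos n (st p + 1)) (by linarith [B.n_pos (blockEnd g s (cl p + 1))])
    rw [mul_zero, add_zero] at h2
    have h5 := B.m_anti h1
    have h6 := B.m_le (blockEnd g s (cl q))
    linarith

/-- At its station on a bridge, a function is smaller than all others. -/
theorem lt_of_bridge_station (p : IdxPair) (hp : st p = blockEnd g s (cl p)) {t : ℝ}
    (ht : t = n (st p) * ((7 - cl p) / 7 - 1 / 14)) (q : IdxPair) (hq : q ≠ p) :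
    H (st p) p + pairSlope (s (st p)) p * t + coeff g s n m H cl st p <
      H (st p) q + pairSlope (s (st p)) q * t + coeff g s n m H cl st q := by
  have hT : ∀ σ, blockEnd g s (σ + 1) ≤ blockEnd g s σ := P.blockEnd_succ_le
  have hTa : Antitone (blockEnd g s) := antitone_nat_of_succ_le hT
  have hbg := blockEnd_le g s (cl p)
  have hst := excess_stationBridge (n := n) (m := m) (H := H) (g := g) (s := s) (cl := cl)
    (st := st) p
  have hκ : stationBridge g s cl st p = st p := if_neg (by omega)
  have h0 : offset g s m cl st p = 0 := if_neg (by omega)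
  rw [hκ, h0] at hst
  have hslope : (pairSlope (s (st p)) p : ℝ) = cl p := by
    have := S.le_slope_end p
    rw [← hp] at this
    exact_mod_cast le_antisymm (S.slope_le p) this
  have hn := B.n_pos (st p)
  have hc6 : (cl p : ℝ) ≤ 6 := by exact_mod_cast S.cl_le p
  have hc0 : (0 : ℝ) ≤ cl p := by positivity
  have ht1 : n (st p) / 14 ≤ t := by rw [ht]; nlinarith
  have ht2 : t ≤ n (st p) := by rw [ht]; nlinarith
  have hpos : breakPos n (blockEnd g s) (cl p) = bridgePos n (st p) + t + n (st p) / 14 := by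
    rw [breakPos, ← hp, ht]; ring
  have hval : ∀ r, H (st p) r + pairSlope (s (st p)) r * t + coeff g s n m H cl st r =
      blockLine n (blockEnd g s) (cl r) (bridgePos n (st p) + t) +
        (excess g s n m H cl st (st p) r + ((pairSlope (s (st p)) r : ℝ) - cl r) * t) := by
    intro r
    rw [add_coeff r (st p), blockLine_add]; ring
  rw [hval, hval, hst, hslope]
  have hm := B.m_le (st p)
  have hm0 := B.m_nonneg (st p)
  rcases lt_trichotomy (cl q) (cl p) with hcl | hcl | hcl
  · have h1 : st p ≤ st q := by
      have := hTa (show cl q + 1 ≤ cl p by omega)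
      have := S.start_le q
      omega
    have h2 := excess_before B P S q h1 ht2
    have h4 := blockLine_gap_of_lt (T := blockEnd g s) B.n_pos hT hcl (S.cl_le p)
      (x := bridgePos n (st p) + t) (by linarith)
    linarith
  · have h1 : st q < st p := by
      have h2 := S.le_end q
      rw [hcl, ← hp] at h2
      exact lt_of_le_of_ne h2 fun h => hq (S.inj p q hcl h)
    have h2 := excess_after_loop B P S q (by rw [hcl]; omega) (j := st p) h1 (by omega)
      (by linarith) (.inr ht1)
    have h3 := B.m_pos (st q) (by omega)
    rw [hcl] at h2 ⊢
    linarith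
  · have h1 : blockEnd g s (cl q) ≤ st p := hp ▸ hTa hcl.le
    have h2 := excess_after B P S q h1 (by omega) (by linarith) (.inr ht1)
    have key : ∀ τ, cl p < τ → breakPos n (blockEnd g s) τ + n (blockEnd g s τ) / 14 ≤
        bridgePos n (st p) + t := by
      intro τ hτ
      have h3 : blockEnd g s τ ≤ st p := hp ▸ hTa hτ.le
      rcases h3.eq_or_lt with h3 | h3
      · have h4 : (cl p : ℝ) + 1 ≤ τ := by exact_mod_cast hτ
        rw [breakPos, h3, ht]
        nlinarith
      · have h4 := breakPos_le (T := blockEnd g s) B.n_pos (by omega : 1 ≤ τ) h3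
        linarith [B.n_pos (blockEnd g s τ)]
    have h3 := key _ hcl
    have h3' := key (cl p + 1) (by omega)
    have h4 := blockLine_gap_of_gt (T := blockEnd g s) B.n_pos hT hcl (S.cl_le q)
      (x := bridgePos n (st p) + t) (by linarith [B.n_pos (blockEnd g s (cl p + 1))])
    have h6 := B.m_le (blockEnd g s (cl q))
    have h7 := B.n_pos (blockEnd g s (cl q))
    linarith [B.m_nonneg (blockEnd g s (cl q))]

omit S in
/-- The main estimate: there are coefficients for which each function is smaller than all others at
some point. -/
theorem exists_separating_coeff
    (hU : ∀ k ≤ g, ∀ t ∈ Set.Icc 0 (n k), (fun p => H k p + pairSlope (s k) p * t) ∈ U)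
    (geo : ∀ k < g, s (k + 1) ≠ s k → ∀ A : Finset IdxPair, A.Nonempty → A.card ≤ 3 → ∀ τ : ℤ,
      (∀ p ∈ A, pairSlope (s (k + 1)) p = τ) → ∃ p ∈ A, LoopWin m H U k p A) :
    ∃ c : IdxPair → ℝ, ∀ p, ∃ u ∈ U, ∀ q, q ≠ p → u p + c p < u q + c q := by
  obtain ⟨cl, st, S⟩ := P.exists_schedule geo
  refine ⟨coeff g s n m H cl st, fun p => ?_⟩
  have hbg := blockEnd_le g s (cl p)
  rcases (S.le_end p).lt_or_eq with hp | hp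
  · have hU' : H (st p + 1) ∈ U := by
      have := hU (st p + 1) (by omega) 0 ⟨le_rfl, (B.n_pos _).le⟩
      simpa using this
    rcases lt_or_ge (cl p : ℤ) (pairSlope (s (st p + 1)) p) with hdep | hdep
    · refine ⟨_, hU', lt_of_loop_station B P S p hp (fun q => ?_) (.inl ⟨hdep, rfl⟩)⟩
      have := B.m_nonneg (st p)
      simpa using this
    · obtain h | ⟨A, ⟨u, huU, hu, hwin⟩, hA⟩ := S.loop p hp
      · omega
      · exact ⟨u, huU, lt_of_loop_station B P S p hp hu (.inr ⟨hdep, fun q hq hst hs =>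
          hwin q (hA q hq hst hs) (by rintro rfl; exact lt_irrefl _ hst)⟩)⟩
  · have hn := B.n_pos (st p)
    have hc6 : (cl p : ℝ) ≤ 6 := by exact_mod_cast S.cl_le p
    have hc0 : (0 : ℝ) ≤ cl p := by positivity
    exact ⟨_, hU (st p) (by omega) (n (st p) * ((7 - cl p) / 7 - 1 / 14)) ⟨by nlinarith,
      by nlinarith⟩, lt_of_bridge_station B P S p hp rfl⟩

end Coefficients

/-! ### The functions on a chain of loops -/

namespace ChainOfLoops

variable {g : ℕ} {Γ : ChainOfLoops g}

/-- The bridge `k`, or the last one if `k` is too large. -/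
def bridgeIdx (g k : ℕ) : Fin (g + 1) := ⟨min k g, by omega⟩

theorem bridgeIdx_castSucc (k : Fin g) : bridgeIdx g k = k.castSucc := by
  ext; simp only [bridgeIdx, Fin.val_castSucc]; omega

theorem bridgeIdx_succ (k : Fin g) : bridgeIdx g (k + 1) = k.succ := by
  ext; simp only [bridgeIdx, Fin.val_succ]; omega

theorem bridgeIdx_of_ge {k : ℕ} (h : g ≤ k) : bridgeIdx g k = Fin.last g := by
  ext; simp only [bridgeIdx, Fin.val_last]; omega

/-- The slopes of the functions `φ i` on the bridge `k`. -/
noncomputable def slopes (φ : Fin 7 → Γ.Point → ℝ) (k : ℕ) (i : Fin 7) : ℤ :=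
  slope (φ i) (bridgeIdx g k)

/-- The length of the bottom edge of the loop after the bridge `k`, or zero if there is none. -/
noncomputable def shortLen (Γ : ChainOfLoops g) (k : ℕ) : ℝ := if h : k < g then Γ.m ⟨k, h⟩ else 0

/-- Twice the total change of `f` on the loops before the bridge `k`. -/
noncomputable def loopDrift (f : Γ.Point → ℝ) (k : ℕ) : ℝ :=
  ∑ j ∈ Finset.range k, if h : j < g then
    2 * (f (Γ.bridgeL (Fin.succ ⟨j, h⟩)) - f (Γ.bridgeR (Fin.castSucc ⟨j, h⟩))) else 0

/-- The value of `φ i + φ j` at the left end of the bridge `k`, up to a constant which depends only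
on `k` and removes most of the change on loops. -/
noncomputable def bridgeValue (φ : Fin 7 → Γ.Point → ℝ) (k : ℕ) (p : IdxPair) : ℝ :=
  φ p.1.1 (Γ.bridgeL (bridgeIdx g k)) + φ p.1.2 (Γ.bridgeL (bridgeIdx g k)) - loopDrift (φ 0) k

/-- The vectors of values of the functions `φ i + φ j` at points of the chain, up to constants. -/
def pointValues (φ : Fin 7 → Γ.Point → ℝ) : Set (IdxPair → ℝ) :=
  {u | ∃ (x : Γ.Point) (b : ℝ), ∀ p, u p = φ p.1.1 x + φ p.1.2 x + b}

theorem shortLen_coe (k : Fin g) : Γ.shortLen k = Γ.m k := dif_pos k.2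

theorem shortLen_of_ge {k : ℕ} (h : g ≤ k) : Γ.shortLen k = 0 := dif_neg (by omega)

theorem abs_nearLeft_le {c : ℕ} {α : ℤ} (h : |α| ≤ 9) : |nearLeft c α| ≤ 10 := by
  rw [abs_le] at *
  unfold nearLeft
  split_ifs <;> omega

theorem abs_nearRight_le {c : ℕ} {α : ℤ} (h : |α| ≤ 9) : |nearRight c α| ≤ 10 := by
  rw [abs_le] at *
  unfold nearRight
  split_ifs <;> omega

namespace VASystem

variable {D : Γ.graph.Divisor} {E : Fin 7 → Γ.graph.Divisor} {φ : Fin 7 → Γ.Point → ℝ}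
  (S : VASystem Γ D E φ)

include S

theorem slopePath (hΓ : Γ.Admissible 1000) : SlopePath g (slopes φ) where
  zero i := by
    rw [slopes, show bridgeIdx g 0 = 0 from by ext; simp [bridgeIdx]]
    exact S.slope_zero i
  last i := by
    rw [slopes, bridgeIdx_of_ge le_rfl]
    exact S.slope_last i
  strictMono k := S.slope_strictMono _
  step k := by
    rcases lt_or_ge k g with hk | hk
    · by_cases hex : ∃ j, slopes φ (k + 1) j ≠ slopes φ k j
      · obtain ⟨j, hj⟩ := hex
        refine .inr ⟨hk, j, funext fun i => ?_⟩
        have e0 := bridgeIdx_castSucc ⟨k, hk⟩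
        have e1 := bridgeIdx_succ ⟨k, hk⟩
        simp only at e0 e1
        simp only [slopes, e0, e1] at hj ⊢
        have hj' := (S.slope_succ j ⟨k, hk⟩).resolve_left hj
        rw [Function.update_apply]
        split_ifs with h
        · rw [h, hj']
        · rw [slopes, e0]
          exact (S.slope_succ i ⟨k, hk⟩).resolve_right fun hi =>
            h (S.jump_unique (hΓ.2 ⟨k, hk⟩).1 hi hj')
      · push Not at hex
        exact .inl (funext hex)
    · left
      funext i
      rw [slopes, slopes, bridgeIdx_of_ge hk, bridgeIdx_of_ge (by omega)]

theorem bridgeValues (hΓ : Γ.Admissible 1000) : BridgeValues g (slopes φ)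
    (fun k => Γ.n (bridgeIdx g k)) Γ.shortLen (bridgeValue φ) := by
  have hlen : ∀ k : Fin g, 1000 * Γ.m k ≤ Γ.n k.succ ∧ 1000 * Γ.m k ≤ Γ.n k.castSucc ∧
      Γ.n k.succ ≤ Γ.n k.castSucc := by
    intro k
    obtain ⟨h1, h2, h3⟩ := hΓ.2 k
    have := Γ.m_pos k
    have := Γ.l_pos k
    have := Γ.n_pos k.succ
    refine ⟨?_, ?_, ?_⟩ <;> linarith
  have hcases : ∀ k : ℕ, (∃ j : Fin g, k = j) ∨ g ≤ k := fun k => by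
    rcases lt_or_ge k g with h | h
    exacts [.inl ⟨⟨k, h⟩, rfl⟩, .inr h]
  refine ⟨fun k => ?_, fun k hk => ?_, fun k => ?_, fun k => Γ.n_pos _, fun k => ?_, fun k => ?_,
    fun k => ?_, fun k hk p => ?_⟩
  · obtain ⟨k, rfl⟩ | h := hcases k
    · rw [shortLen_coe]; exact (Γ.m_pos k).le
    · rw [shortLen_of_ge h]
  · rw [shortLen, dif_pos hk]; exact Γ.m_pos _
  · obtain ⟨k', hk'⟩ | h := hcases (k + 1)
    · obtain ⟨k, rfl⟩ | h := hcases k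
      · rw [hk', shortLen_coe, shortLen_coe]
        have h1 := hΓ.1 k k' hk'.symm
        have h2 := (hΓ.2 k').1
        have h3 := Γ.m_pos k'
        linarith
      · omega
    · rw [shortLen_of_ge h]
      obtain ⟨k, rfl⟩ | h := hcases k
      · rw [shortLen_coe]; exact div_nonneg (Γ.m_pos k).le (by norm_num)
      · rw [shortLen_of_ge h]; norm_num
  · obtain ⟨k, rfl⟩ | h := hcases k
    · rw [shortLen_coe, bridgeIdx_castSucc]; exact (hlen k).2.1
    · rw [shortLen_of_ge h, mul_zero]; exact (Γ.n_pos _).le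
  · obtain ⟨k, rfl⟩ | h := hcases k
    · rw [shortLen_coe, bridgeIdx_succ]; exact (hlen k).1
    · rw [shortLen_of_ge h, mul_zero]; exact (Γ.n_pos _).le
  · obtain ⟨k, rfl⟩ | h := hcases k
    · rw [bridgeIdx_castSucc, bridgeIdx_succ]; exact (hlen k).2.2
    · rw [bridgeIdx_of_ge h, bridgeIdx_of_ge (by omega)]
  · obtain ⟨k, rfl⟩ | h := hcases k
    · have haff : ∀ i, φ i (Γ.bridgeR k.castSucc) =
          φ i (Γ.bridgeL k.castSucc) + slope (φ i) k.castSucc * Γ.n k.castSucc := by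
        intro i
        have := (S.bridge_affine i k.castSucc).1 _ ⟨(Γ.n_pos _).le, le_rfl⟩
        rwa [bridgePt_len] at this
      have h1 := abs_le.1 (S.abs_change_le p.1.1 0 k (hΓ.2 k).1)
      have h2 := abs_le.1 (S.abs_change_le p.1.2 0 k (hΓ.2 k).1)
      rw [haff p.1.1] at h1
      rw [haff p.1.2] at h2
      simp only [bridgeValue, loopDrift, pairSlope, slopes, Finset.sum_range_succ,
        bridgeIdx_castSucc, bridgeIdx_succ, shortLen_coe, dif_pos k.2, Fin.eta]
      rw [abs_le]
      push_cast
      constructor <;> linarith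
    · omega

theorem exists_loopWin (hΓ : Γ.Admissible 1000) {k : ℕ} (hk : k < g)
    (hjump : slopes φ (k + 1) ≠ slopes φ k) {A : Finset IdxPair} (hA : A.Nonempty)
    (hcard : A.card ≤ 3) {τ : ℤ} (hτ : ∀ p ∈ A, pairSlope (slopes φ (k + 1)) p = τ) :
    ∃ p ∈ A, LoopWin Γ.shortLen (bridgeValue φ) (pointValues φ) k p A := by
  lift k to Fin g using hk
  obtain ⟨j, hj⟩ := Function.ne_iff.1 hjump
  simp only [slopes, pairSlope, bridgeIdx_castSucc, bridgeIdx_succ] at hj hτ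
  have hj' := (S.slope_succ j k).resolve_left hj
  have hm := Γ.m_pos k
  have hlm := (hΓ.2 k).1
  set α : Fin 7 → ℤ := fun i => slope (φ i) k.succ - slope (φ j) k.succ with hα
  have hα9 : ∀ i, |α i| ≤ 9 := fun i => S.abs_slope_sub_le i j _
  obtain ⟨p, hpA, c, hc, hwin⟩ := exists_loop_winner (α := α) (τ := τ - 2 * slope (φ j) k.succ)
    (fun a b hab => sub_lt_sub_right (S.slope_strictMono k.succ hab) _)
    (fun i hi => by
      -- Two of the functions would have the same slope on one of the two bridges at the loop.
      rcases S.slope_succ i k with h | h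
      · have := (S.slope_strictMono k.castSucc).injective (a₁ := i) (a₂ := j)
          (by simp only [hα] at hi ⊢; omega)
        subst this
        omega
      · obtain rfl := S.jump_unique hlm h hj'
        simp [hα] at hi)
    hα9 hA hcard (fun p hp => by have := hτ p hp; simp only [hα]; omega)
  -- Both kinds of winning points are handled by the same computation.
  have key : ∀ (x : Γ.Point) (f : Fin 7 → ℤ), (∀ i, |f i| ≤ 10) →
      (∀ i, (φ i x - φ i (Γ.bridgeL k.succ)) - (φ j x - φ j (Γ.bridgeL k.succ)) = Γ.m k * f i) →
      (∀ q ∈ A, q ≠ p → f p.1.1 + f p.1.2 + 1 ≤ f q.1.1 + f q.1.2) →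
      LoopWin Γ.shortLen (bridgeValue φ) (pointValues φ) k p A := by
    intro x f hf hx hw
    have hu : ∀ q : IdxPair, φ q.1.1 x + φ q.1.2 x + (-loopDrift (φ 0) (k + 1) -
        2 * (φ j x - φ j (Γ.bridgeL k.succ))) - bridgeValue φ (k + 1) q =
        Γ.m k * (f q.1.1 + f q.1.2) := by
      intro q
      rw [bridgeValue, bridgeIdx_succ]
      linarith [hx q.1.1, hx q.1.2]
    refine ⟨fun q => φ q.1.1 x + φ q.1.2 x + (-loopDrift (φ 0) (k + 1) -
      2 * (φ j x - φ j (Γ.bridgeL k.succ))), ⟨x, _, fun q => rfl⟩, fun q => ?_, fun q hq hqp => ?_⟩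
    · rw [hu, shortLen_coe, abs_mul, abs_of_pos hm]
      have h1 := abs_le.1 (hf q.1.1)
      have h2 := abs_le.1 (hf q.1.2)
      have h3 : |f q.1.1 + f q.1.2| ≤ 20 := abs_le.2 ⟨by omega, by omega⟩
      have h4 : |(f q.1.1 : ℝ) + f q.1.2| ≤ 20 := by exact_mod_cast h3
      nlinarith
    · rw [hu, hu, shortLen_coe]
      have h1 : (f p.1.1 : ℝ) + f p.1.2 + 1 ≤ f q.1.1 + f q.1.2 := by exact_mod_cast hw q hq hqp
      nlinarith
  refine ⟨p, hpA, ?_⟩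
  rcases hwin with hwin | hwin
  · exact key _ _ (fun i => abs_nearLeft_le (hα9 i)) (fun i => (S.loop_values hlm hj' i hc).1) hwin
  · exact key _ _ (fun i => abs_nearRight_le (hα9 i)) (fun i => (S.loop_values hlm hj' i hc).2) hwin

theorem exists_maximallyIndependent (hΓ : Γ.Admissible 1000) :
    ∃ c : IdxPair → ℝ, TropicalCombination.MaximallyIndependent
      (fun (p : IdxPair) (x : Γ.Point) => φ p.1.1 x + φ p.1.2 x) c := by
  obtain ⟨c, hc⟩ := exists_separating_coeff (U := pointValues φ) (S.bridgeValues hΓ)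
    (S.slopePath hΓ) (fun k _ t ht => ⟨Γ.bridgePt (bridgeIdx g k) t, -loopDrift (φ 0) k, fun p => by
      rw [(S.bridge_affine p.1.1 _).1 t ht, (S.bridge_affine p.1.2 _).1 t ht]
      simp only [bridgeValue, pairSlope, slopes]
      push_cast
      ring⟩)
    (fun k hk hj A hA hcard τ hτ => S.exists_loopWin hΓ hk hj hA hcard hτ)
  refine ⟨c, fun p => ?_⟩
  obtain ⟨u, ⟨x, b, hu⟩, h⟩ := hc p
  have hlt : ∀ q, q ≠ p → φ p.1.1 x + φ p.1.2 x + c p < φ q.1.1 x + φ q.1.2 x + c q := by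
    intro q hq
    have := h q hq
    rw [hu, hu] at this
    linarith
  refine ⟨x, fun q => ?_, fun q hq hach => (hach p).not_gt (hlt q hq)⟩
  rcases eq_or_ne q p with rfl | hq
  exacts [le_rfl, (hlt q hq).le]

end VASystem

end ChainOfLoops

/-! ### Tropical independence -/

/-- Given a maximally independent combination and other coefficients, consider the index for which
the coefficient drops the most: where it achieves the minimum uniquely for the old coefficients, it
still does so for the new ones. -/
theorem TropicalCombination.MaximallyIndependent.not_tropicallyDependent {X ι : Type} [Finite ι]
    [Nonempty ι] {ψ : ι → X → ℝ} {c : ι → ℝ} (h : MaximallyIndependent ψ c) :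
    ¬ TropicallyDependent ψ := by
  rintro ⟨c', hc'⟩
  obtain ⟨i, hi⟩ := Finite.exists_min fun i => c' i - c i
  obtain ⟨x, hx, hx'⟩ := h i
  have hlt : ∀ j, j ≠ i → ψ i x + c' i < ψ j x + c' j := by
    intro j hj
    have h1 : ψ i x + c i < ψ j x + c j :=
      lt_of_le_of_ne (hx j) fun he => hx' j hj fun k => he ▸ hx k
    linarith [hi j]
  obtain ⟨j, k, hjk, hj, hk⟩ := hc' x
  rcases eq_or_ne j i with rfl | hji
  · exact (hk j).not_gt (hlt k hjk.symm)
  · exact (hj i).not_gt (hlt j hji)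

theorem theorem5p1 (ρ : ℕ) :
    ∃ C : ℝ, 0 < C ∧ ∀ Γ : ChainOfLoops (21 + ρ), Γ.Admissible C →
      ∀ D : Γ.graph.Divisor, Γ.IsBreak D → Γ.graph.degree D = 24 + (ρ : ℤ) →
      Γ.graph.HasRank D 6 → Γ.VertexAvoiding D 6 →
      ∀ (E : Fin 7 → Γ.graph.Divisor) (φ : Fin 7 → Γ.Point → ℝ),
        (∀ i : Fin 7, Γ.IsDistinguished D 6 i (E i)) →
        (∀ i : Fin 7, Γ.graph.Moves (φ i) D (E i)) →
        (∃ c : {p : Fin 7 × Fin 7 // p.1 ≤ p.2} → ℝ,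
          TropicalCombination.MaximallyIndependent
            (fun (p : {p : Fin 7 × Fin 7 // p.1 ≤ p.2}) (x : Γ.Point) =>
              φ p.1.1 x + φ p.1.2 x) c) ∧
        ¬ TropicalCombination.TropicallyDependent
            (fun (p : {p : Fin 7 × Fin 7 // p.1 ≤ p.2}) (x : Γ.Point) =>
              φ p.1.1 x + φ p.1.2 x) := by
  refine ⟨1000, by norm_num, fun Γ hΓ D hD hdeg _ hVA E φ hE hφ => ?_⟩
  have S : ChainOfLoops.VASystem Γ D E φ :=
    ⟨hD, by rw [hdeg]; push_cast; ring, fun i => hVA i (by omega), hE, hφ⟩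
  obtain ⟨c, hc⟩ := S.exists_maximallyIndependent hΓ
  have : Nonempty {p : Fin 7 × Fin 7 // p.1 ≤ p.2} := ⟨⟨(0, 0), le_rfl⟩⟩
  exact ⟨⟨c, hc⟩, hc.not_tropicallyDependent⟩
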